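/- Let $\mathbb R^{4,2}$ be $\mathbb R^6$ with a symmetric bilinear form $(\,,)$ of signature $(4,2)$, and let $\Sigma$ be a smooth surface (2-manifold). Subbundles of $\Sigma\times\mathbb R^{4,2}$ are smooth, and $d$ is the trivial connection. A subbundle $E$ is constant along a distribution $T$ if $d_X\sigma\in E$ for all $\sigma\in\Gamma E$, $X\in T$. A *Legendre map* is a null rank $2$ subbundle $f$ such that $d\sigma\perp f$ for all $\sigma\in\Gamma f$, and such that $X\in T_x\Sigma$ with $d_X\sigma\in f(x)$ for all $\sigma\in\Gamma f$ implies $X=0$. A line $s\le f(x)$ is a *curvature sphere* of $f$ at $x$ if its *curvature space* $T_s=\{X\in T_x\Sigma: d_X\sigma\in f(x)\text{ for all }\sigma\in\Gamma f\text{ with }\sigma(x)\in s\}$ is non-zero; $x$ is *umbilic* if there is exactly one curvature sphere at $x$. If $f$ is umbilic-free, it is *regular* if its curvature sphere congruences immerse (as maps into projective space), and it is a *channel surface* if it has a curvature sphere congruence $s$ that is constant along its own curvature spaces $T_s$. Two umbilic-free Legendre maps $f,\hat f$ are *Ribaucour transforms* of each other if $f\cap\hat f$ is a rank $1$ subbundle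 and their curvature spaces coincide at each point. Let $T$ be a smooth rank $1$ distribution consisting of curvature spaces of $f$. The leaves of $T$ are *spherical curvature lines* of $f$ if for some $\mathfrak p$ with $(\mathfrak p,\mathfrak p)<0$ there is a null rank $1$ subbundle $\nu$, constant along $T$, with $\nu\perp f\cap\mathfrak p^\perp$ and with $(\nu\oplus\langle\mathfrak p\rangle)\cap f=\{0\}$ (the spheres meet the surface transversally). For a spacelike rank $1$ subbundle $L$, let $\mathcal D^L$ be the sum of the connections induced by $d$ on $L$ and $L^\perp$. **Theorem.** Let $f$ be a regular umbilic-free Legendre map on $\Sigma$ and let the leaves of $T$ be spherical curvature lines of $f$. Then there is a unique spacelike rank $1$ subbundle $L\le f^\perp$ that is constant along $T$, and $\mathcal D^L$ is flat. Locally, $f$ is a Ribaucour transform of a $3$-parameter family of channel surfaces, obtained from parallel null lines of $\mathcal D^L$ that are orthogonal to $L$. Precisely: 1. Every $x_0\in\Sigma$ has an open neighbourhood $U$ for which there are a non-empty open set $\Omega\subset\mathbb R^3$ and a smooth map $w:\Omega\times U\to\mathbb R^{4,2}\setminus\{0\}$ such that for every $x\in U$ the map $a\mapsto\langle w(a,x)\rangle$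 from $\Omega$ to projective space is an immersion, and such that for every $a\in\Omega$ the line bundle $\hat s_a=\langle w(a,\cdot)\rangle$ is null, parallel for $\mathcal D^L$, orthogonal to $L$ and satisfies $\hat s_a\cap f=\{0\}$, and $$\hat f_a=(f\cap\hat s_a^\perp)\oplus\hat s_a$$ is a channel surface on $U$ and a Ribaucour transform of $f|_U$. Moreover $\hat f_a\neq\hat f_b$ for $a\ne b$. 2. If $U\subset\Sigma$ is open and $\hat s$ is any null rank $1$ subbundle over $U$ that is parallel for $\mathcal D^L$, orthogonal to $L$, nowhere orthogonal to the curvature sphere of $f$ with curvature space $T$, and nowhere stationary (at no $x\in U$ is $d_X\sigma\in\hat s(x)$ for all $X\in T_x\Sigma$ and all $\sigma\in\Gamma\hat s$), then $\hat f=(f\cap\hat s^\perp)\oplus\hat s$ is a channel surface on $U$ and a Ribaucour transform of $f|_U$. -/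

import Mathlib

open Set Topology
open scoped Manifold ContDiff

noncomputable section

namespace LieSphere

/-- The vector space underlying `ℝ^{4,2}`. -/
abbrev R42 : Type := EuclideanSpace ℝ (Fin 6)

/-- The symmetric bilinear form `( , )` of signature `(4,2)`. -/
def form : LinearMap.BilinForm ℝ R42 :=
  LinearMap.mk₂ ℝ
    (fun v w => v 0 * w 0 + v 1 * w 1 + v 2 * w 2 + v 3 * w 3 - v 4 * w 4 - v 5 * w 5)
    (by intros; simp only [PiLp.add_apply]; ring)
    (by intros; simp only [PiLp.smul_apply, smul_eq_mul]; ring)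
    (by intros; simp only [PiLp.add_apply]; ring)
    (by intros; simp only [PiLp.smul_apply, smul_eq_mul]; ring)

/-- The orthogonal complement with respect to `form`. -/
def perp (E : Submodule ℝ R42) : Submodule ℝ R42 := form.orthogonal E

/-- `E` is null: the form vanishes identically on `E`. -/
def IsNull (E : Submodule ℝ R42) : Prop := E ≤ perp E

/-- `E` is spacelike: the form is positive definite on `E`. -/
def IsSpacelike (E : Submodule ℝ R42) : Prop := ∀ v ∈ E, v ≠ 0 → 0 < form v v

open Classical in
/-- The projection onto `E` along `perp E`, for subspaces on which the form is nondegenerate. -/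
def orthProj (E : Submodule ℝ R42) : R42 →ₗ[ℝ] R42 :=
  if h : IsCompl E (perp E) then Submodule.projection E (perp E) h else 0

section Bundles

variable {M : Type*} [TopologicalSpace M] [ChartedSpace (EuclideanSpace ℝ (Fin 2)) M]

/-- The differential at `x` of an `ℝ^{4,2}`-valued map on the surface `M`. -/
def dAt (σ : M → R42) (x : M) : TangentSpace (𝓡 2) x →L[ℝ] R42 :=
  mfderiv (𝓡 2) 𝓘(ℝ, R42) σ x

/-- `E` is a smooth rank `r` subbundle over `U` of the trivial bundle `M × ℝ^{4,2}`
(equivalently, a smooth map from `U` to the Grassmannian of `r`-planes). -/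
def IsSubbundleOn (r : ℕ) (U : Set M) (E : M → Submodule ℝ R42) : Prop :=
  (∀ x ∈ U, Module.finrank ℝ (E x) = r) ∧
  ∀ x ∈ U, ∃ W : Set M, IsOpen W ∧ x ∈ W ∧ W ⊆ U ∧ ∃ σ : Fin r → M → R42,
    (∀ i, ContMDiffOn (𝓡 2) 𝓘(ℝ, R42) ∞ (σ i) W) ∧
    ∀ y ∈ W, E y = Submodule.span ℝ (range fun i => σ i y)

/-- `σ` is a smooth section of `E` on a neighbourhood of `x`. -/
structure IsSectionNear (E : M → Submodule ℝ R42) (x : M) (σ : M → R42) : Prop where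
  smooth : ∀ᶠ y in 𝓝 x, ContMDiffAt (𝓡 2) 𝓘(ℝ, R42) ∞ σ y
  mem : ∀ᶠ y in 𝓝 x, σ y ∈ E y

/-- `f` restricts to a Legendre map from the open set `U` to the Grassmannian of null `2`-planes:
a smooth null rank `2` subbundle with `f^{(1)} ≤ f^⊥` and the immersion condition. -/
structure IsLegendreOn (U : Set M) (f : M → Submodule ℝ R42) : Prop where
  subbundle : IsSubbundleOn 2 U f
  null : ∀ x ∈ U, IsNull (f x)
  contact : ∀ x ∈ U, ∀ σ, IsSectionNear f x σ → ∀ X, dAt σ x X ∈ perp (f x)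
  immersed : ∀ x ∈ U, ∀ X : TangentSpace (𝓡 2) x,
    (∀ σ, IsSectionNear f x σ → dAt σ x X ∈ f x) → X = 0

/-- The tangent vectors `X` at `x` with `d_X σ ∈ f(x)` for all sections `σ` of `f` with
`σ(x) ∈ s`; for a curvature sphere `s` of `f` at `x` this is its curvature space. -/
def curvatureSpace (f : M → Submodule ℝ R42) (x : M) (s : Submodule ℝ R42) :
    Submodule ℝ (TangentSpace (𝓡 2) x) where
  carrier := {X | ∀ σ, IsSectionNear f x σ → σ x ∈ s → dAt σ x X ∈ f x}
  add_mem' := fun hX hY σ hσ hs => by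
    rw [map_add]; exact add_mem (hX σ hσ hs) (hY σ hσ hs)
  zero_mem' := fun σ _ _ => by rw [map_zero]; exact zero_mem _
  smul_mem' := fun c X hX σ hσ hs => by
    rw [map_smul]; exact Submodule.smul_mem _ c (hX σ hσ hs)

/-- The line `s ≤ f(x)` is a curvature sphere of `f` at `x`. -/
structure IsCurvatureSphere (f : M → Submodule ℝ R42) (x : M) (s : Submodule ℝ R42) : Prop where
  rank_one : Module.finrank ℝ s = 1
  le : s ≤ f x
  space_ne_bot : curvatureSpace f x s ≠ ⊥

/-- No point of `U` is umbilic; a point is umbilic if there is exactly one curvature sphere. -/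
def IsUmbilicFreeOn (U : Set M) (f : M → Submodule ℝ R42) : Prop :=
  ∀ x ∈ U, ¬ ∃! s, IsCurvatureSphere f x s

/-- The curvature spaces of `f` at `x`. -/
def curvatureDirections (f : M → Submodule ℝ R42) (x : M) :
    Set (Submodule ℝ (TangentSpace (𝓡 2) x)) :=
  {T | ∃ s, IsCurvatureSphere f x s ∧ curvatureSpace f x s = T}

/-- `s` is a smooth curvature sphere congruence of `f` over `U`. -/
def IsCurvatureSphereCongruenceOn (U : Set M) (f s : M → Submodule ℝ R42) : Prop :=
  IsSubbundleOn 1 U s ∧ ∀ x ∈ U, IsCurvatureSphere f x (s x)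

/-- The rank one subbundle `s`, as a map into projective space, is an immersion on `U`. -/
def ImmersesOn (U : Set M) (s : M → Submodule ℝ R42) : Prop :=
  ∀ x ∈ U, ∀ X : TangentSpace (𝓡 2) x,
    (∀ σ, IsSectionNear s x σ → dAt σ x X ∈ s x) → X = 0

/-- `f` is regular: all its (locally defined) curvature sphere congruences immerse. -/
def IsRegular (f : M → Submodule ℝ R42) : Prop :=
  ∀ (U : Set M) (s : M → Submodule ℝ R42), IsOpen U →
    IsCurvatureSphereCongruenceOn U f s → ImmersesOn U s

/-- The subbundle `E` is constant along the distribution `T` over `U`. -/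
def IsConstantAlong (U : Set M) (T : ∀ x : M, Submodule ℝ (TangentSpace (𝓡 2) x))
    (E : M → Submodule ℝ R42) : Prop :=
  ∀ x ∈ U, ∀ X ∈ T x, ∀ σ, IsSectionNear E x σ → dAt σ x X ∈ E x

/-- `f` is a channel surface over `U`: an umbilic-free Legendre map with a curvature sphere
congruence that is constant along the leaves of its own curvature subbundle. -/
structure IsChannelSurfaceOn (U : Set M) (f : M → Submodule ℝ R42) : Prop where
  legendre : IsLegendreOn U f
  umbilicFree : IsUmbilicFreeOn U f
  channel : ∃ s, IsCurvatureSphereCongruenceOn U f s ∧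
    IsConstantAlong U (fun x => curvatureSpace f x (s x)) s

/-- The umbilic-free Legendre maps `f` and `g` are Ribaucour transforms of each other over `U`:
they envelop a common sphere congruence `f ∩ g`, and their curvature lines correspond. -/
structure IsRibaucourPairOn (U : Set M) (f g : M → Submodule ℝ R42) : Prop where
  legendre_left : IsLegendreOn U f
  legendre_right : IsLegendreOn U g
  umbilicFree_left : IsUmbilicFreeOn U f
  umbilicFree_right : IsUmbilicFreeOn U g
  common_sphere : IsSubbundleOn 1 U (fun x => f x ⊓ g x)
  curvature_lines : ∀ x ∈ U, curvatureDirections f x = curvatureDirections g x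

/-- `T` is a smooth rank one distribution on `M`. -/
def IsLineDistribution [IsManifold (𝓡 2) ∞ M] (T : ∀ x : M, Submodule ℝ (TangentSpace (𝓡 2) x)) : Prop :=
  ∀ x : M, ∃ W : Set M, IsOpen W ∧ x ∈ W ∧ ∃ X : ∀ y : M, TangentSpace (𝓡 2) y,
    ContMDiffOn (𝓡 2) (𝓡 2).tangent ∞ (fun y => (⟨y, X y⟩ : TangentBundle (𝓡 2) M)) W ∧
    ∀ y ∈ W, X y ≠ 0 ∧ T y = Submodule.span ℝ {X y}

/-- The leaves of `T` are spherical curvature lines of `f`. The integral curves of `T` are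
curvature lines, and, in the conformal geometry of some timelike point sphere complex `p`, the
point sphere map `f ∩ p^⊥` lies on spheres `ν`, constant along `T`, which meet the surface
transversally: neither of the two oriented spheres in `ν ⊕ ⟨p⟩` is in oriented contact with
(equivalently, contained in) `f`. -/
structure HasSphericalCurvatureLines [IsManifold (𝓡 2) ∞ M] (f : M → Submodule ℝ R42)
    (T : ∀ x : M, Submodule ℝ (TangentSpace (𝓡 2) x)) : Prop where
  distribution : IsLineDistribution T
  curvature : ∀ x, T x ∈ curvatureDirections f x
  spherical : ∃ (p : R42) (ν : M → Submodule ℝ R42), form p p < 0 ∧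
    IsSubbundleOn 1 univ ν ∧ (∀ x, IsNull (ν x)) ∧ IsConstantAlong univ T ν ∧
    (∀ x, f x ⊓ perp (Submodule.span ℝ {p}) ≤ perp (ν x)) ∧
    ∀ x, (ν x ⊔ Submodule.span ℝ {p}) ⊓ f x = ⊥

/-- `L` is a spacelike rank one subbundle of `f^⊥` that is constant along `T`. -/
structure IsSphereComplexAlong (f : M → Submodule ℝ R42)
    (T : ∀ x : M, Submodule ℝ (TangentSpace (𝓡 2) x)) (L : M → Submodule ℝ R42) : Prop where
  subbundle : IsSubbundleOn 1 univ L
  spacelike : ∀ x, IsSpacelike (L x)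
  le_perp : ∀ x, L x ≤ perp (f x)
  constant : IsConstantAlong univ T L

/-- The connection `D^L`, the sum of the connections induced by `d` on `L` and `L^⊥`:
the value at `X ∈ T_x M` of `D^L σ`. -/
def connD (L : M → Submodule ℝ R42) (σ : M → R42) (x : M) (X : TangentSpace (𝓡 2) x) : R42 :=
  orthProj (L x) (dAt (fun y => orthProj (L y) (σ y)) x X) +
  orthProj (perp (L x)) (dAt (fun y => orthProj (perp (L y)) (σ y)) x X)

/-- `D^L` is flat: near every point there are parallel sections with arbitrary value there. -/
def IsFlat (L : M → Submodule ℝ R42) : Prop :=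
  ∀ x : M, ∃ W : Set M, IsOpen W ∧ x ∈ W ∧ ∀ w : R42, ∃ σ : M → R42, σ x = w ∧
    ContMDiffOn (𝓡 2) 𝓘(ℝ, R42) ∞ σ W ∧ ∀ y ∈ W, ∀ X, connD L σ y X = 0

/-- `s` is a null rank one subbundle over `U`, parallel for `D^L` and orthogonal to `L`. -/
structure IsParallelNullLineOn (U : Set M) (L s : M → Submodule ℝ R42) : Prop where
  subbundle : IsSubbundleOn 1 U s
  null : ∀ x ∈ U, IsNull (s x)
  parallel : ∀ x ∈ U, ∀ σ, IsSectionNear s x σ → ∀ X, connD L σ x X ∈ s x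
  orthogonal : ∀ x ∈ U, s x ≤ perp (L x)

/-- The bundle `s₀ ⊕ s`, where `s₀ = f ∩ s^⊥`. -/
def transform (f s : M → Submodule ℝ R42) (x : M) : Submodule ℝ R42 :=
  (f x ⊓ perp (s x)) ⊔ s x

/-- `w` is a smooth family, with parameters in `Ω ⊆ ℝ³`, of nowhere vanishing maps on `U` such
that the parameter is effective: for all `x ∈ U`, the line spanned by `w a x` depends immersively
on the parameter `a`. -/
structure IsThreeParameterFamilyOn (Ω : Set (EuclideanSpace ℝ (Fin 3))) (U : Set M)
    (w : EuclideanSpace ℝ (Fin 3) → M → R42) : Prop where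
  smooth : ContMDiffOn (𝓘(ℝ, EuclideanSpace ℝ (Fin 3)).prod (𝓡 2)) 𝓘(ℝ, R42) ∞
    (fun q : EuclideanSpace ℝ (Fin 3) × M => w q.1 q.2) (Ω ×ˢ U)
  ne_zero : ∀ a ∈ Ω, ∀ x ∈ U, w a x ≠ 0
  immersive : ∀ a ∈ Ω, ∀ x ∈ U, ∀ ξ : EuclideanSpace ℝ (Fin 3),
    fderiv ℝ (fun b => w b x) a ξ ∈ Submodule.span ℝ {w a x} → ξ = 0

end Bundles

end LieSphere

end

/-! ### Linear algebra of signature (4,2) -/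

noncomputable section

namespace LieSphere

/-! Everything rests on `perp (f x) / f x` being a positive definite plane (`form_self_pos`,
`mem_of_orthogonal_pair`). At every point there are a frame `σ`, `τ` of `f` and tangent vectors `X`
∈ `T`, `Y` such that `d_X σ` and `d_Y τ` lie in `f`; the symmetry `form_drv_comm` then makes `d_Y σ`
and `d_X τ` an orthogonal basis of that plane (`IsCurvatureFrame`).

Existence of `L`. The bundle ν ⊕ ⟨p⟩ is constant along `T`, and f ∩ p^⊥ is orthogonal to all of it.
Orthogonality to `f` is therefore a single linear condition, and L = (ν ⊕ ⟨p⟩) ∩ f^⊥ is a line,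
spacelike by transversality. Where the curvature sphere `σ` of `T` is not orthogonal to `p`,
differentiating (l, σ) = 0 along `T` keeps `d_X l` orthogonal to `f`. Such points are dense: on an
open set where `σ` spans the point sphere map, its derivatives along `T` would stay in f ∩ p^⊥,
against regularity. Continuity covers the remaining points.

Uniqueness. A unit section `l` of such a bundle has `d_X l = 0` along `T`, hence is orthogonal to
`d_X τ`. For two of them, m - (m, l) l lies in `f` and is stationary along `T`; by regularity it
vanishes.

Flatness. The differential of `l` has rank one and kernel `T`, so locally l = γ ∘ v for a curve γ
and a function v (`exists_factor_of_rank_one`). Parallel transport is the solution of the linear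
equation Φ' = (γ ∧ γ') Φ composed with v (`exists_parallel_transport`).

Transforms. A parallel null `w` orthogonal to `l` satisfies dw = k w - (w, dl) l. Along `T` this is
a multiple of `w`, so ŝ = ⟨w⟩ is a curvature sphere of f̂, constant along its curvature space. Along
`Y`, the derivatives of `w` and of the section spanning f ∩ ŝ^⊥ are both multiples of `l` modulo f̂.
As (w, d_Y l) ≠ 0, a combination of the two sections has derivative in f̂, and `Y` is the other
curvature direction (`transform_curvatureFrame`).

The family. Null lines in l(x)^⊥ not orthogonal to σ(x) are parametrised by a three-dimensional
space, as in an affine chart of a quadric, and are carried along by parallel transport. General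
position is an open condition (`exists_transport_family`). Finally f̂ determines ŝ, as its curvature
sphere with curvature space `T`. -/

theorem form_apply (v w : R42) : form v w =
    v 0 * w 0 + v 1 * w 1 + v 2 * w 2 + v 3 * w 3 - v 4 * w 4 - v 5 * w 5 := rfl

theorem form_comm (v w : R42) : form v w = form w v := by
  simp only [form_apply]; ring

theorem form_isRefl : form.IsRefl := fun v w h => by rw [form_comm, h]

theorem form_nondegenerate : form.Nondegenerate := by
  have key : ∀ v : R42, (∀ w, form v w = 0) → v = 0 := by
    intro v h
    ext i
    have := h (EuclideanSpace.single i 1)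
    fin_cases i <;> simpa [form_apply] using this
  exact ⟨key, fun v h => key v fun w => by rw [form_comm]; exact h w⟩

theorem mem_perp {E : Submodule ℝ R42} {v : R42} : v ∈ perp E ↔ ∀ w ∈ E, form w v = 0 := Iff.rfl

theorem mem_perp_span_singleton {u v : R42} :
    v ∈ perp (Submodule.span ℝ {u}) ↔ form u v = 0 := by
  rw [mem_perp]
  constructor
  · intro h; exact h u (Submodule.mem_span_singleton_self u)
  · intro h w hw
    obtain ⟨c, rfl⟩ := Submodule.mem_span_singleton.1 hw
    simp [h]

theorem mem_perp_span_pair {u u' v : R42} :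
    v ∈ perp (Submodule.span ℝ {u, u'}) ↔ form u v = 0 ∧ form u' v = 0 := by
  rw [mem_perp]
  constructor
  · intro h
    exact ⟨h u (Submodule.subset_span (by simp)), h u' (Submodule.subset_span (by simp))⟩
  · rintro ⟨h, h'⟩ w hw
    obtain ⟨c, c', rfl⟩ := Submodule.mem_span_pair.1 hw
    simp [h, h']

theorem finrank_R42 : Module.finrank ℝ R42 = 6 := by simp

theorem finrank_perp (E : Submodule ℝ R42) :
    Module.finrank ℝ (perp E) = 6 - Module.finrank ℝ E := by
  rw [perp, LinearMap.BilinForm.finrank_orthogonal form_nondegenerate, finrank_R42]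

/-- A subspace of `ℝ^{4,2}` on which the form is nonpositive has dimension at most two. -/
theorem finrank_le_two_of_nonpos {E : Submodule ℝ R42} (h : ∀ v ∈ E, form v v ≤ 0) :
    Module.finrank ℝ E ≤ 2 := by
  -- The two negative coordinates embed `E`: a vector on which both vanish has nonnegative square,
  -- so it is zero.
  let g : R42 →ₗ[ℝ] (Fin 2 → ℝ) :=
    { toFun := fun v => ![v 4, v 5]
      map_add' := fun v w => by ext i; fin_cases i <;> simp
      map_smul' := fun c v => by ext i; fin_cases i <;> simp }
  have hinj : Function.Injective (g.comp E.subtype) := by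
    rw [← LinearMap.ker_eq_bot, LinearMap.ker_eq_bot']
    rintro ⟨v, hv⟩ h0
    have h4 : v 4 = 0 := congrFun h0 0
    have h5 : v 5 = 0 := congrFun h0 1
    have := h v hv
    rw [form_apply, h4, h5] at this
    ext i
    fin_cases i <;> simp <;> first | assumption | nlinarith [sq_nonneg (v 0), sq_nonneg (v 1), sq_nonneg (v 2), sq_nonneg (v 3)]
  simpa using LinearMap.finrank_le_finrank_of_injective hinj

/-- For a null plane `E`, the form induced on `perp E / E` is positive definite. -/
theorem form_self_pos {E : Submodule ℝ R42} (hE : IsNull E) (h2 : Module.finrank ℝ E = 2)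
    {v : R42} (hv : v ∈ perp E) (hvE : v ∉ E) : 0 < form v v := by
  by_contra! hle
  -- Otherwise the form would be nonpositive on a three-dimensional space.
  have hnp : ∀ w ∈ E ⊔ Submodule.span ℝ {v}, form w w ≤ 0 := by
    intro w hw
    obtain ⟨e, he, u, hu, rfl⟩ := Submodule.mem_sup.1 hw
    obtain ⟨c, rfl⟩ := Submodule.mem_span_singleton.1 hu
    have h1 : form e e = 0 := hE he e he
    have h2 : form e v = 0 := hv e he
    have h3 : form v e = 0 := by rw [form_comm, h2]
    simp only [map_add, LinearMap.add_apply, map_smul, LinearMap.smul_apply, smul_eq_mul, h1, h2, h3]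
    nlinarith [mul_nonneg (mul_self_nonneg c) (neg_nonneg.2 hle)]
  have h3 := finrank_le_two_of_nonpos hnp
  have hlt : E < E ⊔ Submodule.span ℝ {v} := by
    refine lt_of_le_of_ne le_sup_left fun heq => hvE ?_
    rw [heq]
    exact Submodule.mem_sup_right (Submodule.mem_span_singleton_self v)
  have := Submodule.finrank_lt_finrank_of_lt hlt
  omega

/-- For a null plane `E`, the quotient `perp E / E` is two-dimensional. -/
theorem mem_of_orthogonal_pair {E : Submodule ℝ R42} (hE : IsNull E)
    (h2 : Module.finrank ℝ E = 2) {a b v : R42} (ha : a ∈ perp E) (hb : b ∈ perp E)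
    (hv : v ∈ perp E) (haE : a ∉ E) (hbE : b ∉ E) (hab : form a b = 0)
    (hav : form a v = 0) (hbv : form b v = 0) : v ∈ E := by
  by_contra hvE
  have haa := form_self_pos hE h2 ha haE
  have hbb := form_self_pos hE h2 hb hbE
  have hvv := form_self_pos hE h2 hv hvE
  have hba : form b a = 0 := by rw [form_comm, hab]
  have hva : form v a = 0 := by rw [form_comm, hav]
  have hvb : form v b = 0 := by rw [form_comm, hbv]
  -- Three mutually orthogonal vectors of positive square span a space `P` meeting the null plane
  -- `E` trivially, so `E ⊔ P` would have dimension five inside the four-dimensional `perp E`.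
  have hli : LinearIndependent ℝ ![a, b, v] := by
    rw [Fintype.linearIndependent_iff]
    intro g hg
    simp only [Fin.sum_univ_three, Matrix.cons_val_zero, Matrix.cons_val_one,
      Matrix.cons_val] at hg
    have e1 := congrArg (form a) hg
    have e2 := congrArg (form b) hg
    have e3 := congrArg (form v) hg
    simp only [map_add, map_smul, smul_eq_mul, map_zero, hab, hav, hbv, hba, hva, hvb, mul_zero,
      add_zero, zero_add] at e1 e2 e3
    intro i
    fin_cases i
    · simpa [haa.ne'] using e1
    · simpa [hbb.ne'] using e2
    · simpa [hvv.ne'] using e3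
  set P := Submodule.span ℝ (range ![a, b, v]) with hP
  have hPr : Module.finrank ℝ P = 3 := by simpa using finrank_span_eq_card hli
  have hPle : P ≤ perp E := by
    rw [hP, Submodule.span_le]
    rintro _ ⟨i, rfl⟩
    fin_cases i
    exacts [ha, hb, hv]
  have hEle : E ≤ perp E := hE
  have hinf : E ⊓ P = ⊥ := by
    rw [eq_bot_iff]
    rintro w ⟨hwE, hwP⟩
    obtain ⟨c, rfl⟩ := (Submodule.mem_span_range_iff_exists_fun ℝ).1 hwP
    have hw0 := hE hwE
    rw [mem_perp] at ha hb hv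
    have e1 := ha _ hwE
    have e2 := hb _ hwE
    have e3 := hv _ hwE
    simp only [Fin.sum_univ_three, Matrix.cons_val_zero, Matrix.cons_val_one,
      Matrix.cons_val, map_add, map_smul, smul_eq_mul, hab, hav, hbv, hba, hva, hvb, mul_zero,
      add_zero, zero_add, LinearMap.add_apply, LinearMap.smul_apply, mul_eq_zero, haa.ne',
      hbb.ne', hvv.ne', or_false] at e1 e2 e3
    simp [Fin.sum_univ_three, e1, e2, e3]
  have hsup := Submodule.finrank_sup_add_finrank_inf_eq E P
  rw [hinf, finrank_bot, hPr, h2] at hsup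
  have := Submodule.finrank_mono (sup_le hEle hPle)
  rw [finrank_perp, h2] at this
  omega

/-- The projection onto a line spanned by a unit vector. -/
theorem orthProj_span_singleton {l : R42} (hl : form l l = 1) (v : R42) :
    orthProj (Submodule.span ℝ {l}) v = form v l • l := by
  have h : IsCompl (Submodule.span ℝ {l}) (perp (Submodule.span ℝ {l})) :=
    LinearMap.BilinForm.isCompl_span_singleton_orthogonal (by rw [hl]; exact one_ne_zero)
  rw [orthProj, dif_pos h]
  have hd : v = form v l • l + (v - form v l • l) := by abel
  have h1 : form v l • l ∈ Submodule.span ℝ {l} :=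
    Submodule.smul_mem _ _ (Submodule.mem_span_singleton_self l)
  have h2 : v - form v l • l ∈ perp (Submodule.span ℝ {l}) := by
    rw [mem_perp_span_singleton]
    simp [hl, form_comm l v]
  conv_lhs => rw [hd, map_add, Submodule.projection_apply_of_mem_left h h1,
    (Submodule.projection_apply_eq_zero_iff h).2 h2, add_zero]

/-- The projection onto the orthogonal complement of a unit vector. -/
theorem orthProj_perp_span_singleton {l : R42} (hl : form l l = 1) (v : R42) :
    orthProj (perp (Submodule.span ℝ {l})) v = v - form v l • l := by
  have h : IsCompl (Submodule.span ℝ {l}) (perp (Submodule.span ℝ {l})) :=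
    LinearMap.BilinForm.isCompl_span_singleton_orthogonal (by rw [hl]; exact one_ne_zero)
  have hpp : perp (perp (Submodule.span ℝ {l})) = Submodule.span ℝ {l} :=
    LinearMap.BilinForm.orthogonal_orthogonal form_nondegenerate form_isRefl _
  have h' : IsCompl (perp (Submodule.span ℝ {l})) (perp (perp (Submodule.span ℝ {l}))) := by
    rw [hpp]; exact h.symm
  rw [orthProj, dif_pos h']
  have hd : v = (v - form v l • l) + form v l • l := by abel
  have h1 : form v l • l ∈ perp (perp (Submodule.span ℝ {l})) := by
    rw [hpp]; exact Submodule.smul_mem _ _ (Submodule.mem_span_singleton_self l)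
  have h2 : v - form v l • l ∈ perp (Submodule.span ℝ {l}) := by
    rw [mem_perp_span_singleton]
    simp [hl, form_comm l v]
  conv_lhs => rw [hd, map_add, Submodule.projection_apply_of_mem_left h' h2,
    (Submodule.projection_apply_eq_zero_iff h').2 h1, add_zero]

/-! ### Differentiation of vector-valued maps on the surface -/

section Calculus

variable {M : Type*} [TopologicalSpace M] [ChartedSpace (EuclideanSpace ℝ (Fin 2)) M]
  {E F G : Type*} [NormedAddCommGroup E] [NormedSpace ℝ E] [NormedAddCommGroup F] [NormedSpace ℝ F]
  [NormedAddCommGroup G] [NormedSpace ℝ G] {x : M}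

/-- The differential at `x` of a map from the surface `M` to a normed space. -/
def drv (g : M → F) (x : M) : TangentSpace (𝓡 2) x →L[ℝ] F :=
  mfderiv (𝓡 2) 𝓘(ℝ, F) g x

theorem dAt_eq_drv (σ : M → R42) (x : M) : dAt σ x = drv σ x := rfl

/-- `g` is smooth on a neighbourhood of `x`. -/
def SmoothNear (g : M → F) (x : M) : Prop :=
  ∀ᶠ y in 𝓝 x, ContMDiffAt (𝓡 2) 𝓘(ℝ, F) ∞ g y

theorem SmoothNear.self {g : M → F} (h : SmoothNear g x) :
    ContMDiffAt (𝓡 2) 𝓘(ℝ, F) ∞ g x := h.self_of_nhds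

theorem SmoothNear.eventually {g : M → F} (h : SmoothNear g x) :
    ∀ᶠ y in 𝓝 x, SmoothNear g y := eventually_eventually_nhds.2 h

theorem SmoothNear.mdiff {g : M → F} (h : SmoothNear g x) :
    MDifferentiableAt (𝓡 2) 𝓘(ℝ, F) g x := h.self.mdifferentiableAt (by simp)

theorem SmoothNear.continuousAt {g : M → F} (h : SmoothNear g x) : ContinuousAt g x :=
  h.self.continuousAt

theorem smoothNear_of_contMDiffOn {g : M → F} {W : Set M} (hW : IsOpen W)
    (h : ContMDiffOn (𝓡 2) 𝓘(ℝ, F) ∞ g W) (hx : x ∈ W) : SmoothNear g x := by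
  filter_upwards [hW.mem_nhds hx] with y hy
  exact h.contMDiffAt (hW.mem_nhds hy)

theorem smoothNear_const (c : F) : SmoothNear (fun _ : M => c) x :=
  Filter.Eventually.of_forall fun _ => contMDiffAt_const

theorem SmoothNear.add {g h : M → F} (hg : SmoothNear g x) (hh : SmoothNear h x) :
    SmoothNear (fun y => g y + h y) x := by
  filter_upwards [hg, hh] with y h1 h2 using h1.add h2

theorem SmoothNear.sub {g h : M → F} (hg : SmoothNear g x) (hh : SmoothNear h x) :
    SmoothNear (fun y => g y - h y) x := by
  filter_upwards [hg, hh] with y h1 h2 using h1.sub h2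

theorem SmoothNear.smul {c : M → ℝ} {h : M → F} (hg : SmoothNear c x) (hh : SmoothNear h x) :
    SmoothNear (fun y => c y • h y) x := by
  filter_upwards [hg, hh] with y h1 h2 using h1.smul h2

theorem SmoothNear.clm_apply₂ (B : E →L[ℝ] F →L[ℝ] G) {g : M → E} {h : M → F}
    (hg : SmoothNear g x) (hh : SmoothNear h x) : SmoothNear (fun y => B (g y) (h y)) x := by
  filter_upwards [hg, hh] with y h1 h2
  exact (B.contMDiff.contMDiffAt.comp y h1).clm_apply h2

/-- The form as a continuous bilinear map. -/
def formL : R42 →L[ℝ] R42 →L[ℝ] ℝ := form.toContinuousBilinearMap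

theorem SmoothNear.form {g h : M → R42} (hg : SmoothNear g x) (hh : SmoothNear h x) :
    SmoothNear (fun y => form (g y) (h y)) x := hg.clm_apply₂ formL hh

theorem SmoothNear.comp {φ : E → F} {g : M → E} (hφ : ∀ᶠ z in 𝓝 (g x), ContDiffAt ℝ ∞ φ z)
    (hg : SmoothNear g x) : SmoothNear (fun y => φ (g y)) x := by
  filter_upwards [hg, hg.continuousAt.eventually hφ] with y h1 h2
  exact h2.comp_contMDiffAt h1

theorem SmoothNear.inv {c : M → ℝ} (hc : SmoothNear c x) (h0 : c x ≠ 0) :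
    SmoothNear (fun y => (c y)⁻¹) x := by
  refine SmoothNear.comp (φ := fun t : ℝ => t⁻¹) ?_ hc
  filter_upwards [isOpen_ne.mem_nhds h0] with t ht
  exact contDiffAt_inv ℝ ht

theorem SmoothNear.div {b c : M → ℝ} (hb : SmoothNear b x) (hc : SmoothNear c x) (h0 : c x ≠ 0) :
    SmoothNear (fun y => b y / c y) x := by
  simp only [div_eq_mul_inv]
  exact hb.smul (hc.inv h0)

/-- The differential `drv g x` on the model space. -/
def chartDrv (g : M → F) (x : M) : EuclideanSpace ℝ (Fin 2) →L[ℝ] F := drv g x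

theorem chartDrv_apply (g : M → F) (x : M) (X : TangentSpace (𝓡 2) x) :
    chartDrv g x X = drv g x X := rfl

theorem hasFDerivAt_chart {g : M → F} (h : MDifferentiableAt (𝓡 2) 𝓘(ℝ, F) g x) :
    HasFDerivAt (fun z => g ((extChartAt (𝓡 2) x).symm z)) (chartDrv g x)
      (extChartAt (𝓡 2) x x) := by
  have h1 : HasFDerivWithinAt (fun z => g ((extChartAt (𝓡 2) x).symm z)) (chartDrv g x)
      (range (𝓡 2)) (extChartAt (𝓡 2) x x) := h.hasMFDerivAt.2
  rwa [ModelWithCorners.range_eq_univ, hasFDerivWithinAt_univ] at h1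

/-- With `hasFDerivAt_chart` this moves the rules of calculus between the manifold and the model
plane: a rule is applied to chart expressions and then read back. -/
theorem chartDrv_eq_of_hasFDerivAt {g : M → F} (hc : ContinuousAt g x)
    {D : EuclideanSpace ℝ (Fin 2) →L[ℝ] F}
    (h : HasFDerivAt (fun z => g ((extChartAt (𝓡 2) x).symm z)) D (extChartAt (𝓡 2) x x)) :
    chartDrv g x = D := by
  have h1 : HasFDerivWithinAt (fun z => g ((extChartAt (𝓡 2) x).symm z)) D
      (range (𝓡 2)) (extChartAt (𝓡 2) x x) := h.hasFDerivWithinAt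
  have h2 : HasMFDerivAt (𝓡 2) 𝓘(ℝ, F) g x D := ⟨hc, h1⟩
  exact h2.mfderiv

theorem drv_congr {g h : M → F} (e : ∀ᶠ y in 𝓝 x, g y = h y) : drv g x = drv h x :=
  Filter.EventuallyEq.mfderiv_eq e

theorem drv_const (c : F) : drv (fun _ : M => c) x = 0 := mfderiv_const

theorem drv_clm_apply₂ (B : E →L[ℝ] F →L[ℝ] G) {g : M → E} {h : M → F}
    (hg : SmoothNear g x) (hh : SmoothNear h x) (X : TangentSpace (𝓡 2) x) :
    drv (fun y => B (g y) (h y)) x X = B (drv g x X) (h x) + B (g x) (drv h x X) := by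
  have h1 := hasFDerivAt_chart hg.mdiff
  have h2 := hasFDerivAt_chart hh.mdiff
  have := B.hasFDerivAt_of_bilinear h1 h2
  rw [← chartDrv_apply, chartDrv_eq_of_hasFDerivAt (hg.clm_apply₂ B hh).continuousAt this]
  change B (g ((extChartAt (𝓡 2) x).symm (extChartAt (𝓡 2) x x))) (drv h x X) +
    B (drv g x X) (h ((extChartAt (𝓡 2) x).symm (extChartAt (𝓡 2) x x))) = _
  rw [extChartAt_to_inv, add_comm]

theorem drv_add {g h : M → F} (hg : SmoothNear g x) (hh : SmoothNear h x)
    (X : TangentSpace (𝓡 2) x) :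
    drv (fun y => g y + h y) x X = drv g x X + drv h x X := by
  have := (hasFDerivAt_chart hg.mdiff).add (hasFDerivAt_chart hh.mdiff)
  rw [← chartDrv_apply, chartDrv_eq_of_hasFDerivAt (hg.add hh).continuousAt this]; rfl

theorem drv_sub {g h : M → F} (hg : SmoothNear g x) (hh : SmoothNear h x)
    (X : TangentSpace (𝓡 2) x) :
    drv (fun y => g y - h y) x X = drv g x X - drv h x X := by
  have := (hasFDerivAt_chart hg.mdiff).sub (hasFDerivAt_chart hh.mdiff)
  rw [← chartDrv_apply, chartDrv_eq_of_hasFDerivAt (hg.sub hh).continuousAt this]; rfl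

theorem drv_smul {c : M → ℝ} {h : M → F} (hc : SmoothNear c x) (hh : SmoothNear h x)
    (X : TangentSpace (𝓡 2) x) :
    drv (fun y => c y • h y) x X = drv c x X • h x + c x • drv h x X :=
  drv_clm_apply₂ (ContinuousLinearMap.lsmul ℝ ℝ) hc hh X

theorem drv_const_smul (c : ℝ) {h : M → F} (hh : SmoothNear h x) (X : TangentSpace (𝓡 2) x) :
    drv (fun y => c • h y) x X = c • drv h x X := by
  rw [drv_smul (smoothNear_const c) hh, drv_const]; simp

theorem drv_form {g h : M → R42} (hg : SmoothNear g x) (hh : SmoothNear h x)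
    (X : TangentSpace (𝓡 2) x) :
    drv (fun y => form (g y) (h y)) x X = form (drv g x X) (h x) + form (g x) (drv h x X) :=
  drv_clm_apply₂ formL hg hh X

theorem drv_comp {φ : E → F} {g : M → E} (hφ : DifferentiableAt ℝ φ (g x)) (hg : SmoothNear g x)
    (X : TangentSpace (𝓡 2) x) :
    drv (fun y => φ (g y)) x X = fderiv ℝ φ (g x) (drv g x X) := by
  have h1 := hasFDerivAt_chart hg.mdiff
  have h2 : HasFDerivAt φ (fderiv ℝ φ (g x))
      (g ((extChartAt (𝓡 2) x).symm (extChartAt (𝓡 2) x x))) := by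
    rw [extChartAt_to_inv]; exact hφ.hasFDerivAt
  have := HasFDerivAt.comp (f := fun z => g ((extChartAt (𝓡 2) x).symm z))
    (extChartAt (𝓡 2) x x) h2 h1
  rw [← chartDrv_apply, chartDrv_eq_of_hasFDerivAt (ContinuousAt.comp' hφ.continuousAt hg.continuousAt) this]
  rfl

/-- Derivatives of functions of vanishing pairing. -/
theorem form_drv_add_eq_zero {g h : M → R42} (hg : SmoothNear g x) (hh : SmoothNear h x) {c : ℝ}
    (h0 : ∀ᶠ y in 𝓝 x, form (g y) (h y) = c) (X : TangentSpace (𝓡 2) x) :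
    form (drv g x X) (h x) + form (g x) (drv h x X) = 0 := by
  rw [← drv_form hg hh, drv_congr h0, drv_const]; rfl

theorem drv_self_chart {g : M → F} (hg : SmoothNear g x) (X : TangentSpace (𝓡 2) x) :
    drv g x X = fderiv ℝ (fun z => g ((extChartAt (𝓡 2) x).symm z)) (extChartAt (𝓡 2) x x) X := by
  rw [(hasFDerivAt_chart hg.mdiff).fderiv, chartDrv_apply]

variable [IsManifold (𝓡 2) ∞ M]

/-- The expression of a smooth function in the chart at `x`. -/
theorem SmoothNear.contDiffAt_chart {g : M → F} (hg : SmoothNear g x) :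
    ∀ᶠ z in 𝓝 (extChartAt (𝓡 2) x x),
      ContDiffAt ℝ ∞ (fun z => g ((extChartAt (𝓡 2) x).symm z)) z := by
  have hc : ContinuousAt (extChartAt (𝓡 2) x).symm (extChartAt (𝓡 2) x x) :=
    continuousAt_extChartAt_symm x
  have hg' : ∀ᶠ y in 𝓝 ((extChartAt (𝓡 2) x).symm (extChartAt (𝓡 2) x x)),
      ContMDiffAt (𝓡 2) 𝓘(ℝ, F) ∞ g y := by rw [extChartAt_to_inv]; exact hg
  filter_upwards [hc.eventually hg', extChartAt_target_mem_nhds (I := 𝓡 2) x] with z hz hzt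
  rw [← contMDiffAt_iff_contDiffAt]
  exact hz.comp z ((contMDiffOn_extChartAt_symm x).contMDiffAt
    ((isOpen_extChartAt_target x).mem_nhds hzt))

/-- The derivative near `x` in terms of the chart at `x`. -/
theorem drv_eq_fderiv_chart {g : M → F} {y : M} (hy : y ∈ (chartAt (EuclideanSpace ℝ (Fin 2)) x).source)
    (hg : SmoothNear g y) (X : TangentSpace (𝓡 2) y) :
    drv g y X = fderiv ℝ (fun z => g ((extChartAt (𝓡 2) x).symm z)) (extChartAt (𝓡 2) x y)
      (drv (extChartAt (𝓡 2) x) y X) := by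
  have hφ : SmoothNear (extChartAt (𝓡 2) x) y :=
    smoothNear_of_contMDiffOn (chartAt (EuclideanSpace ℝ (Fin 2)) x).open_source
      (contMDiffOn_extChartAt (I := 𝓡 2) (n := ∞)) hy
  have hy' : y ∈ (extChartAt (𝓡 2) x).source := by rwa [extChartAt_source]
  have hd : DifferentiableAt ℝ (fun z => g ((extChartAt (𝓡 2) x).symm z))
      (extChartAt (𝓡 2) x y) := by
    refine ContDiffAt.differentiableAt (n := ∞) ?_ (by simp)
    rw [← contMDiffAt_iff_contDiffAt]
    have h1 : ContMDiffAt (𝓡 2) 𝓘(ℝ, F) ∞ g ((extChartAt (𝓡 2) x).symm (extChartAt (𝓡 2) x y)) := by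
      rw [(extChartAt (𝓡 2) x).left_inv hy']; exact hg.self
    exact h1.comp _ ((contMDiffOn_extChartAt_symm x).contMDiffAt
      ((isOpen_extChartAt_target x).mem_nhds ((extChartAt (𝓡 2) x).map_source hy')))
  rw [← drv_comp hd hφ]
  congr 1
  refine drv_congr ?_
  filter_upwards [(isOpen_extChartAt_source (I := 𝓡 2) x).mem_nhds hy'] with y' h'
  rw [(extChartAt (𝓡 2) x).left_inv h']

/-- The coordinate vector field of the chart at `x` with constant components `e`. -/
def coordVec (x : M) (e : EuclideanSpace ℝ (Fin 2)) (y : M) : TangentSpace (𝓡 2) y :=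
  mfderiv 𝓘(ℝ, EuclideanSpace ℝ (Fin 2)) (𝓡 2) (extChartAt (𝓡 2) x).symm (extChartAt (𝓡 2) x y) e

/-- Lets pointwise identities on tangent vectors near `x` become identities for the chart expression
with a fixed vector `e`, which can then be differentiated again or passed to a limit. -/
theorem drv_extChartAt_coordVec {y : M}
    (hy : y ∈ (chartAt (EuclideanSpace ℝ (Fin 2)) x).source) (e : EuclideanSpace ℝ (Fin 2)) :
    drv (extChartAt (𝓡 2) x) y (coordVec x e y) = e := by
  have hy' : y ∈ (extChartAt (𝓡 2) x).source := by rwa [extChartAt_source]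
  have hyt := (extChartAt (𝓡 2) x).map_source hy'
  have h := mfderiv_extChartAt_comp_mfderivWithin_extChartAt_symm (I := 𝓡 2) hyt
  rw [ModelWithCorners.range_eq_univ, mfderivWithin_univ] at h
  have h2 := DFunLike.congr_fun h e
  rw [drv, coordVec]
  have e1 : (extChartAt (𝓡 2) x).symm (extChartAt (𝓡 2) x y) = y := (extChartAt (𝓡 2) x).left_inv hy'
  rw [e1] at h2
  exact h2

end Calculus

/-! ### Local frames of subbundles -/

section Frames

variable {M : Type*} [TopologicalSpace M] [ChartedSpace (EuclideanSpace ℝ (Fin 2)) M]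
  {f E : M → Submodule ℝ R42} {x : M} {U : Set M}

theorem IsSectionNear.smoothNear {σ : M → R42} (h : IsSectionNear E x σ) : SmoothNear σ x :=
  h.smooth

theorem IsSectionNear.mem_self {σ : M → R42} (h : IsSectionNear E x σ) : σ x ∈ E x :=
  h.mem.self_of_nhds

theorem IsSectionNear.add {σ τ : M → R42} (hσ : IsSectionNear E x σ) (hτ : IsSectionNear E x τ) :
    IsSectionNear E x (fun y => σ y + τ y) :=
  ⟨hσ.smoothNear.add hτ.smoothNear, by
    filter_upwards [hσ.mem, hτ.mem] with y h1 h2 using add_mem h1 h2⟩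

theorem IsSectionNear.sub {σ τ : M → R42} (hσ : IsSectionNear E x σ) (hτ : IsSectionNear E x τ) :
    IsSectionNear E x (fun y => σ y - τ y) :=
  ⟨hσ.smoothNear.sub hτ.smoothNear, by
    filter_upwards [hσ.mem, hτ.mem] with y h1 h2 using sub_mem h1 h2⟩

theorem IsSectionNear.smul {c : M → ℝ} {σ : M → R42} (hc : SmoothNear c x)
    (hσ : IsSectionNear E x σ) : IsSectionNear E x (fun y => c y • σ y) :=
  ⟨hc.smul hσ.smoothNear, by
    filter_upwards [hσ.mem] with y h1 using Submodule.smul_mem _ _ h1⟩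

theorem IsSectionNear.const_smul {σ : M → R42} (c : ℝ)
    (hσ : IsSectionNear E x σ) : IsSectionNear E x (fun y => c • σ y) :=
  hσ.smul (smoothNear_const c)

theorem IsSectionNear.eventually {σ : M → R42} (h : IsSectionNear E x σ) :
    ∀ᶠ y in 𝓝 x, IsSectionNear E y σ := by
  filter_upwards [h.smoothNear.eventually, eventually_eventually_nhds.2 h.mem] with y h1 h2
  exact ⟨h1, h2⟩

/-- A local frame of a rank two bundle. -/
structure IsFrameNear (E : M → Submodule ℝ R42) (x : M) (σ τ : M → R42) : Prop where
  smooth_left : SmoothNear σ x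
  smooth_right : SmoothNear τ x
  span_eq : ∀ᶠ y in 𝓝 x, E y = Submodule.span ℝ {σ y, τ y}
  linInd : LinearIndependent ℝ ![σ x, τ x]

theorem IsFrameNear.left {σ τ : M → R42} (h : IsFrameNear E x σ τ) : IsSectionNear E x σ :=
  ⟨h.smooth_left, by
    filter_upwards [h.span_eq] with y hy
    rw [hy]; exact Submodule.subset_span (by simp)⟩

theorem IsFrameNear.swap {σ τ : M → R42} (h : IsFrameNear E x σ τ) : IsFrameNear E x τ σ :=
  ⟨h.smooth_right, h.smooth_left, by simpa only [pair_comm] using h.span_eq,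
    LinearIndependent.pair_symm_iff.1 h.linInd⟩

theorem IsFrameNear.right {σ τ : M → R42} (h : IsFrameNear E x σ τ) : IsSectionNear E x τ :=
  h.swap.left

/-- Linear functionals dual to an independent pair. -/
theorem exists_dual_pair {u v : R42} (h : LinearIndependent ℝ ![u, v]) :
    ∃ A B : R42 →L[ℝ] ℝ, A u = 1 ∧ A v = 0 ∧ B u = 0 ∧ B v = 1 := by
  obtain ⟨g, hg⟩ := (Fintype.linearCombination ℝ ![u, v]).exists_leftInverse_of_injective
    (LinearMap.ker_eq_bot.2 (linearIndependent_iff_injective_fintypeLinearCombination.1 h))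
  have h1 : ∀ c, g (Fintype.linearCombination ℝ ![u, v] c) = c := fun c => LinearMap.congr_fun hg c
  have hu := h1 ![1, 0]
  have hv := h1 ![0, 1]
  simp only [Fintype.linearCombination_apply, Fin.sum_univ_two, Matrix.cons_val_zero,
    Matrix.cons_val_one, one_smul, zero_smul, add_zero, zero_add] at hu hv
  refine ⟨LinearMap.toContinuousLinearMap ((LinearMap.proj 0).comp g),
    LinearMap.toContinuousLinearMap ((LinearMap.proj 1).comp g), ?_, ?_, ?_, ?_⟩ <;>
    simp [hu, hv]

theorem SmoothNear.clm {F G : Type*} [NormedAddCommGroup F] [NormedSpace ℝ F]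
    [NormedAddCommGroup G] [NormedSpace ℝ G] (A : F →L[ℝ] G) {g : M → F} (hg : SmoothNear g x) :
    SmoothNear (fun y => A (g y)) x :=
  hg.comp (Filter.Eventually.of_forall fun _ => A.contDiff.contDiffAt)

/-- The coefficients of a section with respect to a frame are smooth. -/
theorem IsFrameNear.exists_coeff {σ τ ρ : M → R42} (h : IsFrameNear E x σ τ)
    (hρ : IsSectionNear E x ρ) : ∃ a b : M → ℝ, SmoothNear a x ∧ SmoothNear b x ∧
      ∀ᶠ y in 𝓝 x, ρ y = a y • σ y + b y • τ y := by
  obtain ⟨A, B, h1, h2, h3, h4⟩ := exists_dual_pair h.linInd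
  -- Cramer's rule: `D` is the determinant of the frame in the coordinates `A`, `B`, and equals 1 at
  -- `x`.
  set D : M → ℝ := fun y => A (σ y) * B (τ y) - A (τ y) * B (σ y) with hD
  have sAσ := h.smooth_left.clm A
  have sBσ := h.smooth_left.clm B
  have sAτ := h.smooth_right.clm A
  have sBτ := h.smooth_right.clm B
  have sD : SmoothNear D x := (sAσ.smul sBτ).sub (sAτ.smul sBσ)
  have hDx : D x ≠ 0 := by simp [hD, h1, h2, h3, h4]
  refine ⟨fun y => (A (ρ y) * B (τ y) - A (τ y) * B (ρ y)) / D y,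
    fun y => (A (σ y) * B (ρ y) - A (ρ y) * B (σ y)) / D y,
    (((hρ.smoothNear.clm A).smul sBτ).sub (sAτ.smul (hρ.smoothNear.clm B))).div sD hDx,
    ((sAσ.smul (hρ.smoothNear.clm B)).sub ((hρ.smoothNear.clm A).smul sBσ)).div sD hDx, ?_⟩
  filter_upwards [hρ.mem, h.span_eq, sD.continuousAt.eventually_ne hDx] with y hy hs hDy
  rw [hs] at hy
  obtain ⟨a, b, hab⟩ := Submodule.mem_span_pair.1 hy
  have ha : (A (ρ y) * B (τ y) - A (τ y) * B (ρ y)) / D y = a := by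
    rw [div_eq_iff hDy, ← hab, hD]
    simp only [map_add, map_smul, smul_eq_mul]; ring
  have hb : (A (σ y) * B (ρ y) - A (ρ y) * B (σ y)) / D y = b := by
    rw [div_eq_iff hDy, ← hab, hD]
    simp only [map_add, map_smul, smul_eq_mul]; ring
  simp only [ha, hb, hab]

/-- The derivative of a section is determined modulo the bundle by its value. -/
theorem IsFrameNear.drv_mem_of_eq_zero {σ τ ρ : M → R42} (h : IsFrameNear E x σ τ)
    (hρ : IsSectionNear E x ρ) (h0 : ρ x = 0) (X : TangentSpace (𝓡 2) x) :
    drv ρ x X ∈ E x := by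
  obtain ⟨a, b, ha, hb, he⟩ := h.exists_coeff hρ
  have h1 := he.self_of_nhds
  rw [h0] at h1
  have h2 := LinearIndependent.pair_iff.1 h.linInd _ _ h1.symm
  rw [drv_congr he, drv_add (ha.smul h.smooth_left) (hb.smul h.smooth_right),
    drv_smul ha h.smooth_left, drv_smul hb h.smooth_right, h2.1, h2.2, zero_smul, zero_smul,
    add_zero, add_zero]
  exact add_mem (Submodule.smul_mem _ _ h.left.mem_self) (Submodule.smul_mem _ _ h.right.mem_self)

/-- A subbundle of rank two has local frames with prescribed values at a point. -/
theorem IsSubbundleOn.exists_frame (hE : IsSubbundleOn 2 U E) (hx : x ∈ U) {u v : R42}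
    (hu : u ∈ E x) (hv : v ∈ E x) (huv : LinearIndependent ℝ ![u, v]) :
    ∃ σ τ : M → R42, IsFrameNear E x σ τ ∧ σ x = u ∧ τ x = v := by
  obtain ⟨W, hW, hxW, -, e, he, hs⟩ := hE.2 x hx
  have hr : ∀ y ∈ W, E y = Submodule.span ℝ {e 0 y, e 1 y} := by
    intro y hy
    rw [hs y hy]
    congr 1
    ext z
    simp [Fin.exists_fin_two, eq_comm]
  have h0 := smoothNear_of_contMDiffOn hW (he 0) hxW
  have h1 := smoothNear_of_contMDiffOn hW (he 1) hxW
  rw [hr x hxW] at hu hv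
  obtain ⟨a, b, hab⟩ := Submodule.mem_span_pair.1 hu
  obtain ⟨c, d, hcd⟩ := Submodule.mem_span_pair.1 hv
  -- The change of basis at `x` is invertible; using its constant coefficients at nearby points
  -- again gives a frame.
  have hdet : a * d - b * c ≠ 0 := by
    intro hz
    have e1 : d • u - b • v = 0 := by
      rw [← hab, ← hcd]
      have : d • (a • e 0 x + b • e 1 x) - b • (c • e 0 x + d • e 1 x)
        = (a * d - b * c) • e 0 x := by module
      rw [this, hz, zero_smul]
    have e2 : c • u - a • v = 0 := by
      rw [← hab, ← hcd]
      have : c • (a • e 0 x + b • e 1 x) - a • (c • e 0 x + d • e 1 x)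
        = (-(a * d - b * c)) • e 1 x := by module
      rw [this, hz, neg_zero, zero_smul]
    have hp := LinearIndependent.pair_iff.1 huv
    obtain ⟨hd0, hb0⟩ := hp d (-b) (by rw [neg_smul, ← sub_eq_add_neg]; exact e1)
    obtain ⟨hc0, ha0⟩ := hp c (-a) (by rw [neg_smul, ← sub_eq_add_neg]; exact e2)
    have hu0 : u = 0 := by rw [← hab, neg_eq_zero.1 ha0, neg_eq_zero.1 hb0]; simp
    exact huv.ne_zero 0 (by simpa using hu0)
  refine ⟨fun y => a • e 0 y + b • e 1 y, fun y => c • e 0 y + d • e 1 y,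
    ⟨((smoothNear_const a).smul h0).add ((smoothNear_const b).smul h1),
     ((smoothNear_const c).smul h0).add ((smoothNear_const d).smul h1), ?_, ?_⟩, hab, hcd⟩
  · filter_upwards [hW.mem_nhds hxW] with y hy
    rw [hr y hy]
    obtain ⟨k, hk⟩ : ∃ k, k * (a * d - b * c) = 1 := ⟨_, inv_mul_cancel₀ hdet⟩
    refine le_antisymm ?_ ?_ <;> rw [Submodule.span_le, insert_subset_iff, singleton_subset_iff]
    · constructor
      · refine Submodule.mem_span_pair.2 ⟨d * k, -b * k, ?_⟩
        match_scalars <;> first | linear_combination hk | ring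
      · refine Submodule.mem_span_pair.2 ⟨-c * k, a * k, ?_⟩
        match_scalars <;> first | linear_combination hk | ring
    · exact ⟨Submodule.mem_span_pair.2 ⟨a, b, rfl⟩, Submodule.mem_span_pair.2 ⟨c, d, rfl⟩⟩
  · simpa only [hab, hcd] using huv

theorem IsSubbundleOn.exists_frame' (hE : IsSubbundleOn 2 U E) (hx : x ∈ U) :
    ∃ σ τ : M → R42, IsFrameNear E x σ τ := by
  have h2 := hE.1 x hx
  let b := Module.finBasisOfFinrankEq ℝ (E x) h2
  have hli : LinearIndependent ℝ ![(b 0 : R42), (b 1 : R42)] := by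
    rw [LinearIndependent.pair_iff]
    intro s t hst
    have h0 := Fintype.linearIndependent_iff.1 b.linearIndependent ![s, t]
      (by ext1; simpa [Fin.sum_univ_two] using hst)
    exact ⟨h0 0, h0 1⟩
  obtain ⟨σ, τ, h, -⟩ := hE.exists_frame hx (b 0).2 (b 1).2 hli
  exact ⟨σ, τ, h⟩

/-- A subbundle of rank one is locally spanned by a section without zeros. -/
theorem IsSubbundleOn.exists_section (hE : IsSubbundleOn 1 U E) (hx : x ∈ U) :
    ∃ σ : M → R42, SmoothNear σ x ∧
      ∀ᶠ y in 𝓝 x, E y = Submodule.span ℝ {σ y} ∧ σ y ≠ 0 := by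
  obtain ⟨W, hW, hxW, hWU, e, he, hs⟩ := hE.2 x hx
  refine ⟨e 0, smoothNear_of_contMDiffOn hW (he 0) hxW, ?_⟩
  filter_upwards [hW.mem_nhds hxW] with y hy
  have h1 : E y = Submodule.span ℝ {e 0 y} := by rw [hs y hy, range_unique]; rfl
  refine ⟨h1, fun h0 => ?_⟩
  have hb : E y = ⊥ := by rw [h1, h0, Submodule.span_zero_singleton]
  have := hE.1 y (hWU hy)
  rw [hb, finrank_bot] at this
  exact zero_ne_one this

/-- A section of a line bundle is a smooth multiple of a section without zeros. -/
theorem exists_coeff_of_line {σ ρ : M → R42} (hσ : SmoothNear σ x) (h0 : σ x ≠ 0)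
    (hE : ∀ᶠ y in 𝓝 x, E y = Submodule.span ℝ {σ y}) (hρ : IsSectionNear E x ρ) :
    ∃ a : M → ℝ, SmoothNear a x ∧ ∀ᶠ y in 𝓝 x, ρ y = a y • σ y := by
  obtain ⟨A, hA⟩ := SeparatingDual.exists_ne_zero (R := ℝ) h0
  have hs := hσ.clm A
  refine ⟨fun y => A (ρ y) / A (σ y), (hρ.smoothNear.clm A).div hs hA, ?_⟩
  filter_upwards [hρ.mem, hE, hs.continuousAt.eventually_ne hA] with y hy he hn
  rw [he] at hy
  obtain ⟨c, hc⟩ := Submodule.mem_span_singleton.1 hy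
  rw [← hc, map_smul, smul_eq_mul, mul_div_cancel_right₀ _ hn]

theorem isSubbundleOn_one_of_section (h : ∀ x ∈ U, ∃ σ : M → R42, SmoothNear σ x ∧
      ∀ᶠ y in 𝓝 x, y ∈ U ∧ E y = Submodule.span ℝ {σ y} ∧ σ y ≠ 0) : IsSubbundleOn 1 U E := by
  constructor
  · intro x hx
    obtain ⟨σ, -, hσ⟩ := h x hx
    obtain ⟨-, h1, h2⟩ := hσ.self_of_nhds
    rw [h1, finrank_span_singleton h2]
  · intro x hx
    obtain ⟨σ, hs, hσ⟩ := h x hx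
    obtain ⟨W, hW, hWo, hxW⟩ := eventually_nhds_iff.1 (hs.and hσ)
    refine ⟨W, hWo, hxW, fun y hy => (hW y hy).2.1, fun _ => σ,
      fun _ y hy => ((hW y hy).1).contMDiffWithinAt, fun y hy => ?_⟩
    rw [(hW y hy).2.2.1, range_const]

theorem isSubbundleOn_two_of_frame (hU : IsOpen U)
    (h : ∀ x ∈ U, ∃ σ τ : M → R42, IsFrameNear E x σ τ) : IsSubbundleOn 2 U E := by
  constructor
  · intro x hx
    obtain ⟨σ, τ, hσ⟩ := h x hx
    rw [hσ.span_eq.self_of_nhds]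
    have := finrank_span_eq_card hσ.linInd
    rwa [Matrix.range_cons, Matrix.range_cons, Matrix.range_empty, union_empty,
      singleton_union, Fintype.card_fin] at this
  · intro x hx
    obtain ⟨σ, τ, hσ⟩ := h x hx
    obtain ⟨W, hW, hWo, hxW⟩ := eventually_nhds_iff.1
      ((hσ.smooth_left.and hσ.smooth_right).and (hσ.span_eq.and (hU.mem_nhds hx)))
    refine ⟨W, hWo, hxW, fun y hy => (hW y hy).2.2, ![σ, τ], fun i y hy => ?_, fun y hy => ?_⟩
    · fin_cases i
      · exact (hW y hy).1.1.contMDiffWithinAt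
      · exact (hW y hy).1.2.contMDiffWithinAt
    · rw [(hW y hy).2.1]
      congr 1
      ext z
      simp [or_comm]

end Frames

/-! ### Curvature spheres and curvature frames -/

section Curvature

variable {M : Type*} [TopologicalSpace M] [ChartedSpace (EuclideanSpace ℝ (Fin 2)) M]
  {f : M → Submodule ℝ R42} {x : M} {U : Set M}

/-- Membership in the curvature space of the line spanned by the value of a section. -/
theorem IsFrameNear.mem_curvatureSpace_iff {σ τ ρ : M → R42} (h : IsFrameNear f x σ τ)
    (hρ : IsSectionNear f x ρ) {X : TangentSpace (𝓡 2) x} :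
    X ∈ curvatureSpace f x (Submodule.span ℝ {ρ x}) ↔ drv ρ x X ∈ f x := by
  constructor
  · intro hX
    exact hX ρ hρ (Submodule.mem_span_singleton_self _)
  · intro hX π hπ hs
    obtain ⟨c, hc⟩ := Submodule.mem_span_singleton.1 hs
    have h1 := h.drv_mem_of_eq_zero (hπ.sub (hρ.const_smul c)) (by simp [hc]) X
    rw [drv_sub hπ.smoothNear (hρ.const_smul c).smoothNear, drv_const_smul c hρ.smoothNear] at h1
    have := add_mem h1 (Submodule.smul_mem _ c hX)
    rwa [sub_add_cancel] at this

/-- Every line of a rank two bundle at `x` is a combination of the values of a frame, and the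
derivative of a section is the corresponding combination modulo the bundle. -/
theorem IsFrameNear.exists_drv_sub_mem {σ τ ρ : M → R42} (h : IsFrameNear f x σ τ)
    (hρ : IsSectionNear f x ρ) : ∃ a b : ℝ, ρ x = a • σ x + b • τ x ∧
      ∀ X, drv ρ x X - (a • drv σ x X + b • drv τ x X) ∈ f x := by
  have hx := hρ.mem_self
  rw [h.span_eq.self_of_nhds] at hx
  obtain ⟨a, b, hab⟩ := Submodule.mem_span_pair.1 hx
  refine ⟨a, b, hab.symm, fun X => ?_⟩
  have hs := (h.left.const_smul a).add (h.right.const_smul b)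
  have h1 := h.drv_mem_of_eq_zero (hρ.sub hs) (by simp [hab]) X
  rwa [drv_sub hρ.smoothNear hs.smoothNear,
    drv_add (h.left.const_smul a).smoothNear (h.right.const_smul b).smoothNear,
    drv_const_smul a h.smooth_left, drv_const_smul b h.smooth_right] at h1

/-- A frame of `f` at `x` by sections whose values span curvature spheres, with vectors in the
curvature spaces. -/
structure IsCurvatureFrame (f : M → Submodule ℝ R42) (x : M) (σ τ : M → R42)
    (X Y : TangentSpace (𝓡 2) x) : Prop where
  frame : IsFrameNear f x σ τ
  drv_left : drv σ x X ∈ f x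
  drv_right : drv τ x Y ∈ f x
  drv_left_notMem : drv σ x Y ∉ f x
  drv_right_notMem : drv τ x X ∉ f x
  orthogonal : form (drv σ x Y) (drv τ x X) = 0
  spans : ∀ Z, ∃ a b : ℝ, Z = a • X + b • Y

/-- `f` is null of rank two and satisfies the contact condition at `x`. -/
structure IsContactAt (f : M → Submodule ℝ R42) (x : M) : Prop where
  finrank : Module.finrank ℝ (f x) = 2
  null : IsNull (f x)
  contact : ∀ σ, IsSectionNear f x σ → ∀ X, drv σ x X ∈ perp (f x)

theorem IsLegendreOn.isContactAt (hf : IsLegendreOn U f) (hx : x ∈ U) : IsContactAt f x :=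
  ⟨hf.subbundle.1 x hx, hf.null x hx, hf.contact x hx⟩

namespace IsCurvatureFrame

variable {σ τ : M → R42} {X Y : TangentSpace (𝓡 2) x}

theorem swap (h : IsCurvatureFrame f x σ τ X Y) : IsCurvatureFrame f x τ σ Y X :=
  ⟨h.frame.swap, h.drv_right, h.drv_left, h.drv_right_notMem, h.drv_left_notMem,
    by rw [form_comm, h.orthogonal], fun Z => by
      obtain ⟨a, b, hab⟩ := h.spans Z
      exact ⟨b, a, by rw [hab, add_comm]⟩⟩

theorem ne_zero (h : IsCurvatureFrame f x σ τ X Y) : X ≠ 0 := by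
  rintro rfl
  exact h.drv_right_notMem (by rw [map_zero]; exact zero_mem _)

theorem form_pos (h : IsCurvatureFrame f x σ τ X Y) (hf : IsContactAt f x) :
    0 < form (drv σ x Y) (drv σ x Y) :=
  form_self_pos hf.null hf.finrank (hf.contact _ h.frame.left _) h.drv_left_notMem

/-- Pairing with `d_Y σ`, which is orthogonal to `f` and to `d_X τ` and has positive square,
isolates `a`. With the primed version, `d_Y σ` and `d_X τ` are independent modulo `f`. -/
theorem eq_zero_of_mem (h : IsCurvatureFrame f x σ τ X Y) (hf : IsContactAt f x) {a b : ℝ}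
    (hab : a • drv σ x Y + b • drv τ x X ∈ f x) : a = 0 := by
  have h1 := hf.contact _ h.frame.left Y _ hab
  rw [map_add, LinearMap.add_apply, map_smul, map_smul, LinearMap.smul_apply, LinearMap.smul_apply,
    form_comm (drv τ x X), h.orthogonal, smul_zero, add_zero, smul_eq_mul, mul_eq_zero] at h1
  exact h1.resolve_right (h.form_pos hf).ne'

theorem eq_zero_of_mem' (h : IsCurvatureFrame f x σ τ X Y) (hf : IsContactAt f x) {a b : ℝ}
    (hab : a • drv σ x Y + b • drv τ x X ∈ f x) : b = 0 :=
  h.swap.eq_zero_of_mem hf (by rwa [add_comm] at hab)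

/-- The derivative of a section modulo `f`. -/
theorem drv_sub_mem (h : IsCurvatureFrame f x σ τ X Y) {ρ : M → R42} (hρ : IsSectionNear f x ρ)
    {a b : ℝ} (hab : ρ x = a • σ x + b • τ x) (c e : ℝ) :
    drv ρ x (c • X + e • Y) - ((a * e) • drv σ x Y + (b * c) • drv τ x X) ∈ f x := by
  have hs := (h.frame.left.const_smul a).add (h.frame.right.const_smul b)
  have h1 := h.frame.drv_mem_of_eq_zero (hρ.sub hs) (by simp [hab]) (c • X + e • Y)
  rw [drv_sub hρ.smoothNear hs.smoothNear,
    drv_add (h.frame.left.const_smul a).smoothNear (h.frame.right.const_smul b).smoothNear,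
    drv_const_smul a h.frame.smooth_left, drv_const_smul b h.frame.smooth_right,
    map_add (drv σ x), map_add (drv τ x), map_smul (drv σ x), map_smul (drv σ x),
    map_smul (drv τ x), map_smul (drv τ x)] at h1
  have h2 := add_mem h1 (add_mem (Submodule.smul_mem _ (a * c) h.drv_left)
    (Submodule.smul_mem _ (b * e) h.drv_right))
  convert h2 using 1
  module

/-- In a curvature frame the derivative modulo `f` is diagonal, with only the entries `d_Y σ` and
`d_X τ`. All facts about curvature spheres and spaces at the point are read off from these two
products. -/
theorem drv_mem_iff (h : IsCurvatureFrame f x σ τ X Y) (hf : IsContactAt f x) {ρ : M → R42}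
    (hρ : IsSectionNear f x ρ) {a b : ℝ} (hab : ρ x = a • σ x + b • τ x) (c e : ℝ) :
    drv ρ x (c • X + e • Y) ∈ f x ↔ a * e = 0 ∧ b * c = 0 := by
  have h1 := h.drv_sub_mem hρ hab c e
  rw [← Submodule.sub_mem_iff_left _ h1, sub_sub_cancel]
  constructor
  · intro h2
    exact ⟨h.eq_zero_of_mem hf h2, h.eq_zero_of_mem' hf h2⟩
  · rintro ⟨h2, h3⟩
    rw [h2, h3, zero_smul, zero_smul, add_zero]
    exact zero_mem _

theorem curvatureSpace_left (h : IsCurvatureFrame f x σ τ X Y) (hf : IsContactAt f x) :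
    curvatureSpace f x (Submodule.span ℝ {σ x}) = Submodule.span ℝ {X} := by
  ext Z
  rw [h.frame.mem_curvatureSpace_iff h.frame.left]
  obtain ⟨c, e, rfl⟩ := h.spans Z
  rw [h.drv_mem_iff hf h.frame.left (a := 1) (b := 0) (by simp), Submodule.mem_span_singleton]
  constructor
  · rintro ⟨h1, -⟩
    rw [one_mul] at h1
    exact ⟨c, by simp [h1]⟩
  · rintro ⟨k, hk⟩
    refine ⟨?_, by simp⟩
    have h2 : drv σ x (c • X + e • Y) ∈ f x := by
      rw [← hk, map_smul]
      exact Submodule.smul_mem _ _ h.drv_left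
    exact ((h.drv_mem_iff hf h.frame.left (a := 1) (b := 0) (by simp) c e).1 h2).1

theorem isCurvatureSphere_left (h : IsCurvatureFrame f x σ τ X Y) (hf : IsContactAt f x) :
    IsCurvatureSphere f x (Submodule.span ℝ {σ x}) where
  rank_one := finrank_span_singleton (h.frame.linInd.ne_zero 0)
  le := by
    rw [Submodule.span_singleton_le_iff_mem]; exact h.frame.left.mem_self
  space_ne_bot := by
    rw [h.curvatureSpace_left hf, Ne, Submodule.span_singleton_eq_bot]
    exact h.ne_zero

/-- For a generator `a σ + b τ` and a nonzero direction `c X + e Y` in its curvature space, `a e =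
0` and `b c = 0` force `a` or `b` to vanish. -/
theorem eq_or_eq (h : IsCurvatureFrame f x σ τ X Y) (hf : IsContactAt f x)
    {s : Submodule ℝ R42} (hs : IsCurvatureSphere f x s) :
    s = Submodule.span ℝ {σ x} ∨ s = Submodule.span ℝ {τ x} := by
  obtain ⟨u, hu0, hu⟩ := finrank_eq_one_iff'.1 hs.rank_one
  have hsu : s = Submodule.span ℝ {(u : R42)} := by
    refine le_antisymm (fun w hw => ?_) ?_
    · obtain ⟨c, hc⟩ := hu ⟨w, hw⟩
      exact Submodule.mem_span_singleton.2 ⟨c, congrArg Subtype.val hc⟩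
    · rw [Submodule.span_singleton_le_iff_mem]; exact u.2
  have huf : (u : R42) ∈ f x := hs.le u.2
  rw [h.frame.span_eq.self_of_nhds] at huf
  obtain ⟨a, b, hab⟩ := Submodule.mem_span_pair.1 huf
  obtain ⟨Z, hZ, hZ0⟩ := Submodule.exists_mem_ne_zero_of_ne_bot hs.space_ne_bot
  obtain ⟨c, e, rfl⟩ := h.spans Z
  have hρ := (h.frame.left.const_smul a).add (h.frame.right.const_smul b)
  have h1 := (h.drv_mem_iff hf hρ rfl c e).1 (hZ _ hρ (by rw [hab]; exact u.2))
  have hne : (u : R42) ≠ 0 := fun h => hu0 (Subtype.ext h)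
  rw [hsu, ← hab]
  rcases mul_eq_zero.1 h1.1 with ha | he
  · right
    subst ha
    have hb : b ≠ 0 := by rintro rfl; exact hne (by rw [← hab]; simp)
    rw [zero_smul, zero_add]
    exact Submodule.span_singleton_smul_eq (IsUnit.mk0 b hb) _
  · left
    have hc : c ≠ 0 := by rintro rfl; exact hZ0 (by simp [he])
    have hb : b = 0 := (mul_eq_zero.1 h1.2).resolve_right hc
    subst hb
    have ha : a ≠ 0 := by rintro rfl; exact hne (by rw [← hab]; simp)
    rw [zero_smul, add_zero]
    exact Submodule.span_singleton_smul_eq (IsUnit.mk0 a ha) _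

theorem span_ne (h : IsCurvatureFrame f x σ τ X Y) :
    Submodule.span ℝ {σ x} ≠ Submodule.span ℝ {τ x} := by
  intro he
  have h1 : τ x ∈ Submodule.span ℝ {σ x} := by rw [he]; exact Submodule.mem_span_singleton_self _
  obtain ⟨c, hc⟩ := Submodule.mem_span_singleton.1 h1
  have := (LinearIndependent.pair_iff.1 h.frame.linInd c (-1) (by rw [hc]; simp)).2
  norm_num at this

theorem not_existsUnique (h : IsCurvatureFrame f x σ τ X Y) (hf : IsContactAt f x) :
    ¬ ∃! s, IsCurvatureSphere f x s := fun hu =>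
  h.span_ne (hu.unique (h.isCurvatureSphere_left hf) (h.swap.isCurvatureSphere_left hf))

theorem curvatureDirections_eq (h : IsCurvatureFrame f x σ τ X Y) (hf : IsContactAt f x) :
    curvatureDirections f x = {Submodule.span ℝ {X}, Submodule.span ℝ {Y}} := by
  ext S
  constructor
  · rintro ⟨s, hs, rfl⟩
    rcases h.eq_or_eq hf hs with rfl | rfl
    · exact Or.inl (h.curvatureSpace_left hf)
    · exact Or.inr (h.swap.curvatureSpace_left hf)
  · rintro (rfl | rfl)
    · exact ⟨_, h.isCurvatureSphere_left hf, h.curvatureSpace_left hf⟩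
    · exact ⟨_, h.swap.isCurvatureSphere_left hf, h.swap.curvatureSpace_left hf⟩

theorem span_dir_ne (h : IsCurvatureFrame f x σ τ X Y) :
    Submodule.span ℝ {X} ≠ Submodule.span ℝ {Y} := by
  intro he
  have h1 : Y ∈ Submodule.span ℝ {X} := by rw [he]; exact Submodule.mem_span_singleton_self _
  obtain ⟨c, rfl⟩ := Submodule.mem_span_singleton.1 h1
  exact h.drv_left_notMem (by rw [map_smul]; exact Submodule.smul_mem _ _ h.drv_left)

/-- A curvature sphere is determined by its curvature space. -/
theorem eq_left_of_curvatureSpace (h : IsCurvatureFrame f x σ τ X Y) (hf : IsContactAt f x)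
    {s : Submodule ℝ R42} (hs : IsCurvatureSphere f x s)
    (hX : curvatureSpace f x s = Submodule.span ℝ {X}) : s = Submodule.span ℝ {σ x} := by
  rcases h.eq_or_eq hf hs with rfl | rfl
  · rfl
  · rw [h.swap.curvatureSpace_left hf] at hX
    exact absurd hX.symm h.span_dir_ne

theorem immersed (h : IsCurvatureFrame f x σ τ X Y) (hf : IsContactAt f x)
    {Z : TangentSpace (𝓡 2) x} (hZ : ∀ ρ, IsSectionNear f x ρ → dAt ρ x Z ∈ f x) : Z = 0 := by
  obtain ⟨c, e, rfl⟩ := h.spans Z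
  have h1 := (h.drv_mem_iff hf h.frame.left (a := 1) (b := 0) (by simp) c e).1 (hZ _ h.frame.left)
  have h2 := (h.drv_mem_iff hf h.frame.right (a := 0) (b := 1) (by simp) c e).1
    (hZ _ h.frame.right)
  rw [one_mul] at h1 h2
  rw [h1.1, show c = 0 by simpa using h2.2]
  simp

end IsCurvatureFrame

theorem exists_eq_smul_add_smul {X Y : TangentSpace (𝓡 2) x} (hX : X ≠ 0)
    (hY : ∀ c : ℝ, c • X ≠ Y) (Z : TangentSpace (𝓡 2) x) : ∃ a b : ℝ, Z = a • X + b • Y := by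
  have key : ∀ (V W : EuclideanSpace ℝ (Fin 2)), V ≠ 0 → (∀ c : ℝ, c • V ≠ W) →
      ∀ Z, ∃ a b : ℝ, Z = a • V + b • W := by
    intro V W hV hW Z
    have h := ((LinearIndependent.pair_iff' hV).2 hW).span_eq_top_of_card_eq_finrank (by simp)
    have hZ : Z ∈ (⊤ : Submodule ℝ (EuclideanSpace ℝ (Fin 2))) := Submodule.mem_top
    rw [← h, Matrix.range_cons, Matrix.range_cons, Matrix.range_empty, union_empty,
      singleton_union] at hZ
    obtain ⟨a, b, hab⟩ := Submodule.mem_span_pair.1 hZ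
    exact ⟨a, b, hab.symm⟩
  exact key X Y hX hY Z

variable [IsManifold (𝓡 2) ∞ M]

/-- The second fundamental forms of a Legendre map commute. -/
theorem form_drv_comm (hf : IsLegendreOn U f) (hU : IsOpen U) (hx : x ∈ U) {σ τ : M → R42}
    (hσ : IsSectionNear f x σ) (hτ : IsSectionNear f x τ) (X Y : TangentSpace (𝓡 2) x) :
    form (drv σ x X) (drv τ x Y) = form (drv σ x Y) (drv τ x X) := by
  set φ := extChartAt (𝓡 2) x with hφ
  set S := fun z => σ (φ.symm z) with hS
  set T := fun z => τ (φ.symm z) with hT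
  have sS := hσ.smoothNear.contDiffAt_chart
  have sT := hτ.smoothNear.contDiffAt_chart
  have hc : ContinuousAt φ.symm (φ x) := continuousAt_extChartAt_symm x
  have hev : ∀ᶠ y in 𝓝 (φ.symm (φ x)), IsSectionNear f y σ ∧ IsSectionNear f y τ ∧ y ∈ U := by
    rw [hφ, extChartAt_to_inv]
    exact hσ.eventually.and (hτ.eventually.and (hU.mem_nhds hx))
  -- The contact condition holds on a neighbourhood; in a chart, along constant vectors, it may be
  -- differentiated once more.
  have key : ∀ e : EuclideanSpace ℝ (Fin 2),
      ∀ᶠ z in 𝓝 (φ x), form (fderiv ℝ S z e) (T z) = 0 := by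
    intro e
    filter_upwards [hc.eventually hev, extChartAt_target_mem_nhds (I := 𝓡 2) x] with z hz hzt
    obtain ⟨h1, h2, h3⟩ := hz
    have hy : φ.symm z ∈ (chartAt (EuclideanSpace ℝ (Fin 2)) x).source := by
      rw [← extChartAt_source (𝓡 2)]; exact φ.map_target hzt
    have := hf.contact _ h3 σ h1 (coordVec x e (φ.symm z)) _ h2.mem_self
    rw [dAt_eq_drv, drv_eq_fderiv_chart hy h1.smoothNear, drv_extChartAt_coordVec hy,
      ← hφ, φ.right_inv hzt, form_comm] at this
    exact this
  have sS0 : ContDiffAt ℝ ∞ S (φ x) := sS.self_of_nhds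
  have sT0 : ContDiffAt ℝ ∞ T (φ x) := sT.self_of_nhds
  have hdS : DifferentiableAt ℝ (fderiv ℝ S) (φ x) :=
    (sS0.fderiv_right (m := 1) (by rw [one_add_one_eq_two]; exact ENat.LEInfty.out)).differentiableAt (by simp)
  have hdT : DifferentiableAt ℝ T (φ x) := sT0.differentiableAt (by simp)
  have hsymm : IsSymmSndFDerivAt ℝ S (φ x) := sS0.isSymmSndFDerivAt
    (by simp only [minSmoothness_of_isRCLikeNormedField]; exact ENat.LEInfty.out)
  have hT0 : ∀ e e' : EuclideanSpace ℝ (Fin 2),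
      form (fderiv ℝ (fderiv ℝ S) (φ x) e' e) (T (φ x)) +
        form (fderiv ℝ S (φ x) e) (fderiv ℝ T (φ x) e') = 0 := by
    intro e e'
    have h1 : HasFDerivAt (fun z => fderiv ℝ S z e)
      ((ContinuousLinearMap.apply ℝ R42 e).comp (fderiv ℝ (fderiv ℝ S) (φ x))) (φ x) :=
      (ContinuousLinearMap.apply ℝ R42 e).hasFDerivAt.comp _ hdS.hasFDerivAt
    have h2 := formL.hasFDerivAt_of_bilinear h1 hdT.hasFDerivAt
    have h3 := h2.congr_of_eventuallyEq (f₁ := fun _ => (0 : ℝ))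
      (by filter_upwards [key e] with z hz using hz.symm)
    have h4 := congrArg (fun D => D e') (h3.unique (hasFDerivAt_const 0 _))
    change form (fderiv ℝ S (φ x) e) (fderiv ℝ T (φ x) e') +
      form (fderiv ℝ (fderiv ℝ S) (φ x) e' e) (T (φ x)) = 0 at h4
    rw [add_comm]; exact h4
  -- The two identities differ in the order of the second derivative of `S`; its symmetry leaves the
  -- mixed first-order terms equal.
  have e1 := hT0 X Y
  have e2 := hT0 Y X
  rw [hsymm.eq X Y] at e2
  rw [drv_self_chart hσ.smoothNear, drv_self_chart hτ.smoothNear, drv_self_chart hσ.smoothNear,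
    drv_self_chart hτ.smoothNear]
  linarith

/-- Curvature frames exist at non-umbilic points. -/
theorem exists_curvatureFrame (hf : IsLegendreOn univ f) (humb : IsUmbilicFreeOn univ f)
    {S : Submodule ℝ (TangentSpace (𝓡 2) x)} (hS : S ∈ curvatureDirections f x) :
    ∃ (σ τ : M → R42) (X Y : TangentSpace (𝓡 2) x), IsCurvatureFrame f x σ τ X Y ∧
      S = Submodule.span ℝ {X} := by
  obtain ⟨s, hs, rfl⟩ := hS
  obtain ⟨s', hs', hne⟩ : ∃ s', IsCurvatureSphere f x s' ∧ s' ≠ s := by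
    by_contra! h
    exact humb x (mem_univ x) ⟨s, hs, h⟩
  have aux : ∀ s, IsCurvatureSphere f x s → ∃ u ∈ f x, u ≠ 0 ∧ s = Submodule.span ℝ {u} := by
    intro s hs
    obtain ⟨u, hu0, hu⟩ := finrank_eq_one_iff'.1 hs.rank_one
    refine ⟨u, hs.le u.2, fun h => hu0 (Subtype.ext h), le_antisymm (fun w hw => ?_) ?_⟩
    · obtain ⟨c, hc⟩ := hu ⟨w, hw⟩
      exact Submodule.mem_span_singleton.2 ⟨c, congrArg Subtype.val hc⟩
    · rw [Submodule.span_singleton_le_iff_mem]; exact u.2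
  obtain ⟨u, huf, hu0, rfl⟩ := aux s hs
  obtain ⟨v, hvf, hv0, rfl⟩ := aux s' hs'
  have huv : LinearIndependent ℝ ![u, v] := by
    rw [LinearIndependent.pair_iff' hu0]
    rintro c rfl
    have hc : c ≠ 0 := by rintro rfl; exact hv0 (zero_smul _ _)
    exact hne (Submodule.span_singleton_smul_eq (IsUnit.mk0 c hc) _)
  obtain ⟨σ, τ, h, rfl, rfl⟩ := hf.subbundle.exists_frame (mem_univ x) huf hvf huv
  obtain ⟨X, hX, hX0⟩ := Submodule.exists_mem_ne_zero_of_ne_bot hs.space_ne_bot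
  obtain ⟨Y, hY, hY0⟩ := Submodule.exists_mem_ne_zero_of_ne_bot hs'.space_ne_bot
  have hX' := (h.mem_curvatureSpace_iff h.left).1 hX
  have hY' := (h.mem_curvatureSpace_iff h.right).1 hY
  -- Modulo `f`, derivatives of all sections are combinations of those of the frame, so the
  -- immersion condition need only be tested on `σ` and `τ`.
  have himm : ∀ Z : TangentSpace (𝓡 2) x, Z ≠ 0 → drv σ x Z ∈ f x → drv τ x Z ∉ f x := by
    intro Z hZ h1 h2
    refine hZ (hf.immersed x (mem_univ x) Z fun ρ hρ => ?_)
    obtain ⟨a, b, -, hd⟩ := h.exists_drv_sub_mem hρ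
    have := add_mem (hd Z) (add_mem (Submodule.smul_mem _ a h1) (Submodule.smul_mem _ b h2))
    rwa [sub_add_cancel] at this
  have hXτ := himm X hX0 hX'
  have hYσ : drv σ x Y ∉ f x := fun h1 => himm Y hY0 h1 hY'
  have hF : IsCurvatureFrame f x σ τ X Y := by
    refine ⟨h, hX', hY', hYσ, hXτ, ?_, exists_eq_smul_add_smul hX0 fun c hc => ?_⟩
    -- Symmetry exchanges `X` and `Y`, leaving the product of `d_X σ ∈ f` with `d_Y τ ∈ f^⊥`.
    · rw [form_drv_comm hf isOpen_univ (mem_univ x) h.left h.right]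
      exact hf.contact x (mem_univ x) τ h.right Y _ hX'
    · exact hYσ (by rw [← hc, map_smul]; exact Submodule.smul_mem _ _ hX')
  exact ⟨σ, τ, X, Y, hF, hF.curvatureSpace_left (hf.isContactAt (mem_univ x))⟩

end Curvature

/-! ### Unit sections of the sphere complex, and uniqueness -/

section SphereComplex

variable {M : Type*} [TopologicalSpace M] [ChartedSpace (EuclideanSpace ℝ (Fin 2)) M]
  {f L : M → Submodule ℝ R42} {T : ∀ x : M, Submodule ℝ (TangentSpace (𝓡 2) x)} {x : M}

/-- A smooth unit section of a spacelike line bundle in `perp f` whose derivative vanishes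
along `T`. -/
structure IsUnitSection (f L : M → Submodule ℝ R42)
    (T : ∀ x : M, Submodule ℝ (TangentSpace (𝓡 2) x)) (x : M) (l : M → R42) : Prop where
  smooth : SmoothNear l x
  span_eq : ∀ᶠ y in 𝓝 x, L y = Submodule.span ℝ {l y}
  unit : ∀ᶠ y in 𝓝 x, form (l y) (l y) = 1
  normal : ∀ᶠ y in 𝓝 x, l y ∈ perp (f y)
  drv_eq_zero : ∀ᶠ y in 𝓝 x, ∀ X ∈ T y, drv l y X = 0

theorem IsUnitSection.eventually {l : M → R42} (h : IsUnitSection f L T x l) :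
    ∀ᶠ y in 𝓝 x, IsUnitSection f L T y l := by
  filter_upwards [h.smooth.eventually, eventually_eventually_nhds.2 h.span_eq,
    eventually_eventually_nhds.2 h.unit, eventually_eventually_nhds.2 h.normal,
    eventually_eventually_nhds.2 h.drv_eq_zero] with y h1 h2 h3 h4 h5
  exact ⟨h1, h2, h3, h4, h5⟩

/-- After normalisation, a derivative along `T` is a multiple of the section, by constancy, and
orthogonal to it, by unit length. Hence it is zero. -/
theorem IsSphereComplexAlong.exists_unitSection (hL : IsSphereComplexAlong f T L) (x : M) :
    ∃ l : M → R42, IsUnitSection f L T x l := by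
  obtain ⟨m, hm, hmL⟩ := hL.subbundle.exists_section (mem_univ x)
  have hpos : ∀ᶠ y in 𝓝 x, 0 < form (m y) (m y) := by
    filter_upwards [hmL] with y hy
    exact hL.spacelike y (m y) (by rw [hy.1]; exact Submodule.mem_span_singleton_self _) hy.2
  have hN : SmoothNear (fun y => Real.sqrt (form (m y) (m y))) x := by
    refine SmoothNear.comp (φ := Real.sqrt) ?_ (hm.form hm)
    filter_upwards [lt_mem_nhds hpos.self_of_nhds] with t ht
    exact Real.contDiffAt_sqrt ht.ne'
  have hc : SmoothNear (fun y => (Real.sqrt (form (m y) (m y)))⁻¹) x :=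
    hN.inv (Real.sqrt_pos.2 hpos.self_of_nhds).ne'
  obtain ⟨s, hs, hspan, hunit⟩ : ∃ s : M → R42, SmoothNear s x ∧
      (∀ᶠ y in 𝓝 x, L y = Submodule.span ℝ {s y}) ∧ ∀ᶠ y in 𝓝 x, form (s y) (s y) = 1 := by
    refine ⟨_, hc.smul hm, ?_, ?_⟩
    · filter_upwards [hmL, hpos] with y h1 h2
      rw [h1.1, Submodule.span_singleton_smul_eq
        (IsUnit.mk0 _ (inv_ne_zero (Real.sqrt_pos.2 h2).ne'))]
    · filter_upwards [hpos] with y h2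
      have h3 := Real.mul_self_sqrt h2.le
      have h4 := (Real.sqrt_pos.2 h2).ne'
      simp only [map_smul, LinearMap.smul_apply, smul_eq_mul]
      field_simp
      nlinarith
  refine ⟨s, hs, hspan, hunit, ?_, ?_⟩
  · filter_upwards [hspan] with y hy
    exact hL.le_perp y (by rw [hy]; exact Submodule.mem_span_singleton_self _)
  · filter_upwards [hs.eventually, eventually_eventually_nhds.2 hspan,
      eventually_eventually_nhds.2 hunit] with y h1 h2 h3 X hX
    have hsec : IsSectionNear L y s :=
      ⟨h1, by filter_upwards [h2] with z hz; rw [hz]; exact Submodule.mem_span_singleton_self _⟩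
    have h4 := hL.constant y (mem_univ y) X hX _ hsec
    rw [h2.self_of_nhds] at h4
    obtain ⟨k, hk⟩ := Submodule.mem_span_singleton.1 h4
    have h5 := form_drv_add_eq_zero h1 h1 h3 X
    rw [dAt_eq_drv] at hk
    rw [← hk, map_smul, LinearMap.smul_apply, map_smul, h3.self_of_nhds, smul_eq_mul] at h5
    rw [← hk, show k = 0 by linarith, zero_smul]

section

variable {l σ τ : M → R42} {X Y : TangentSpace (𝓡 2) x}

/-- The unit section is orthogonal to the derivative of `f` along `T`. -/
theorem IsUnitSection.form_drv_eq_zero (hl : IsUnitSection f L T x l) (hX : X ∈ T x)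
    (hτ : IsSectionNear f x τ) : form (l x) (drv τ x X) = 0 := by
  have h0 : ∀ᶠ y in 𝓝 x, form (l y) (τ y) = 0 := by
    filter_upwards [hl.normal, hτ.mem] with y h1 h2
    rw [form_comm]; exact h1 _ h2
  have := form_drv_add_eq_zero hl.smooth hτ.smoothNear h0 X
  rwa [hl.drv_eq_zero.self_of_nhds X hX, map_zero, LinearMap.zero_apply, zero_add] at this

theorem IsUnitSection.notMem (hl : IsUnitSection f L T x l) (hf : IsContactAt f x) :
    l x ∉ f x := fun h => by
  have h1 := hf.null h _ h
  rw [hl.unit.self_of_nhds] at h1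
  exact one_ne_zero h1

/-- Vectors of `perp f` orthogonal to the derivative of `f` along `T` lie in `f ⊕ L`. -/
theorem IsUnitSection.sub_form_smul_mem (hl : IsUnitSection f L T x l) (hf : IsContactAt f x)
    (h : IsCurvatureFrame f x σ τ X Y) (hX : X ∈ T x) {v : R42} (hv : v ∈ perp (f x))
    (hvτ : form v (drv τ x X) = 0) : v - form v (l x) • l x ∈ f x := by
  have hu := hl.unit.self_of_nhds
  have h1 := hl.form_drv_eq_zero hX h.frame.right
  -- `l` and `d_X τ` form an orthogonal basis of `f^⊥ / f`; the difference is orthogonal to both.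
  refine mem_of_orthogonal_pair hf.null hf.finrank hl.normal.self_of_nhds
    (hf.contact _ h.frame.right X) (sub_mem hv (Submodule.smul_mem _ _ hl.normal.self_of_nhds))
    (hl.notMem hf) h.drv_right_notMem h1 ?_ ?_
  · rw [map_sub, map_smul, hu, form_comm v, smul_eq_mul, mul_one, sub_self]
  · rw [map_sub, map_smul, form_comm (drv τ x X) v, hvτ,
      form_comm (drv τ x X) (l x), h1, smul_zero, sub_zero]

/-- The unit section is immersed transversally to `T`. -/
theorem IsUnitSection.form_drv_ne_zero (hl : IsUnitSection f L T x l) (hf : IsContactAt f x)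
    (h : IsCurvatureFrame f x σ τ X Y) (hX : X ∈ T x) : form (drv σ x Y) (l x) ≠ 0 := by
  intro h0
  have h1 := hl.sub_form_smul_mem hf h hX (hf.contact _ h.frame.left Y) h.orthogonal
  rw [h0, zero_smul, sub_zero] at h1
  exact h.drv_left_notMem h1

theorem IsUnitSection.form_drv_unit (hl : IsUnitSection f L T x l) (hσ : IsSectionNear f x σ)
    (Z : TangentSpace (𝓡 2) x) : form (drv l x Z) (σ x) = - form (drv σ x Z) (l x) := by
  have h0 : ∀ᶠ y in 𝓝 x, form (l y) (σ y) = 0 := by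
    filter_upwards [hl.normal, hσ.mem] with y h1 h2
    rw [form_comm]; exact h1 _ h2
  have := form_drv_add_eq_zero hl.smooth hσ.smoothNear h0 Z
  rw [form_comm (drv σ x Z)]
  linarith

end

/-- A curve of spheres in `f` along `T` that is stationary contradicts regularity. -/
theorem IsRegular.eq_zero_of_drv_eq_zero (hreg : IsRegular f) {φ : M → R42} (hφ : SmoothNear φ x)
    (hm : ∀ᶠ y in 𝓝 x, φ y ∈ f y) (hT : ∀ y, T y ≠ ⊥) (hf : IsSubbundleOn 2 univ f)
    (hd : ∀ᶠ y in 𝓝 x, ∀ X ∈ T y, drv φ y X = 0) : φ x = 0 := by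
  by_contra h0
  obtain ⟨W, hW, hWo, hxW⟩ := eventually_nhds_iff.1
    ((hφ.and (hm.and hd)).and (hφ.continuousAt.eventually_ne h0))
  have hs : ∀ y ∈ W, SmoothNear φ y := fun y hy => by
    filter_upwards [hWo.mem_nhds hy] with z hz using (hW z hz).1.1
  have hsec : ∀ y ∈ W, IsSectionNear f y φ := fun y hy => ⟨hs y hy, by
    filter_upwards [hWo.mem_nhds hy] with z hz using (hW z hz).1.2.1⟩
  -- A nonzero `φ` would span a curvature sphere congruence, since its derivative along `T` is zero;
  -- for the same reason that congruence does not immerse.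
  have hcongr : IsCurvatureSphereCongruenceOn W f (fun y => Submodule.span ℝ {φ y}) := by
    refine ⟨isSubbundleOn_one_of_section fun y hy => ⟨φ, hs y hy, ?_⟩, fun y hy => ⟨?_, ?_, ?_⟩⟩
    · filter_upwards [hWo.mem_nhds hy] with z hz using ⟨hz, rfl, (hW z hz).2⟩
    · exact finrank_span_singleton (hW y hy).2
    · rw [Submodule.span_singleton_le_iff_mem]; exact (hW y hy).1.2.1
    · obtain ⟨σ, τ, h⟩ := hf.exists_frame' (mem_univ y)
      obtain ⟨X, hX, hX0⟩ := Submodule.exists_mem_ne_zero_of_ne_bot (hT y)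
      refine (Submodule.ne_bot_iff _).2 ⟨X, (h.mem_curvatureSpace_iff (hsec y hy)).2 ?_, hX0⟩
      rw [(hW y hy).1.2.2 X hX]; exact zero_mem _
  obtain ⟨X, hX, hX0⟩ := Submodule.exists_mem_ne_zero_of_ne_bot (hT x)
  refine hX0 (hreg W _ hWo hcongr x hxW X fun ρ hρ => ?_)
  obtain ⟨a, ha, he⟩ := exists_coeff_of_line hφ h0 (Filter.Eventually.of_forall fun _ => rfl) hρ
  rw [dAt_eq_drv, drv_congr he, drv_smul ha hφ, (hW x hxW).1.2.2 X hX, smul_zero, add_zero]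
  exact Submodule.smul_mem _ _ (Submodule.mem_span_singleton_self _)

theorem ne_bot_of_mem_curvatureDirections {S : Submodule ℝ (TangentSpace (𝓡 2) x)}
    (h : S ∈ curvatureDirections f x) : S ≠ ⊥ := by
  obtain ⟨s, hs, rfl⟩ := h
  exact hs.space_ne_bot

variable [IsManifold (𝓡 2) ∞ M]

/-- At most one sphere complex is constant along `T`. -/
theorem IsSphereComplexAlong.unique (hf : IsLegendreOn univ f) (humb : IsUmbilicFreeOn univ f)
    (hreg : IsRegular f) (hT : ∀ x, T x ∈ curvatureDirections f x) {L' : M → Submodule ℝ R42}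
    (hL : IsSphereComplexAlong f T L) (hL' : IsSphereComplexAlong f T L') : L' = L := by
  funext x
  obtain ⟨l, hl⟩ := hL.exists_unitSection x
  obtain ⟨m, hm⟩ := hL'.exists_unitSection x
  have hc := hm.smooth.form hl.smooth
  have hφ := hm.smooth.sub (hc.smul hl.smooth)
  -- The coefficient (m, l) is itself constant along `T`, so the difference, a section of `f`, is
  -- stationary along `T`.
  have h0 : m x - form (m x) (l x) • l x = 0 := by
    refine hreg.eq_zero_of_drv_eq_zero (T := T) hφ ?_
      (fun y => ne_bot_of_mem_curvatureDirections (hT y)) hf.subbundle ?_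
    · filter_upwards [hl.eventually, hm.eventually] with y hly hmy
      obtain ⟨σ, τ, X, Y, h, hTX⟩ := exists_curvatureFrame hf humb (hT y)
      have hX : X ∈ T y := by rw [hTX]; exact Submodule.mem_span_singleton_self _
      exact hly.sub_form_smul_mem (hf.isContactAt (mem_univ y)) h hX hmy.normal.self_of_nhds
        (hmy.form_drv_eq_zero hX h.frame.right)
    · filter_upwards [hl.eventually, hm.eventually] with y hly hmy X hX
      have e1 := hly.drv_eq_zero.self_of_nhds X hX
      have e2 := hmy.drv_eq_zero.self_of_nhds X hX
      have hcy := hmy.smooth.form hly.smooth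
      rw [drv_sub hmy.smooth (hcy.smul hly.smooth), drv_smul hcy hly.smooth,
        drv_form hmy.smooth hly.smooth, e1, e2]
      simp
  rw [sub_eq_zero] at h0
  have hm0 : form (m x) (l x) ≠ 0 := by
    intro hz
    have := hm.unit.self_of_nhds
    rw [h0, hz] at this
    simp at this
  rw [hl.span_eq.self_of_nhds, hm.span_eq.self_of_nhds]
  generalize form (m x) (l x) = c at h0 hm0
  rw [h0]
  exact Submodule.span_singleton_smul_eq (IsUnit.mk0 c hm0) _

/-- The derivative of a smooth map along a smooth vector field is continuous. -/
theorem SmoothNear.continuousAt_drv {F : Type*} [NormedAddCommGroup F] [NormedSpace ℝ F]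
    {g : M → F} (hg : SmoothNear g x) {W : Set M} (hW : IsOpen W) (hx : x ∈ W)
    {X : ∀ y : M, TangentSpace (𝓡 2) y}
    (hX : ContMDiffOn (𝓡 2) (𝓡 2).tangent ∞ (fun y => (⟨y, X y⟩ : TangentBundle (𝓡 2) M)) W) :
    ContinuousAt (fun y => drv g y (X y)) x := by
  obtain ⟨V, hV, hVo, hxV⟩ := eventually_nhds_iff.1 hg
  have hgV : ContMDiffOn (𝓡 2) 𝓘(ℝ, F) ∞ g V := fun y hy => (hV y hy).contMDiffWithinAt
  have h1 := hgV.continuousOn_tangentMapWithin (by simp) hVo.uniqueMDiffOn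
  have h2 : ContinuousAt (fun y => (⟨y, X y⟩ : TangentBundle (𝓡 2) M)) x :=
    hX.continuousOn.continuousAt (hW.mem_nhds hx)
  have hp : IsOpen (Bundle.TotalSpace.proj ⁻¹' V : Set (TangentBundle (𝓡 2) M)) :=
    hVo.preimage (FiberBundle.continuous_proj _ _)
  have h3 := (h1.continuousAt (hp.mem_nhds (show (⟨x, X x⟩ : TangentBundle (𝓡 2) M) ∈ _ from hxV)))
  have h4 := ContinuousAt.comp (f := fun y => (⟨y, X y⟩ : TangentBundle (𝓡 2) M)) h3 h2
  have h5 := (continuous_snd.comp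
    (tangentBundleModelSpaceHomeomorph 𝓘(ℝ, F)).continuous).continuousAt.comp h4
  refine h5.congr ?_
  filter_upwards [hVo.mem_nhds hxV] with y hy
  change mfderivWithin (𝓡 2) 𝓘(ℝ, F) g V y (X y) = mfderiv (𝓡 2) 𝓘(ℝ, F) g y (X y)
  rw [mfderivWithin_of_isOpen hVo hy]

end SphereComplex

/-! ### Existence of the sphere complex from spherical curvature lines -/

section Existence

variable {M : Type*} [TopologicalSpace M] [ChartedSpace (EuclideanSpace ℝ (Fin 2)) M]
  {f ν : M → Submodule ℝ R42} {T : ∀ x : M, Submodule ℝ (TangentSpace (𝓡 2) x)} {x : M} {p : R42}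

/-- A null plane is not orthogonal to a timelike vector. -/
theorem exists_form_ne_zero {E : Submodule ℝ R42} (hE : IsNull E) (h2 : Module.finrank ℝ E = 2)
    (hp : form p p < 0) : ∃ u ∈ E, form u p ≠ 0 := by
  by_contra! h
  have hpE : p ∉ E := fun hm => hp.ne (hE hm p hm)
  exact absurd (form_self_pos hE h2 (v := p) h hpE) hp.not_gt

theorem pair_smul_sub_smul_ne_zero {u v : R42} (huv : LinearIndependent ℝ ![u, v]) {a b : ℝ}
    (ha : a ≠ 0) : a • v - b • u ≠ 0 := fun h0 =>
  ha (LinearIndependent.pair_iff.1 huv (-b) a (by rw [← h0]; module)).2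

/-- The intersection of a plane with a hyperplane not containing it. -/
theorem span_pair_inf_perp {u v : R42} (hp : form p u ≠ 0) :
    Submodule.span ℝ {u, v} ⊓ perp (Submodule.span ℝ {p}) =
      Submodule.span ℝ {form p u • v - form p v • u} := by
  refine le_antisymm ?_ ?_
  · rintro w ⟨hv, hvp⟩
    obtain ⟨a, b, rfl⟩ := Submodule.mem_span_pair.1 hv
    have h4 := mem_perp_span_singleton.1 hvp
    rw [map_add, map_smul, map_smul, smul_eq_mul, smul_eq_mul] at h4
    refine Submodule.mem_span_singleton.2 ⟨b / form p u, ?_⟩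
    have ha : a = -(b / form p u * form p v) := by field_simp; linarith
    rw [ha, smul_sub, smul_smul, div_mul_cancel₀ _ hp]
    module
  · rw [Submodule.span_singleton_le_iff_mem]
    refine ⟨Submodule.mem_span_pair.2 ⟨-form p v, form p u, by module⟩, ?_⟩
    rw [SetLike.mem_coe, mem_perp_span_singleton]
    simp only [map_sub, map_smul, smul_eq_mul]; ring

theorem linearIndependent_pair_of_finrank {E : Submodule ℝ R42} {u v : R42}
    (h2 : Module.finrank ℝ E = 2) (h : E = Submodule.span ℝ {u, v}) :
    LinearIndependent ℝ ![u, v] := by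
  rw [linearIndependent_iff_card_eq_finrank_span, Set.finrank, Matrix.range_cons,
    Matrix.range_cons, Matrix.range_empty, union_empty, singleton_union, ← h, h2,
    Fintype.card_fin]

/-- The point sphere map `f ∩ p^⊥` is a smooth line bundle. -/
theorem IsLegendreOn.exists_point_sphere (hf : IsLegendreOn univ f) (hp : form p p < 0) (x : M) :
    ∃ σ ρ : M → R42, IsSectionNear f x σ ∧ SmoothNear ρ x ∧
      ∀ᶠ y in 𝓝 x, form p (σ y) ≠ 0 ∧ ρ y ≠ 0 ∧
        f y ⊓ perp (Submodule.span ℝ {p}) = Submodule.span ℝ {ρ y} := by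
  obtain ⟨u, hu, hup⟩ := exists_form_ne_zero (hf.null x (mem_univ x))
    (hf.subbundle.1 x (mem_univ x)) hp
  obtain ⟨σ, τ, h⟩ := hf.subbundle.exists_frame' (mem_univ x)
  wlog hσ : form p (σ x) ≠ 0 generalizing σ τ
  · refine this τ σ h.swap fun hτ => hup ?_
    rw [not_not] at hσ
    rw [h.span_eq.self_of_nhds] at hu
    obtain ⟨a, b, rfl⟩ := Submodule.mem_span_pair.1 hu
    rw [form_comm, map_add, map_smul, map_smul, hσ, hτ, smul_zero, smul_zero, add_zero]
  have sp := smoothNear_const (M := M) (x := x) p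
  have sσ := sp.form h.smooth_left
  have sτ := sp.form h.smooth_right
  refine ⟨σ, fun y => form p (σ y) • τ y - form p (τ y) • σ y, h.left,
    (sσ.smul h.smooth_right).sub (sτ.smul h.smooth_left), ?_⟩
  filter_upwards [sσ.continuousAt.eventually_ne hσ, h.span_eq] with y h1 h2
  have hind := linearIndependent_pair_of_finrank (hf.subbundle.1 y (mem_univ y)) h2
  exact ⟨h1, pair_smul_sub_smul_ne_zero hind h1, by rw [h2, span_pair_inf_perp h1]⟩

/-- Regularity prevents the point sphere map from being the curvature sphere of `T`. -/
theorem IsRegular.exists_not_le (hreg : IsRegular f) (hf : IsLegendreOn univ f)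
    (hp : form p p < 0) (hT : ∀ y, T y ≠ ⊥) {U : Set M} (hU : IsOpen U) (hx : x ∈ U) :
    ∃ y ∈ U, ¬ T y ≤ curvatureSpace f y (f y ⊓ perp (Submodule.span ℝ {p})) := by
  by_contra! h
  have hsub : IsSubbundleOn 1 U (fun y => f y ⊓ perp (Submodule.span ℝ {p})) := by
    refine isSubbundleOn_one_of_section fun y hy => ?_
    obtain ⟨_, ρ, _, hρ, he⟩ := hf.exists_point_sphere hp y
    refine ⟨ρ, hρ, ?_⟩
    filter_upwards [he, hU.mem_nhds hy] with z h1 h2 using ⟨h2, h1.2.2, h1.2.1⟩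
  have hcongr : IsCurvatureSphereCongruenceOn U f
      (fun y => f y ⊓ perp (Submodule.span ℝ {p})) := by
    refine ⟨hsub, fun y hy => ⟨hsub.1 y hy, inf_le_left, fun hb => ?_⟩⟩
    have := h y hy
    rw [hb, le_bot_iff] at this
    exact hT y this
  obtain ⟨X, hX, hX0⟩ := Submodule.exists_mem_ne_zero_of_ne_bot (hT x)
  -- Along `T` the derivative of the point sphere map stays in `f`, being that of a curvature
  -- sphere, and in `p^⊥`, since `p` is constant. Thus it stays in the line itself.
  refine hX0 (hreg U _ hU hcongr x hx X fun σ hσ => ⟨?_, ?_⟩)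
  · have hσf : IsSectionNear f x σ := ⟨hσ.smooth, hσ.mem.mono fun y hy => hy.1⟩
    exact h x hx hX σ hσf hσ.mem_self
  · rw [SetLike.mem_coe, mem_perp_span_singleton]
    have h0 : ∀ᶠ y in 𝓝 x, form p (σ y) = 0 :=
      hσ.mem.mono fun y hy => mem_perp_span_singleton.1 hy.2
    have := form_drv_add_eq_zero (smoothNear_const p) hσ.smoothNear h0 X
    rwa [drv_const, zero_apply, map_zero, LinearMap.zero_apply, zero_add]
      at this

/-- The bundle `(ν ⊕ ⟨p⟩) ∩ f^⊥`. -/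
def sphereComplex (f ν : M → Submodule ℝ R42) (p : R42) (x : M) : Submodule ℝ R42 :=
  (ν x ⊔ Submodule.span ℝ {p}) ⊓ perp (f x)

/-- Both ν and `p` are orthogonal to `f ∩ p^⊥`, so a combination is orthogonal to `f` as soon as it
is orthogonal to one further section `σ` with `(p, σ) ≠ 0`. This fixes the coefficient `c` as a
smooth quotient. -/
theorem exists_sphereComplex_section (hf : IsLegendreOn univ f) (hp : form p p < 0)
    (hν : IsSubbundleOn 1 univ ν) (hνn : ∀ x, IsNull (ν x))
    (hνp : ∀ x, f x ⊓ perp (Submodule.span ℝ {p}) ≤ perp (ν x))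
    (x : M) : ∃ (n : M → R42) (c : M → ℝ), IsSectionNear ν x n ∧ SmoothNear c x ∧
      ∀ᶠ y in 𝓝 x, n y - c y • p ≠ 0 ∧
        sphereComplex f ν p y = Submodule.span ℝ {n y - c y • p} := by
  obtain ⟨σ, ρ, hσ, hρ, he⟩ := hf.exists_point_sphere hp x
  obtain ⟨n, hn, hnν⟩ := hν.exists_section (mem_univ x)
  have sp := smoothNear_const (M := M) (x := x) p
  have hc := (hn.form hσ.smoothNear).div (sp.form hσ.smoothNear) he.self_of_nhds.1
  refine ⟨n, _, ⟨hn, hnν.mono fun y hy => ?_⟩, hc, ?_⟩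
  · rw [hy.1]; exact Submodule.mem_span_singleton_self _
  filter_upwards [he, hnν, hσ.mem] with y h1 h2 h3
  obtain ⟨hpσ, hρ0, hfp⟩ := h1
  obtain ⟨hνy, hn0⟩ := h2
  have hnn : form (n y) (n y) = 0 := by
    have hm : n y ∈ ν y := by rw [hνy]; exact Submodule.mem_span_singleton_self _
    exact hνn y hm _ hm
  set c := form (n y) (σ y) / form p (σ y) with hcdef
  have hcσ : form (n y - c • p) (σ y) = 0 := by
    rw [map_sub, LinearMap.sub_apply, map_smul, LinearMap.smul_apply, smul_eq_mul, hcdef,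
      div_mul_cancel₀ _ hpσ, sub_self]
  have hmem : n y - c • p ∈ ν y ⊔ Submodule.span ℝ {p} := by
    refine sub_mem (Submodule.mem_sup_left ?_) (Submodule.mem_sup_right ?_)
    · rw [hνy]; exact Submodule.mem_span_singleton_self _
    · exact Submodule.smul_mem _ _ (Submodule.mem_span_singleton_self _)
  have hperp : n y - c • p ∈ perp (f y) := by
    intro v hv
    have hw : v - (form p v / form p (σ y)) • σ y ∈ f y ⊓ perp (Submodule.span ℝ {p}) := by
      refine ⟨sub_mem hv (Submodule.smul_mem _ _ h3), ?_⟩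
      rw [SetLike.mem_coe, mem_perp_span_singleton, map_sub, map_smul, smul_eq_mul,
        div_mul_cancel₀ _ hpσ, sub_self]
    have e1 : form (n y) (v - (form p v / form p (σ y)) • σ y) = 0 := by
      refine hνp y hw _ ?_
      rw [hνy]; exact Submodule.mem_span_singleton_self _
    have e2 : form p (v - (form p v / form p (σ y)) • σ y) = 0 := mem_perp_span_singleton.1 hw.2
    change form v (n y - c • p) = 0
    rw [form_comm]
    have e3 : form (n y - c • p) (v - (form p v / form p (σ y)) • σ y) = 0 := by
      rw [map_sub form, LinearMap.sub_apply, e1, map_smul form, LinearMap.smul_apply, e2,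
        smul_zero, sub_zero]
    rwa [map_sub, map_smul, hcσ, smul_zero, sub_zero] at e3
  refine ⟨fun h0 => ?_, le_antisymm ?_ ?_⟩
  -- If `n = c p`, then `n` null and `p` timelike give `c = 0`, and `n` would vanish.
  · rw [sub_eq_zero] at h0
    rw [h0] at hnn hn0
    simp only [map_smul, LinearMap.smul_apply, smul_eq_mul, mul_eq_zero, hp.ne, or_false,
      or_self] at hnn
    rw [hnn, zero_smul] at hn0
    exact hn0 rfl
  · rintro v ⟨hv, hvf⟩
    obtain ⟨a, ha, b, hb, rfl⟩ := Submodule.mem_sup.1 hv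
    rw [hνy] at ha
    obtain ⟨a, rfl⟩ := Submodule.mem_span_singleton.1 ha
    obtain ⟨b, rfl⟩ := Submodule.mem_span_singleton.1 hb
    have h4 := hvf _ h3
    change form _ _ = 0 at h4
    rw [form_comm, map_add, LinearMap.add_apply, map_smul, map_smul, LinearMap.smul_apply,
      LinearMap.smul_apply, smul_eq_mul, smul_eq_mul] at h4
    refine Submodule.mem_span_singleton.2 ⟨a, ?_⟩
    have hb : b = -(a * c) := by rw [hcdef]; field_simp; linarith
    rw [hb]; module
  · rw [Submodule.span_singleton_le_iff_mem]
    exact ⟨hmem, hperp⟩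

/-- Constancy of the sphere complex at points where the curvature sphere is not the point
sphere. -/
theorem drv_mem_sphereComplex (hνT : IsConstantAlong univ T ν)
    (hνp : ∀ x, f x ⊓ perp (Submodule.span ℝ {p}) ≤ perp (ν x)) {n : M → R42} {c : M → ℝ}
    (hn : IsSectionNear ν x n) (hc : SmoothNear c x)
    (he : ∀ᶠ y in 𝓝 x, sphereComplex f ν p y = Submodule.span ℝ {n y - c y • p})
    {σ : M → R42} (hσ : IsSectionNear f x σ) {X : TangentSpace (𝓡 2) x} (hX : X ∈ T x)
    (hσX : drv σ x X ∈ f x) (hpσ : form p (σ x) ≠ 0) :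
    drv (fun y => n y - c y • p) x X ∈ sphereComplex f ν p x := by
  have sp := smoothNear_const (M := M) (x := x) p
  have hl := hn.smoothNear.sub (hc.smul sp)
  have hlperp : ∀ᶠ y in 𝓝 x, n y - c y • p ∈ perp (f y) := by
    filter_upwards [he] with y hy
    have : n y - c y • p ∈ sphereComplex f ν p y := by
      rw [hy]; exact Submodule.mem_span_singleton_self _
    exact this.2
  have h1 : drv (fun y => n y - c y • p) x X ∈ ν x ⊔ Submodule.span ℝ {p} := by
    rw [drv_sub hn.smoothNear (hc.smul sp), drv_smul hc sp, drv_const,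
      zero_apply, smul_zero, add_zero]
    exact sub_mem (Submodule.mem_sup_left (hνT x (mem_univ x) X hX n hn))
      (Submodule.mem_sup_right (Submodule.smul_mem _ _ (Submodule.mem_span_singleton_self _)))
  have h0 : ∀ᶠ y in 𝓝 x, form (n y - c y • p) (σ y) = 0 := by
    filter_upwards [hlperp, hσ.mem] with y h2 h3
    rw [form_comm]; exact h2 _ h3
  have h2 := form_drv_add_eq_zero hl hσ.smoothNear h0 X
  -- Because `d_X σ ∈ f`, the product rule for (l, σ) = 0 leaves `d_X l` orthogonal to `σ`. On the
  -- complementary line `f ∩ p^⊥` orthogonality is automatic, as `d_X l` lies in ν ⊕ ⟨p⟩.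
  have h3 : form (n x - c x • p) (drv σ x X) = 0 := by
    rw [form_comm]; exact hlperp.self_of_nhds _ hσX
  rw [h3, add_zero] at h2
  refine ⟨h1, fun v hv => ?_⟩
  have hw : v - (form p v / form p (σ x)) • σ x ∈ f x ⊓ perp (Submodule.span ℝ {p}) := by
    refine ⟨sub_mem hv (Submodule.smul_mem _ _ hσ.mem_self), ?_⟩
    rw [SetLike.mem_coe, mem_perp_span_singleton, map_sub, map_smul, smul_eq_mul,
      div_mul_cancel₀ _ hpσ, sub_self]
  have e1 : form (drv (fun y => n y - c y • p) x X)
      (v - (form p v / form p (σ x)) • σ x) = 0 := by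
    obtain ⟨a, ha, b, hb, hab⟩ := Submodule.mem_sup.1 h1
    rw [← hab, map_add, LinearMap.add_apply, hνp x hw a ha, hw.2 b hb, add_zero]
  rw [map_sub, map_smul, h2, smul_zero, sub_zero] at e1
  change form _ _ = 0
  rw [form_comm, e1]

variable [IsManifold (𝓡 2) ∞ M]

/-- Spherical curvature lines determine a sphere complex constant along them. -/
theorem HasSphericalCurvatureLines.exists_sphereComplex (hf : IsLegendreOn univ f)
    (humb : IsUmbilicFreeOn univ f) (hreg : IsRegular f) (hT : HasSphericalCurvatureLines f T) :
    ∃ L, IsSphereComplexAlong f T L := by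
  obtain ⟨p, ν, hp, hν, hνn, hνT, hνp, htr⟩ := hT.spherical
  have hTb : ∀ y, T y ≠ ⊥ := fun y => ne_bot_of_mem_curvatureDirections (hT.curvature y)
  refine ⟨sphereComplex f ν p, ?_, fun x v hv hv0 => ?_, fun x => inf_le_right, ?_⟩
  · refine isSubbundleOn_one_of_section fun x _ => ?_
    obtain ⟨n, c, hn, hc, he⟩ := exists_sphereComplex_section hf hp hν hνn hνp x
    refine ⟨_, hn.smoothNear.sub (hc.smul (smoothNear_const p)), ?_⟩
    filter_upwards [he] with y hy using ⟨mem_univ y, hy.2, hy.1⟩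
  · refine form_self_pos (hf.null x (mem_univ x)) (hf.subbundle.1 x (mem_univ x)) hv.2 fun hvf => ?_
    have : v ∈ (ν x ⊔ Submodule.span ℝ {p}) ⊓ f x := ⟨hv.1, hvf⟩
    rw [htr x] at this
    exact hv0 this
  · intro x _ X hX ρ hρ
    obtain ⟨n, c, hn, hc, he⟩ := exists_sphereComplex_section hf hp hν hνn hνp x
    have hl := hn.smoothNear.sub (hc.smul (smoothNear_const p))
    obtain ⟨W, hW, hxW, Z, hZ, hZT⟩ := hT.distribution x
    have hcont := hl.continuousAt_drv hW hxW hZ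
    set l : M → R42 := fun y => n y - c y • p with hldef
    have hl0 : l x ≠ 0 := he.self_of_nhds.1
    have hform : ∀ y, l y ≠ 0 → l y ∈ sphereComplex f ν p y → form (l y) (l y) ≠ 0 := by
      intro y h0 hy
      refine (form_self_pos (hf.null y (mem_univ y)) (hf.subbundle.1 y (mem_univ y)) hy.2
        fun hvf => h0 ?_).ne'
      have : l y ∈ (ν y ⊔ Submodule.span ℝ {p}) ⊓ f y := ⟨hy.1, hvf⟩
      rwa [htr y] at this
    have hlx : sphereComplex f ν p x = Submodule.span ℝ {l x} := he.self_of_nhds.2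
    -- As (l, l) ≠ 0, this expression vanishes exactly where `d_Z l` is a multiple of `l`. Its
    -- continuity carries constancy from nearby points, where the curvature sphere is not the point
    -- sphere, to `x`.
    have hG : ContinuousAt (fun y => form (l y) (l y) • drv l y (Z y) -
        form (l y) (drv l y (Z y)) • l y) x := by
      have c1 : ContinuousAt (fun y => formL (l y)) x :=
        formL.continuous.continuousAt.comp hl.continuousAt
      exact ((c1.clm_apply hl.continuousAt).smul hcont).sub
        ((c1.clm_apply hcont).smul hl.continuousAt)
    have hGx : form (l x) (l x) • drv l x (Z x) - form (l x) (drv l x (Z x)) • l x = 0 := by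
      by_contra hne
      have hev := hG.eventually_ne hne
      obtain ⟨V, hV, hVo, hxV⟩ := eventually_nhds_iff.1
        (((hev.and (hW.mem_nhds hxW)).and (eventually_eventually_nhds.2 he)).and
          (hn.eventually.and hc.eventually))
      obtain ⟨y, hyV, hy⟩ := hreg.exists_not_le hf hp hTb hVo hxV
      obtain ⟨⟨⟨hy1, hyW⟩, hye⟩, hyn, hyc⟩ := hV y hyV
      obtain ⟨σ, τ, X', Y, h, hTX⟩ := exists_curvatureFrame hf humb (hT.curvature y)
      have hZy : Z y ∈ T y := by
        rw [(hZT y hyW).2]; exact Submodule.mem_span_singleton_self _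
      have hcs := h.curvatureSpace_left (hf.isContactAt (mem_univ y))
      have hσZ : drv σ y (Z y) ∈ f y := by
        rw [← h.frame.mem_curvatureSpace_iff h.frame.left, hcs, ← hTX]; exact hZy
      -- Otherwise `σ` would span the point sphere at `y`, whose curvature space would then contain
      -- `T y`, contrary to the choice of `y`.
      have hpσ : form p (σ y) ≠ 0 := by
        intro h0
        refine hy ?_
        obtain ⟨_, ρ', _, _, heρ⟩ := hf.exists_point_sphere hp y
        obtain ⟨-, -, hfp⟩ := heρ.self_of_nhds
        have hσm : σ y ∈ f y ⊓ perp (Submodule.span ℝ {p}) :=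
          ⟨h.frame.left.mem_self, mem_perp_span_singleton.2 h0⟩
        have heq : f y ⊓ perp (Submodule.span ℝ {p}) = Submodule.span ℝ {σ y} := by
          rw [hfp] at hσm ⊢
          obtain ⟨k, hk⟩ := Submodule.mem_span_singleton.1 hσm
          have hk0 : k ≠ 0 := by
            rintro rfl
            exact h.frame.linInd.ne_zero 0 (by rw [zero_smul] at hk; exact hk.symm)
          rw [← hk, Submodule.span_singleton_smul_eq (IsUnit.mk0 k hk0)]
        rw [heq, hcs, hTX]
      have hmem := drv_mem_sphereComplex hνT hνp hyn hyc (hye.mono fun z hz => hz.2)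
        h.frame.left hZy hσZ hpσ
      rw [hye.self_of_nhds.2] at hmem
      obtain ⟨k, hk⟩ := Submodule.mem_span_singleton.1 hmem
      refine hy1 ?_
      change k • l y = drv l y (Z y) at hk
      rw [← hk, map_smul, smul_smul, smul_eq_mul, mul_comm, sub_self]
    have hZx := (hZT x hxW).2
    rw [hZx] at hX
    obtain ⟨k, rfl⟩ := Submodule.mem_span_singleton.1 hX
    obtain ⟨a, ha, hρa⟩ := exists_coeff_of_line hl hl0 (he.mono fun z hz => hz.2) hρ
    have hlm : l x ∈ sphereComplex f ν p x := by
      rw [hlx]; exact Submodule.mem_span_singleton_self _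
    have hd : drv l x (Z x) ∈ sphereComplex f ν p x := by
      have hq := hform x hl0 hlm
      rw [sub_eq_zero] at hGx
      have : drv l x (Z x) =
          (form (l x) (l x))⁻¹ • (form (l x) (drv l x (Z x)) • l x) := by
        rw [← hGx, inv_smul_smul₀ hq]
      rw [this]
      exact Submodule.smul_mem _ _ (Submodule.smul_mem _ _ hlm)
    rw [dAt_eq_drv, map_smul, drv_congr hρa, drv_smul ha hl]
    exact Submodule.smul_mem _ _ (add_mem (Submodule.smul_mem _ _ hlm) (Submodule.smul_mem _ _ hd))

end Existence

/-! ### Transforms by parallel null lines -/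

section Transform

variable {M : Type*} [TopologicalSpace M] [ChartedSpace (EuclideanSpace ℝ (Fin 2)) M]
  {f L s : M → Submodule ℝ R42} {T : ∀ x : M, Submodule ℝ (TangentSpace (𝓡 2) x)} {x : M}
  {U : Set M}

/-- The connection `D^L` in terms of a unit section of `L`. -/
theorem IsUnitSection.connD_eq {l w : M → R42} (hl : IsUnitSection f L T x l) (hw : SmoothNear w x)
    (Z : TangentSpace (𝓡 2) x) : connD L w x Z =
      drv w x Z + form (w x) (drv l x Z) • l x - form (w x) (l x) • drv l x Z := by
  have hc := hw.form hl.smooth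
  have hu := hl.unit.self_of_nhds
  have e1 : ∀ᶠ y in 𝓝 x, orthProj (L y) (w y) = form (w y) (l y) • l y := by
    filter_upwards [hl.span_eq, hl.unit] with y h1 h2
    rw [h1, orthProj_span_singleton h2]
  have e2 : ∀ᶠ y in 𝓝 x, orthProj (perp (L y)) (w y) = w y - form (w y) (l y) • l y := by
    filter_upwards [hl.span_eq, hl.unit] with y h1 h2
    rw [h1, orthProj_perp_span_singleton h2]
  have h3 := form_drv_add_eq_zero hl.smooth hl.smooth hl.unit Z
  have h4 : form (drv l x Z) (l x) = 0 := by
    rw [form_comm (l x)] at h3; linarith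
  -- Projecting the derivatives of `(w, l) l` and `w - (w, l) l` simplifies because unit length
  -- gives `(dl, l) = 0`.
  rw [connD, dAt_eq_drv, dAt_eq_drv, drv_congr e1, drv_congr e2,
    drv_sub hw (hc.smul hl.smooth), drv_smul hc hl.smooth, drv_form hw hl.smooth,
    hl.span_eq.self_of_nhds, orthProj_span_singleton hu, orthProj_perp_span_singleton hu]
  simp only [map_add, map_sub, map_smul, LinearMap.add_apply, LinearMap.sub_apply,
    LinearMap.smul_apply, smul_eq_mul, h4, hu]
  module

theorem IsSubbundleOn.mono {r : ℕ} {V : Set M} {E : M → Submodule ℝ R42} (h : IsSubbundleOn r U E)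
    (hV : IsOpen V) (hVU : V ⊆ U) : IsSubbundleOn r V E := by
  refine ⟨fun x hx => h.1 x (hVU hx), fun x hx => ?_⟩
  obtain ⟨W, hW, hxW, -, σ, hσ, hs⟩ := h.2 x (hVU hx)
  exact ⟨W ∩ V, hW.inter hV, ⟨hxW, hx⟩, inter_subset_right, σ,
    fun i => (hσ i).mono inter_subset_left, fun y hy => hs y hy.1⟩

theorem IsLegendreOn.mono {V : Set M} (h : IsLegendreOn U f) (hV : IsOpen V) (hVU : V ⊆ U) :
    IsLegendreOn V f :=
  ⟨h.subbundle.mono hV hVU, fun x hx => h.null x (hVU hx), fun x hx => h.contact x (hVU hx),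
    fun x hx => h.immersed x (hVU hx)⟩

theorem IsFrameNear.add_smul {E : M → Submodule ℝ R42} {σ τ : M → R42} (h : IsFrameNear E x σ τ)
    (m : ℝ) : IsFrameNear E x σ (fun y => τ y + m • σ y) := by
  refine ⟨h.smooth_left, h.smooth_right.add ((smoothNear_const m).smul h.smooth_left), ?_, ?_⟩
  · filter_upwards [h.span_eq] with y hy
    rw [hy]
    refine le_antisymm ?_ ?_ <;> rw [Submodule.span_le, insert_subset_iff, singleton_subset_iff]
    · exact ⟨Submodule.subset_span (by simp), Submodule.mem_span_pair.2 ⟨-m, 1, by module⟩⟩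
    · exact ⟨Submodule.subset_span (by simp), Submodule.mem_span_pair.2 ⟨m, 1, by module⟩⟩
  · rw [LinearIndependent.pair_iff]
    intro a b hab
    have := LinearIndependent.pair_iff.1 h.linInd (a + b * m) b (by rw [← hab]; module)
    exact ⟨by simpa [this.2] using this.1, this.2⟩

/-- The local data near a point from which a transform is built. -/
structure IsTransformData (f L s : M → Submodule ℝ R42)
    (T : ∀ x : M, Submodule ℝ (TangentSpace (𝓡 2) x)) (x : M) (l w σ τ : M → R42)
    (X Y : TangentSpace (𝓡 2) x) : Prop where
  contact : ∀ᶠ y in 𝓝 x, IsContactAt f y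
  unit : IsUnitSection f L T x l
  frame : IsCurvatureFrame f x σ τ X Y
  mem : X ∈ T x
  smooth : SmoothNear w x
  span_eq : ∀ᶠ y in 𝓝 x, s y = Submodule.span ℝ {w y} ∧ w y ≠ 0
  null : ∀ᶠ y in 𝓝 x, form (w y) (w y) = 0
  normal : ∀ᶠ y in 𝓝 x, form (w y) (l y) = 0
  parallel : ∀ Z, connD L w x Z ∈ s x
  form_ne_zero : form (w x) (σ x) ≠ 0
  not_stationary : ∃ (ρ : M → R42) (Z : TangentSpace (𝓡 2) x), IsSectionNear s x ρ ∧
    dAt ρ x Z ∉ s x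

namespace IsTransformData

variable {l w σ τ : M → R42} {X Y : TangentSpace (𝓡 2) x}

/-- A section of `f ∩ s^⊥`. -/
def commonSphere {N : Type*} (w σ τ : N → R42) (y : N) : R42 :=
  form (w y) (σ y) • τ y - form (w y) (τ y) • σ y

/-- Since `w` is orthogonal to `l`, parallelism of its line leaves only the `l`-component of its
derivative beyond a multiple of `w`. Every later computation with the transform uses this formula.
-/
theorem exists_drv (h : IsTransformData f L s T x l w σ τ X Y) (Z : TangentSpace (𝓡 2) x) :
    ∃ k : ℝ, drv w x Z = k • w x - form (w x) (drv l x Z) • l x := by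
  have h1 := h.parallel Z
  rw [h.unit.connD_eq h.smooth, h.normal.self_of_nhds, zero_smul, sub_zero,
    h.span_eq.self_of_nhds.1] at h1
  obtain ⟨k, hk⟩ := Submodule.mem_span_singleton.1 h1
  exact ⟨k, by rw [hk]; abel⟩

/-- `dl` already vanishes on `X`. Were `(w, d_Y l)` zero too, the derivative of `w` would be a
multiple of `w` in every direction and the null line would be stationary. -/
theorem form_drv_ne_zero (h : IsTransformData f L s T x l w σ τ X Y) :
    form (w x) (drv l x Y) ≠ 0 := by
  intro h0
  obtain ⟨ρ, Z, hρ, hZ⟩ := h.not_stationary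
  obtain ⟨hs, hw0⟩ := h.span_eq.self_of_nhds
  obtain ⟨a, ha, he⟩ := exists_coeff_of_line h.smooth hw0 (h.span_eq.mono fun y hy => hy.1) hρ
  obtain ⟨k, hk⟩ := h.exists_drv Z
  have hlZ : form (w x) (drv l x Z) = 0 := by
    obtain ⟨b, c, rfl⟩ := h.frame.spans Z
    rw [map_add, map_smul, map_smul, h.unit.drv_eq_zero.self_of_nhds X h.mem, smul_zero, zero_add,
      map_smul, h0, smul_zero]
  refine hZ ?_
  have hm : w x ∈ s x := by rw [hs]; exact Submodule.mem_span_singleton_self _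
  rw [dAt_eq_drv, drv_congr he, drv_smul ha h.smooth, hk, hlZ, zero_smul, sub_zero]
  exact add_mem (Submodule.smul_mem _ _ hm) (Submodule.smul_mem _ _ (Submodule.smul_mem _ _ hm))

theorem commonSphere_smooth (h : IsTransformData f L s T x l w σ τ X Y) :
    SmoothNear (commonSphere w σ τ) x :=
  ((h.smooth.form h.frame.frame.smooth_left).smul h.frame.frame.smooth_right).sub
    ((h.smooth.form h.frame.frame.smooth_right).smul h.frame.frame.smooth_left)

theorem eventually_span (h : IsTransformData f L s T x l w σ τ X Y) :
    ∀ᶠ y in 𝓝 x, form (w y) (σ y) ≠ 0 ∧ commonSphere w σ τ y ≠ 0 ∧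
      f y ⊓ perp (s y) = Submodule.span ℝ {commonSphere w σ τ y} ∧
      transform f s y = Submodule.span ℝ {commonSphere w σ τ y, w y} := by
  have hc := (h.smooth.form h.frame.frame.smooth_left).continuousAt.eventually_ne h.form_ne_zero
  filter_upwards [hc, h.frame.frame.span_eq, h.span_eq, h.contact] with y h1 h2 h3 h4
  have h5 : f y ⊓ perp (s y) = Submodule.span ℝ {commonSphere w σ τ y} := by
    rw [h2, h3.1, span_pair_inf_perp h1, commonSphere]
  refine ⟨h1, ?_, h5, ?_⟩
  · exact pair_smul_sub_smul_ne_zero (linearIndependent_pair_of_finrank h4.finrank h2) h1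
  · rw [transform, h5, h3.1, Submodule.span_insert]

theorem commonSphere_section (h : IsTransformData f L s T x l w σ τ X Y) :
    IsSectionNear f x (commonSphere w σ τ) :=
  ⟨h.commonSphere_smooth, h.eventually_span.mono fun y hy => by
    have : commonSphere w σ τ y ∈ f y ⊓ perp (s y) := by
      rw [hy.2.2.1]; exact Submodule.mem_span_singleton_self _
    exact this.1⟩

theorem form_commonSphere {N : Type*} (w σ τ : N → R42) (y : N) : form (w y) (commonSphere w σ τ y) = 0 := by
  simp only [commonSphere, map_sub, map_smul, smul_eq_mul]; ring

/-- At nearby points, `f` meets the transform in the common sphere only. -/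
theorem eventually_inf (h : IsTransformData f L s T x l w σ τ X Y) :
    ∀ᶠ y in 𝓝 x, f y ⊓ transform f s y = Submodule.span ℝ {commonSphere w σ τ y} := by
  filter_upwards [h.eventually_span, h.contact, h.commonSphere_section.mem,
    h.frame.frame.left.mem] with y h1 h2 h3 h4
  refine le_antisymm ?_ ?_
  · rintro v ⟨hvf, hv⟩
    rw [SetLike.mem_coe, h1.2.2.2] at hv
    obtain ⟨a, b, rfl⟩ := Submodule.mem_span_pair.1 hv
    have h5 : form (σ y) (a • commonSphere w σ τ y + b • w y) = 0 := h2.null hvf _ h4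
    have h6 : form (σ y) (commonSphere w σ τ y) = 0 := h2.null h3 _ h4
    rw [map_add, map_smul, map_smul, h6, smul_zero, zero_add, form_comm, smul_eq_mul,
      mul_eq_zero] at h5
    rw [h5.resolve_right h1.1, zero_smul, add_zero]
    exact Submodule.smul_mem _ _ (Submodule.mem_span_singleton_self _)
  · rw [Submodule.span_singleton_le_iff_mem]
    refine ⟨h3, ?_⟩
    rw [h1.2.2.2]
    exact Submodule.subset_span (by simp)

/-- Independence is detected by pairing with `σ`, which kills the common sphere but not `w`. -/
theorem transform_frame (h : IsTransformData f L s T x l w σ τ X Y) :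
    IsFrameNear (transform f s) x w (commonSphere w σ τ) := by
  refine IsFrameNear.swap ⟨h.commonSphere_smooth, h.smooth,
    h.eventually_span.mono fun y hy => hy.2.2.2, ?_⟩
  rw [LinearIndependent.pair_iff]
  intro a b hab
  have h1 := h.eventually_span.self_of_nhds
  have h3 := h.commonSphere_section.mem_self
  have h4 := h.frame.frame.left.mem_self
  have h6 : form (σ x) (commonSphere w σ τ x) = 0 := h.contact.self_of_nhds.null h3 _ h4
  have h5 := congrArg (form (σ x)) hab
  rw [map_add, map_smul, map_smul, h6, smul_zero, zero_add, map_zero, form_comm, smul_eq_mul,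
      mul_eq_zero] at h5
  have hb := h5.resolve_right h1.1
  rw [hb, zero_smul, add_zero, smul_eq_zero] at hab
  exact ⟨hab.resolve_right h1.2.1, hb⟩

/-- The derivative of `w` lies in ⟨w, l⟩, and `l` is orthogonal to `w` and to the common sphere.
Differentiating the vanishing product of `w` with the common sphere gives the remaining mixed
relation. -/
theorem transform_isContactAt (h : IsTransformData f L s T x l w σ τ X Y) :
    IsContactAt (transform f s) x := by
  have hF := h.transform_frame
  have hspan := hF.span_eq.self_of_nhds
  have hw0 := h.null.self_of_nhds
  have hwl := h.normal.self_of_nhds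
  have hwc := form_commonSphere w σ τ x
  have hc := h.commonSphere_section
  have hf := h.contact.self_of_nhds
  have hcc : form (commonSphere w σ τ x) (commonSphere w σ τ x) = 0 :=
    hf.null hc.mem_self _ hc.mem_self
  have hlc : form (commonSphere w σ τ x) (l x) = 0 := h.unit.normal.self_of_nhds _ hc.mem_self
  have hperp : ∀ v, form (w x) v = 0 → form (commonSphere w σ τ x) v = 0 →
      v ∈ perp (transform f s x) := by
    intro v h1 h2
    rw [hspan, mem_perp_span_pair]
    exact ⟨h1, h2⟩
  refine ⟨?_, ?_, fun ρ hρ Z => ?_⟩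
  · rw [hspan]
    have := finrank_span_eq_card hF.linInd
    rwa [Matrix.range_cons, Matrix.range_cons, Matrix.range_empty, union_empty,
      singleton_union, Fintype.card_fin] at this
  · intro v hv
    rw [hspan] at hv
    obtain ⟨a, b, rfl⟩ := Submodule.mem_span_pair.1 hv
    refine hperp _ ?_ ?_
    · simp [hw0, hwc]
    · simp [hcc, form_comm _ (w x), hwc]
  · obtain ⟨k, hk⟩ := h.exists_drv Z
    have d1 : drv w x Z ∈ perp (transform f s x) := by
      rw [hk]
      refine hperp _ ?_ ?_
      · simp [hw0, hwl]
      · simp [hlc, form_comm _ (w x), hwc]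
    have d2 : drv (commonSphere w σ τ) x Z ∈ perp (transform f s x) := by
      refine hperp _ ?_ (hf.contact _ hc Z _ hc.mem_self)
      have := form_drv_add_eq_zero h.smooth hc.smoothNear
        (Filter.Eventually.of_forall (form_commonSphere w σ τ)) Z
      rw [form_comm] at this
      have e : form (commonSphere w σ τ x) (drv w x Z) = 0 := by
        refine d1 _ ?_
        rw [hspan]; exact Submodule.subset_span (by simp)
      rwa [e, zero_add] at this
    obtain ⟨a, b, ha, hb, he⟩ := hF.exists_coeff hρ
    rw [drv_congr he, drv_add (ha.smul h.smooth) (hb.smul hc.smoothNear), drv_smul ha h.smooth,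
      drv_smul hb hc.smoothNear]
    have hn : ∀ v ∈ transform f s x, v ∈ perp (transform f s x) := by
      intro v hv
      rw [hspan] at hv
      obtain ⟨a, b, rfl⟩ := Submodule.mem_span_pair.1 hv
      refine hperp _ ?_ ?_
      · simp [hw0, hwc]
      · simp [hcc, form_comm _ (w x), hwc]
    exact add_mem (add_mem (Submodule.smul_mem _ _ (hn _ hF.left.mem_self))
      (Submodule.smul_mem _ _ d1)) (add_mem (Submodule.smul_mem _ _ (hn _ hF.right.mem_self))
      (Submodule.smul_mem _ _ d2))

/-- The derivatives of the coefficients multiply `σ` and `τ` and so disappear modulo `f`. -/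
theorem drv_commonSphere (h : IsTransformData f L s T x l w σ τ X Y) (Z : TangentSpace (𝓡 2) x) :
    drv (commonSphere w σ τ) x Z -
      (form (w x) (σ x) • drv τ x Z - form (w x) (τ x) • drv σ x Z) ∈ f x := by
  have s1 := h.smooth.form h.frame.frame.smooth_left
  have s2 := h.smooth.form h.frame.frame.smooth_right
  have : drv (commonSphere w σ τ) x Z = _ :=
    drv_sub (s1.smul h.frame.frame.smooth_right) (s2.smul h.frame.frame.smooth_left) Z
  rw [this, drv_smul s1 h.frame.frame.smooth_right, drv_smul s2 h.frame.frame.smooth_left]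
  have e := sub_mem
    (Submodule.smul_mem _ (drv (fun y => form (w y) (σ y)) x Z) h.frame.frame.right.mem_self)
    (Submodule.smul_mem _ (drv (fun y => form (w y) (τ y)) x Z) h.frame.frame.left.mem_self)
  convert e using 1
  abel

/-- The transform has the curvature directions of `f`. -/
theorem transform_curvatureFrame (h : IsTransformData f L s T x l w σ τ X Y) :
    ∃ m : ℝ, IsCurvatureFrame (transform f s) x w (fun y => commonSphere w σ τ y + m • w y) X Y := by
  have hF := h.transform_frame
  have hC := h.transform_isContactAt
  have hf := h.contact.self_of_nhds
  have hc := h.commonSphere_section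
  have hwY := h.form_drv_ne_zero
  have hlX := h.unit.drv_eq_zero.self_of_nhds X h.mem
  have hwm := hF.left.mem_self
  obtain ⟨kX, hkX⟩ := h.exists_drv X
  obtain ⟨kY, hkY⟩ := h.exists_drv Y
  rw [hlX, map_zero, zero_smul, sub_zero] at hkX
  have hwX : drv w x X ∈ transform f s x := by
    rw [hkX]; exact Submodule.smul_mem _ _ hwm
  -- Along `Y` the common sphere has derivative -μ l modulo `f` and `w` has derivative -(w, d_Y l) l
  -- modulo `w`; `m` is chosen so that the two terms in `l` cancel.
  set μ := form (w x) (τ x) * form (drv σ x Y) (l x) with hμ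
  set m := -μ / form (w x) (drv l x Y) with hm
  have hF' := hF.add_smul m
  have hdρ : ∀ Z, drv (fun y => commonSphere w σ τ y + m • w y) x Z =
      drv (commonSphere w σ τ) x Z + m • drv w x Z := fun Z => by
    rw [drv_add hc.smoothNear ((smoothNear_const m).smul h.smooth), drv_const_smul m h.smooth]
  refine ⟨m, hF', hwX, ?_, fun hmem => ?_, fun hmem => ?_, ?_, h.frame.spans⟩
  · have h1 : drv (commonSphere w σ τ) x Y + μ • l x ∈ f x := by
      have e1 := h.drv_commonSphere Y
      have e2 := h.unit.sub_form_smul_mem hf h.frame h.mem (hf.contact _ h.frame.frame.left Y)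
        h.frame.orthogonal
      have e3 := add_mem e1 (sub_mem
        (Submodule.smul_mem _ (form (w x) (σ x)) h.frame.drv_right)
        (Submodule.smul_mem _ (form (w x) (τ x)) e2))
      convert e3 using 1
      rw [hμ]; module
    have h2 : drv (commonSphere w σ τ) x Y + μ • l x ∈ transform f s x := by
      refine Submodule.mem_sup_left ⟨h1, ?_⟩
      rw [h.span_eq.self_of_nhds.1, SetLike.mem_coe, mem_perp_span_singleton, map_add, map_smul,
        h.normal.self_of_nhds, smul_zero, add_zero]
      exact hC.contact _ hF.right Y _ hwm
    rw [hdρ, hkY]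
    have h3 := add_mem h2 (Submodule.smul_mem _ (m * kY) hwm)
    convert h3 using 1
    have h4 : m * form (w x) (drv l x Y) = -μ := by rw [hm, div_mul_cancel₀ _ hwY]
    rw [smul_sub, smul_smul, smul_smul, h4]
    module
  -- A nonzero multiple of the unit vector `l` cannot lie in a null space.
  · have h1 : form (w x) (drv l x Y) • l x ∈ transform f s x := by
      have := sub_mem (Submodule.smul_mem _ kY hwm) hmem
      rwa [hkY, sub_sub_cancel] at this
    have h2 := hC.null h1 _ h1
    simp only [map_smul, LinearMap.smul_apply, h.unit.unit.self_of_nhds, smul_eq_mul, mul_one,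
      mul_self_eq_zero] at h2
    exact hwY h2
  · rw [hdρ] at hmem
    have h1 : drv (commonSphere w σ τ) x X ∈ transform f s x := by
      have := sub_mem hmem (Submodule.smul_mem _ m hwX)
      rwa [add_sub_cancel_right] at this
    rw [hF.span_eq.self_of_nhds] at h1
    -- Pairing with `σ` kills the `w`-component, so the derivative along `X` would lie in `f`.
    -- Modulo `f` it is `(w, σ) d_X τ`, which does not.
    obtain ⟨b, a, hab⟩ := Submodule.mem_span_pair.1 h1
    have hσm := h.frame.frame.left.mem_self
    have e1 : form (σ x) (drv (commonSphere w σ τ) x X) = 0 := hf.contact _ hc X _ hσm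
    have e2 : form (σ x) (commonSphere w σ τ x) = 0 := hf.null hc.mem_self _ hσm
    rw [← hab, map_add, map_smul, map_smul, e2, smul_zero, add_zero, form_comm, smul_eq_mul,
      mul_eq_zero] at e1
    rw [e1.resolve_right h.form_ne_zero, zero_smul, zero_add] at hab
    have e3 := sub_mem (Submodule.smul_mem _ a hc.mem_self) (h.drv_commonSphere X)
    rw [← hab, sub_sub_cancel] at e3
    have e4 := add_mem e3 (Submodule.smul_mem _ (form (w x) (τ x)) h.frame.drv_left)
    rw [sub_add_cancel] at e4
    exact h.frame.drv_right_notMem ((Submodule.smul_mem_iff _ h.form_ne_zero).1 e4)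
  -- `d_Y w` is a combination of `w` and `l`. Both are orthogonal to the derivative of the second
  -- section along `X`, by the contact condition and by `d_X l = 0` respectively.
  · have hρ := hF'.right
    have e1 : form (w x) (drv (fun y => commonSphere w σ τ y + m • w y) x X) = 0 :=
      hC.contact _ hρ X _ hwm
    have e0 : ∀ᶠ y in 𝓝 x, form (l y) (commonSphere w σ τ y + m • w y) = 0 := by
      filter_upwards [h.unit.normal, hc.mem, h.normal] with y g1 g2 g3
      rw [map_add, map_smul, form_comm _ (w y), g3, smul_zero, add_zero, form_comm]
      exact g1 _ g2
    have e2 := form_drv_add_eq_zero h.unit.smooth hρ.smoothNear e0 X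
    rw [hlX, map_zero, LinearMap.zero_apply, zero_add] at e2
    rw [hkY, map_sub, map_smul, map_smul, LinearMap.sub_apply, LinearMap.smul_apply,
      LinearMap.smul_apply, e1, e2, smul_zero, smul_zero, sub_zero]

end IsTransformData

variable [IsManifold (𝓡 2) ∞ M]

/-- Near each point, a parallel null line in general position gives the data of a transform. -/
theorem exists_transformData (hf : IsLegendreOn univ f) (humb : IsUmbilicFreeOn univ f)
    (hT : ∀ x, T x ∈ curvatureDirections f x) (hL : IsSphereComplexAlong f T L) (hU : IsOpen U)
    (hs : IsParallelNullLineOn U L s) (hx : x ∈ U)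
    (hgen : ∀ c, IsCurvatureSphere f x c → curvatureSpace f x c = T x → ¬ c ≤ perp (s x))
    (hst : ∃ (σ : M → R42) (X : TangentSpace (𝓡 2) x), IsSectionNear s x σ ∧ dAt σ x X ∉ s x) :
    ∃ (l w σ τ : M → R42) (X Y : TangentSpace (𝓡 2) x),
      IsTransformData f L s T x l w σ τ X Y ∧ T x = Submodule.span ℝ {X} := by
  obtain ⟨l, hl⟩ := hL.exists_unitSection x
  obtain ⟨w, hw, hws⟩ := hs.subbundle.exists_section hx
  obtain ⟨σ, τ, X, Y, h, hTX⟩ := exists_curvatureFrame hf humb (hT x)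
  have hwm : ∀ᶠ y in 𝓝 x, w y ∈ s y := hws.mono fun y hy => by
    rw [hy.1]; exact Submodule.mem_span_singleton_self _
  have hUx := hU.mem_nhds hx
  refine ⟨l, w, σ, τ, X, Y, ⟨Filter.Eventually.of_forall fun y => hf.isContactAt (mem_univ y), hl, h,
    by rw [hTX]; exact Submodule.mem_span_singleton_self _, hw, hws, ?_, ?_,
    hs.parallel x hx w ⟨hw, hwm⟩, fun h0 => ?_, hst⟩, hTX⟩
  · filter_upwards [hwm, hUx] with y h1 h2 using hs.null y h2 h1 _ h1
  · filter_upwards [hwm, hUx, hl.span_eq] with y h1 h2 h3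
    have := hs.orthogonal y h2 h1
    rw [h3, mem_perp_span_singleton] at this
    rw [form_comm, this]
  · refine hgen _ (h.isCurvatureSphere_left (hf.isContactAt (mem_univ x)))
      (by rw [h.curvatureSpace_left (hf.isContactAt (mem_univ x)), hTX]) ?_
    rw [Submodule.span_singleton_le_iff_mem, hws.self_of_nhds.1, mem_perp_span_singleton, h0]

/-- Parallel null lines in general position yield Ribaucour transforms that are channel
surfaces. -/
theorem transform_isChannel_isRibaucour (hf : IsLegendreOn univ f) (humb : IsUmbilicFreeOn univ f)
    (hT : ∀ x, T x ∈ curvatureDirections f x) (hL : IsSphereComplexAlong f T L) (hU : IsOpen U)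
    (hs : IsParallelNullLineOn U L s)
    (hgen : ∀ x ∈ U, ∀ c, IsCurvatureSphere f x c → curvatureSpace f x c = T x →
      ¬ c ≤ perp (s x))
    (hst : ∀ x ∈ U, ∃ (σ : M → R42) (X : TangentSpace (𝓡 2) x),
      IsSectionNear s x σ ∧ dAt σ x X ∉ s x) :
    IsChannelSurfaceOn U (transform f s) ∧ IsRibaucourPairOn U f (transform f s) := by
  have hdata := fun x (hx : x ∈ U) =>
    exists_transformData hf humb hT hL hU hs hx (hgen x hx) (hst x hx)
  have hleg : IsLegendreOn U (transform f s) := by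
    refine ⟨isSubbundleOn_two_of_frame hU fun x hx => ?_, fun x hx => ?_, fun x hx => ?_,
      fun x hx => ?_⟩ <;> obtain ⟨l, w, σ, τ, X, Y, h, -⟩ := hdata x hx
    · exact ⟨_, _, h.transform_frame⟩
    · exact h.transform_isContactAt.null
    · exact h.transform_isContactAt.contact
    · obtain ⟨m, hm⟩ := h.transform_curvatureFrame
      exact fun Z hZ => hm.immersed h.transform_isContactAt hZ
  have humb' : IsUmbilicFreeOn U (transform f s) := by
    intro x hx
    obtain ⟨l, w, σ, τ, X, Y, h, -⟩ := hdata x hx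
    obtain ⟨m, hm⟩ := h.transform_curvatureFrame
    exact hm.not_existsUnique h.transform_isContactAt
  refine ⟨⟨hleg, humb', s, ⟨hs.subbundle, fun x hx => ?_⟩, fun x hx Z hZ ρ hρ => ?_⟩,
    hf.mono hU (subset_univ _), hleg, fun x _ => humb x (mem_univ x), humb',
    isSubbundleOn_one_of_section fun x hx => ?_, fun x hx => ?_⟩ <;>
    obtain ⟨l, w, σ, τ, X, Y, h, hTX⟩ := hdata x hx
  · obtain ⟨m, hm⟩ := h.transform_curvatureFrame
    rw [h.span_eq.self_of_nhds.1]
    exact hm.isCurvatureSphere_left h.transform_isContactAt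
  · obtain ⟨m, hm⟩ := h.transform_curvatureFrame
    obtain ⟨hsx, hw0⟩ := h.span_eq.self_of_nhds
    replace hZ : Z ∈ curvatureSpace (transform f s) x (s x) := hZ
    rw [hsx, hm.curvatureSpace_left h.transform_isContactAt] at hZ
    obtain ⟨c, rfl⟩ := Submodule.mem_span_singleton.1 hZ
    obtain ⟨a, ha, he⟩ := exists_coeff_of_line h.smooth hw0 (h.span_eq.mono fun y hy => hy.1) hρ
    obtain ⟨k, hk⟩ := h.exists_drv X
    rw [h.unit.drv_eq_zero.self_of_nhds X h.mem, map_zero, zero_smul, sub_zero] at hk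
    have hwm : w x ∈ s x := by rw [hsx]; exact Submodule.mem_span_singleton_self _
    rw [dAt_eq_drv, map_smul, drv_congr he, drv_smul ha h.smooth, hk]
    exact Submodule.smul_mem _ _ (add_mem (Submodule.smul_mem _ _ hwm)
      (Submodule.smul_mem _ _ (Submodule.smul_mem _ _ hwm)))
  · refine ⟨_, h.commonSphere_smooth, ?_⟩
    filter_upwards [h.eventually_inf, h.eventually_span, hU.mem_nhds hx] with y h1 h2 h3
    exact ⟨h3, h1, h2.2.1⟩
  · obtain ⟨m, hm⟩ := h.transform_curvatureFrame
    rw [h.frame.curvatureDirections_eq h.contact.self_of_nhds,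
      hm.curvatureDirections_eq h.transform_isContactAt]

end Transform

/-! ### Linear differential equations and maps of rank one -/

/-- Existence of fundamental solutions of smooth linear differential equations. -/
theorem exists_fundamental_solution {E : Type*} [NormedAddCommGroup E] [NormedSpace ℝ E]
    [CompleteSpace E] {A : ℝ → E →L[ℝ] E} {t₀ ε : ℝ} (hε : 0 < ε)
    (hA : ContDiffOn ℝ ∞ A (Metric.ball t₀ ε)) :
    ∃ δ, 0 < δ ∧ δ ≤ ε ∧ ∃ Φ : ℝ → E →L[ℝ] E, Φ t₀ = ContinuousLinearMap.id ℝ E ∧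
      ContDiffOn ℝ ∞ Φ (Metric.ball t₀ δ) ∧
      ∀ t ∈ Metric.ball t₀ δ, HasDerivAt Φ ((A t).comp (Φ t)) t := by
  have hsub : Icc (t₀ - ε / 2) (t₀ + ε / 2) ⊆ Metric.ball t₀ ε := by
    rw [Real.ball_eq_Ioo]
    exact Icc_subset_Ioo (by linarith) (by linarith)
  obtain ⟨C, hC⟩ := isCompact_Icc.exists_bound_of_continuousOn (hA.continuousOn.mono hsub)
  have hC0 : 0 ≤ C := (norm_nonneg _).trans (hC t₀ ⟨by linarith, by linarith⟩)
  set x₀ : E →L[ℝ] E := ContinuousLinearMap.id ℝ E with hx₀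
  -- `B` bounds the vector field on the unit ball about the identity; `δ` satisfies `B * δ ≤ 1`, so
  -- that solutions do not leave this ball.
  set B := C * (‖x₀‖ + 1) with hB
  have hB0 : 0 ≤ B := by positivity
  set δ := min (ε / 2) (1 / (B + 1)) with hδ
  have hδ0 : 0 < δ := lt_min (by linarith) (by positivity)
  have hδε : δ ≤ ε / 2 := min_le_left _ _
  have hδB : B * δ ≤ 1 := by
    have : δ ≤ 1 / (B + 1) := min_le_right _ _
    calc B * δ ≤ (B + 1) * (1 / (B + 1)) := by gcongr; linarith
      _ = 1 := by field_simp
  have hsub' : Icc (t₀ - δ) (t₀ + δ) ⊆ Icc (t₀ - ε / 2) (t₀ + ε / 2) :=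
    Icc_subset_Icc (by linarith) (by linarith)
  have ht₀ : t₀ ∈ Icc (t₀ - δ) (t₀ + δ) := ⟨by linarith, by linarith⟩
  have hpl : IsPicardLindelof (fun t Ψ => (A t).comp Ψ) ⟨t₀, ht₀⟩ x₀ 1 0 ⟨B, hB0⟩ ⟨C, hC0⟩ := by
    refine ⟨fun t ht => ?_, fun Ψ _ => ?_, fun t ht Ψ hΨ => ?_, ?_⟩
    · refine LipschitzOnWith.of_dist_le_mul fun Ψ _ Ψ' _ => ?_
      rw [dist_eq_norm, dist_eq_norm, ← ContinuousLinearMap.comp_sub]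
      exact (ContinuousLinearMap.opNorm_comp_le _ _).trans
        (mul_le_mul_of_nonneg_right (hC t (hsub' ht)) (norm_nonneg _))
    · exact (hA.continuousOn.mono (hsub'.trans hsub)).clm_comp continuousOn_const
    · refine (ContinuousLinearMap.opNorm_comp_le _ _).trans ?_
      refine mul_le_mul (hC t (hsub' ht)) ?_ (norm_nonneg _) hC0
      rw [mem_closedBall_iff_norm] at hΨ
      calc ‖Ψ‖ = ‖x₀ + (Ψ - x₀)‖ := by rw [add_sub_cancel]
        _ ≤ ‖x₀‖ + ‖Ψ - x₀‖ := norm_add_le _ _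
        _ ≤ ‖x₀‖ + 1 := by gcongr; exact hΨ
    · simp only [add_sub_cancel_left, sub_sub_cancel, max_self, NNReal.coe_one, NNReal.coe_zero,
        sub_zero]
      exact hδB
  obtain ⟨Φ, hΦ0, hΦ⟩ := hpl.exists_eq_forall_mem_Icc_hasDerivWithinAt₀
  refine ⟨δ, hδ0, by linarith, Φ, hΦ0, ?_, fun t ht => ?_⟩
  · have hsm : ContDiffOn ℝ ∞ (Function.uncurry fun t (Ψ : E →L[ℝ] E) => (A t).comp Ψ)
        (Icc (t₀ - δ) (t₀ + δ) ×ˢ univ) := by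
      refine ContDiffOn.clm_comp ?_ contDiff_snd.contDiffOn
      exact (hA.mono (hsub'.trans hsub)).comp contDiff_fst.contDiffOn fun q hq => hq.1
    have := ODE.contDiffOn_enat_Icc_of_hasDerivWithinAt (n := ⊤) hsm hΦ (mapsTo_univ _ _)
    refine this.mono ?_
    rw [Real.ball_eq_Ioo]; exact Ioo_subset_Icc_self
  · rw [Real.ball_eq_Ioo] at ht
    exact (hΦ t (Ioo_subset_Icc_self ht)).hasDerivAt (Icc_mem_nhds ht.1 ht.2)

/-- The endomorphism `v ↦ (v, a) b - (v, b) a`. -/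
def wedge (a b : R42) : R42 →L[ℝ] R42 :=
  (formL a).smulRight b - (formL b).smulRight a

theorem wedge_apply (a b v : R42) : wedge a b v = form v a • b - form v b • a := by
  rw [form_comm v a, form_comm v b]; rfl

/-- Parallel transport along a curve of unit vectors. -/
theorem exists_parallel_transport {γ : ℝ → R42} {t₀ ε : ℝ} (hε : 0 < ε)
    (hγ : ContDiffOn ℝ ∞ γ (Metric.ball t₀ ε))
    (hu : ∀ t ∈ Metric.ball t₀ ε, form (γ t) (γ t) = 1) :
    ∃ δ, 0 < δ ∧ δ ≤ ε ∧ ∃ Φ : ℝ → R42 →L[ℝ] R42, Φ t₀ = ContinuousLinearMap.id ℝ R42 ∧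
      ContDiffOn ℝ ∞ Φ (Metric.ball t₀ δ) ∧
      (∀ t ∈ Metric.ball t₀ δ, HasDerivAt Φ ((wedge (γ t) (deriv γ t)).comp (Φ t)) t) ∧
      (∀ t ∈ Metric.ball t₀ δ, ∀ v w, form (Φ t v) (Φ t w) = form v w) ∧
      ∀ t ∈ Metric.ball t₀ δ, ∀ v, form (Φ t v) (γ t) = form v (γ t₀) := by
  have hd : ∀ t ∈ Metric.ball t₀ ε, HasDerivAt γ (deriv γ t) t := fun t ht =>
    ((hγ.contDiffAt (Metric.isOpen_ball.mem_nhds ht)).differentiableAt (by simp)).hasDerivAt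
  have hγ' : ContDiffOn ℝ ∞ (deriv γ) (Metric.ball t₀ ε) :=
    hγ.deriv_of_isOpen Metric.isOpen_ball (by exact le_rfl)
  have hA : ContDiffOn ℝ ∞ (fun t => wedge (γ t) (deriv γ t)) (Metric.ball t₀ ε) :=
    ((formL.contDiff.comp_contDiffOn hγ).smulRight hγ').sub
      ((formL.contDiff.comp_contDiffOn hγ').smulRight hγ)
  obtain ⟨δ, hδ, hδε, Φ, hΦ0, hΦ, hΦd⟩ := exists_fundamental_solution hε hA
  have hsub : Metric.ball t₀ δ ⊆ Metric.ball t₀ ε := Metric.ball_subset_ball hδε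
  have hform : ∀ {a b : ℝ → R42} {a' b' : R42} {t : ℝ}, HasDerivAt a a' t → HasDerivAt b b' t →
      HasDerivAt (fun s => form (a s) (b s)) (form (a t) b' + form a' (b t)) t := by
    intro a b a' b' t ha hb
    have := (formL.hasFDerivAt_of_bilinear ha.hasFDerivAt hb.hasFDerivAt).hasDerivAt
    refine HasDerivAt.congr_deriv (f := fun s => form (a s) (b s)) this ?_
    change form (a t) ((1 : ℝ) • b') + form ((1 : ℝ) • a') (b t) = _
    rw [one_smul, one_smul]
  have hconst : ∀ g : ℝ → ℝ, (∀ t ∈ Metric.ball t₀ δ, HasDerivAt g 0 t) →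
      ∀ t ∈ Metric.ball t₀ δ, g t = g t₀ := by
    intro g hg t ht
    refine (convex_ball t₀ δ).is_const_of_fderivWithin_eq_zero (𝕜 := ℝ)
      (fun s hs => (hg s hs).differentiableAt.differentiableWithinAt) (fun s hs => ?_) ht
      (Metric.mem_ball_self hδ)
    rw [fderivWithin_of_isOpen Metric.isOpen_ball hs]
    ext
    simp [(hg s hs).deriv]
  have hΦv : ∀ v, ∀ t ∈ Metric.ball t₀ δ,
      HasDerivAt (fun s => Φ s v) (wedge (γ t) (deriv γ t) (Φ t v)) t := fun v t ht => by
    simpa using (hΦd t ht).clm_apply (hasDerivAt_const t v)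
  refine ⟨δ, hδ, hδε, Φ, hΦ0, hΦ, hΦd, fun t ht v w => ?_, fun t ht v => ?_⟩
  -- The wedge is skew for the form, so the two terms of the product rule cancel.
  · have := hconst (fun s => form (Φ s v) (Φ s w)) (fun s hs => ?_) t ht
    · simpa [hΦ0] using this
    · convert hform (hΦv v s hs) (hΦv w s hs) using 1
      simp only [wedge_apply, map_sub, map_smul, LinearMap.sub_apply, LinearMap.smul_apply,
        smul_eq_mul, form_comm (γ s), form_comm (deriv γ s)]
      ring
  -- By unit length and `(γ', γ) = 0`, pairing the wedge with γ gives -(Φ v, γ'), which cancels the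
  -- term from differentiating γ.
  · have := hconst (fun s => form (Φ s v) (γ s)) (fun s hs => ?_) t ht
    · simpa [hΦ0] using this
    · have h1 := hform (hd s (hsub hs)) (hd s (hsub hs))
      have h2 : HasDerivAt (fun s => form (γ s) (γ s)) 0 s := by
        refine (hasDerivAt_const s (1 : ℝ)).congr_of_eventuallyEq ?_
        filter_upwards [Metric.isOpen_ball.mem_nhds (hsub hs)] with r hr using hu r hr
      have h3 := h1.unique h2
      have h4 : form (deriv γ s) (γ s) = 0 := by
        rw [form_comm (γ s)] at h3; linarith
      convert hform (hΦv v s hs) (hd s (hsub hs)) using 1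
      simp only [wedge_apply, map_sub, map_smul, LinearMap.sub_apply, LinearMap.smul_apply,
        smul_eq_mul, h4, hu s (hsub hs)]
      ring

/-- A map of rank one on a surface factors locally through one of its components. -/
theorem exists_factor_of_rank_one {F : Type*} [NormedAddCommGroup F] [NormedSpace ℝ F]
    {g : EuclideanSpace ℝ (Fin 2) → F} {z₀ : EuclideanSpace ℝ (Fin 2)}
    (hg : ∀ᶠ z in 𝓝 z₀, ContDiffAt ℝ ∞ g z) {A : F →L[ℝ] ℝ}
    (hker : ∀ᶠ z in 𝓝 z₀, ∀ e, A (fderiv ℝ g z e) = 0 → fderiv ℝ g z e = 0)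
    (hne : ∃ e, A (fderiv ℝ g z₀ e) ≠ 0) {N : Set (EuclideanSpace ℝ (Fin 2))} (hN : N ∈ 𝓝 z₀) :
    ∃ (γ : ℝ → F) (ε : ℝ), 0 < ε ∧ ContDiffOn ℝ ∞ γ (Metric.ball (A (g z₀)) ε) ∧
      (∀ t ∈ Metric.ball (A (g z₀)) ε, γ t ∈ g '' N) ∧ ∀ᶠ z in 𝓝 z₀, g z = γ (A (g z)) := by
  obtain ⟨e₁, he₁⟩ := hne
  set D : EuclideanSpace ℝ (Fin 2) →L[ℝ] ℝ := A.comp (fderiv ℝ g z₀) with hD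
  have hDe : D e₁ ≠ 0 := he₁
  obtain ⟨e₀, he₀, hDe₀⟩ : ∃ e₀, e₀ ≠ 0 ∧ D e₀ = 0 := by
    by_contra! h
    have hinj : Function.Injective D := by
      rw [injective_iff_map_eq_zero]
      intro v hv
      by_contra hv0
      exact h v hv0 hv
    have := LinearMap.finrank_le_finrank_of_injective (f := (D : EuclideanSpace ℝ (Fin 2) →ₗ[ℝ] ℝ))
      hinj
    simp at this
  -- The functional `μ` completes `A ∘ g` to local coordinates, as it is nonzero on the kernel of
  -- the derivative of `A ∘ g`.
  obtain ⟨μ, hμ⟩ := SeparatingDual.exists_eq_one (R := ℝ) he₀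
  have hspan : ∀ z, μ z = 0 → D z = 0 → z = 0 := by
    intro z hz1 hz2
    have hnc : ∀ c : ℝ, c • e₀ ≠ e₁ := by
      rintro c rfl
      exact hDe (by rw [map_smul, hDe₀, smul_zero])
    have h := ((LinearIndependent.pair_iff' he₀).2 hnc).span_eq_top_of_card_eq_finrank (by simp)
    have hZ : z ∈ (⊤ : Submodule ℝ (EuclideanSpace ℝ (Fin 2))) := Submodule.mem_top
    rw [← h, Matrix.range_cons, Matrix.range_cons, Matrix.range_empty, union_empty,
      singleton_union] at hZ
    obtain ⟨a, b, rfl⟩ := Submodule.mem_span_pair.1 hZ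
    rw [map_add, map_smul, map_smul, hDe₀, smul_zero, zero_add, smul_eq_mul, mul_eq_zero] at hz2
    have hb := hz2.resolve_right hDe
    rw [hb, zero_smul, add_zero, map_smul, hμ, smul_eq_mul, mul_one] at hz1
    rw [hz1, hb, zero_smul, zero_smul, add_zero]
  have hinj : Function.Injective ((μ.prod D : EuclideanSpace ℝ (Fin 2) →L[ℝ] ℝ × ℝ) :
      EuclideanSpace ℝ (Fin 2) →ₗ[ℝ] ℝ × ℝ) := by
    rw [injective_iff_map_eq_zero]
    intro v hv
    exact hspan v (congrArg Prod.fst hv) (congrArg Prod.snd hv)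
  set e : EuclideanSpace ℝ (Fin 2) ≃L[ℝ] ℝ × ℝ :=
    (LinearEquiv.ofInjectiveOfFinrankEq _ hinj (by simp)).toContinuousLinearEquiv with he
  have hecoe : (e : EuclideanSpace ℝ (Fin 2) →L[ℝ] ℝ × ℝ) = μ.prod D := by
    ext v <;> rfl
  set H : EuclideanSpace ℝ (Fin 2) → ℝ × ℝ := fun z => (μ z, A (g z)) with hH
  have hHs : ∀ᶠ z in 𝓝 z₀, ContDiffAt ℝ ∞ H z := by
    filter_upwards [hg] with z hz
    exact μ.contDiff.contDiffAt.prodMk (A.contDiff.contDiffAt.comp z hz)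
  have hHd : HasFDerivAt H (e : EuclideanSpace ℝ (Fin 2) →L[ℝ] ℝ × ℝ) z₀ := by
    rw [hecoe]
    exact μ.hasFDerivAt.prodMk (A.hasFDerivAt.comp z₀
      (hg.self_of_nhds.differentiableAt (by simp)).hasFDerivAt)
  have hH0 := hHs.self_of_nhds
  have hinv : ∀ᶠ z in 𝓝 z₀, ∃ e' : EuclideanSpace ℝ (Fin 2) ≃L[ℝ] ℝ × ℝ,
      (e' : EuclideanSpace ℝ (Fin 2) →L[ℝ] ℝ × ℝ) = fderiv ℝ H z := by
    have hc : ContinuousAt (fderiv ℝ H) z₀ :=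
      (hH0.fderiv_right (m := 0) (by simp)).continuousAt
    have := e.nhds
    rw [← hHd.fderiv] at this
    exact hc.eventually this
  set P := hH0.toOpenPartialHomeomorph H hHd (by simp) with hP
  have hPcoe : (P : EuclideanSpace ℝ (Fin 2) → ℝ × ℝ) = H :=
    hH0.toOpenPartialHomeomorph_coe hHd (by simp)
  have hzs : z₀ ∈ P.source := hH0.mem_toOpenPartialHomeomorph_source hHd (by simp)
  have hpt : H z₀ ∈ P.target := hH0.image_mem_toOpenPartialHomeomorph_target hHd (by simp)
  have hK0 : P.symm (H z₀) = z₀ := by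
    rw [← hPcoe]; exact P.left_inv hzs
  have hKc : ContinuousAt P.symm (H z₀) := P.continuousAt_symm hpt
  have hQ : ∀ᶠ p in 𝓝 (H z₀), p ∈ P.target ∧ (ContDiffAt ℝ ∞ g (P.symm p) ∧
      (∀ e, A (fderiv ℝ g (P.symm p) e) = 0 → fderiv ℝ g (P.symm p) e = 0) ∧
      P.symm p ∈ N ∧ ContDiffAt ℝ ∞ H (P.symm p) ∧
      ∃ e' : EuclideanSpace ℝ (Fin 2) ≃L[ℝ] ℝ × ℝ,
      (e' : EuclideanSpace ℝ (Fin 2) →L[ℝ] ℝ × ℝ) = fderiv ℝ H (P.symm p)) := by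
    have hall := hg.and (hker.and (Filter.Eventually.and hN (hHs.and hinv)))
    rw [← hK0] at hall
    exact Filter.Eventually.and (P.open_target.mem_nhds hpt) (hKc.eventually hall)
  obtain ⟨ε, hε, hball⟩ := Metric.eventually_nhds_iff_ball.1 hQ
  set k : ℝ × ℝ → F := fun p => g (P.symm p) with hk
  have hKs : ∀ p ∈ Metric.ball (H z₀) ε, ContDiffAt ℝ ∞ P.symm p := by
    intro p hp
    obtain ⟨h1, -, -, -, h5, e', he'⟩ := hball p hp
    refine P.contDiffAt_symm (f₀' := e') h1 ?_ ?_
    · rw [hPcoe, he']; exact (h5.differentiableAt (by simp)).hasFDerivAt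
    · rw [hPcoe]; exact h5
  have hks : ∀ p ∈ Metric.ball (H z₀) ε, ContDiffAt ℝ ∞ k p := fun p hp =>
    (hball p hp).2.1.comp p (hKs p hp)
  have hAk : ∀ p ∈ Metric.ball (H z₀) ε, A (k p) = p.2 := by
    intro p hp
    have := P.right_inv (hball p hp).1
    rw [hPcoe] at this
    exact congrArg Prod.snd this
  -- In the new coordinates `A ∘ k` is the second projection, so the first partial derivative of `k`
  -- is killed by `A`; by the rank hypothesis it vanishes.
  have hkd : ∀ p ∈ Metric.ball (H z₀) ε, fderiv ℝ k p (1, 0) = 0 := by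
    intro p hp
    have hgd := ((hball p hp).2.1.differentiableAt (by simp)).hasFDerivAt
    have hKd := ((hKs p hp).differentiableAt (by simp)).hasFDerivAt
    have h1 : HasFDerivAt k _ p := hgd.comp p hKd
    rw [h1.fderiv]
    refine (hball p hp).2.2.1 _ ?_
    have h2 : HasFDerivAt (fun q => A (k q)) _ p := A.hasFDerivAt.comp p h1
    have h3 : HasFDerivAt (fun q => A (k q)) (ContinuousLinearMap.snd ℝ ℝ ℝ) p := by
      refine hasFDerivAt_snd.congr_of_eventuallyEq ?_
      filter_upwards [Metric.isOpen_ball.mem_nhds hp] with q hq using hAk q hq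
    exact congrArg (fun D : ℝ × ℝ →L[ℝ] ℝ => D (1, 0)) (h2.unique h3)
  have hmem : ∀ {u t : ℝ}, (u, t) ∈ Metric.ball (H z₀) ε ↔
      u ∈ Metric.ball (μ z₀) ε ∧ t ∈ Metric.ball (A (g z₀)) ε := by
    intro u t
    rw [← ball_prod_same]; rfl
  have hu₀ : μ z₀ ∈ Metric.ball (μ z₀) ε := Metric.mem_ball_self hε
  have hconst : ∀ u t, (u, t) ∈ Metric.ball (H z₀) ε → k (u, t) = k (μ z₀, t) := by
    intro u t hut
    obtain ⟨hu, ht⟩ := hmem.1 hut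
    have hd : ∀ s ∈ Metric.ball (μ z₀) ε, HasDerivAt (fun s => k (s, t)) 0 s := by
      intro s hs
      have hst := hmem.2 ⟨hs, ht⟩
      have h1 := ((hks _ hst).differentiableAt (by simp)).hasFDerivAt
      have h2 : HasDerivAt (fun s : ℝ => (s, t)) (1, 0) s :=
        (hasDerivAt_id s).prodMk (hasDerivAt_const s t)
      have h3 := h1.comp_hasDerivAt s h2
      rwa [hkd _ hst] at h3
    refine (convex_ball (μ z₀) ε).is_const_of_fderivWithin_eq_zero (𝕜 := ℝ)
      (f := fun s => k (s, t))
      (fun s hs => (hd s hs).differentiableAt.differentiableWithinAt) (fun s hs => ?_) hu hu₀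
    rw [fderivWithin_of_isOpen Metric.isOpen_ball hs]
    ext
    simp [(hd s hs).deriv]
  refine ⟨fun t => k (μ z₀, t), ε, hε, fun t ht => ?_, fun t ht => ?_, ?_⟩
  · refine ContDiffAt.contDiffWithinAt ?_
    exact (hks _ (hmem.2 ⟨hu₀, ht⟩)).comp t (contDiffAt_const.prodMk contDiffAt_id)
  · exact ⟨_, (hball _ (hmem.2 ⟨hu₀, ht⟩)).2.2.2.1, rfl⟩
  · have hHb : ∀ᶠ z in 𝓝 z₀, H z ∈ Metric.ball (H z₀) ε :=
      hH0.continuousAt.eventually (Metric.ball_mem_nhds _ hε)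
    filter_upwards [hHb, P.open_source.mem_nhds hzs] with z h1 h2
    have h3 : P.symm (H z) = z := by rw [← hPcoe]; exact P.left_inv h2
    have h4 := hconst _ _ h1
    change g (P.symm (H z)) = _ at h4
    rw [h3] at h4
    exact h4

/-! ### Parallel transport and flatness -/

section Transport

variable {M : Type*} [TopologicalSpace M] [ChartedSpace (EuclideanSpace ℝ (Fin 2)) M]
  {f L : M → Submodule ℝ R42} {T : ∀ x : M, Submodule ℝ (TangentSpace (𝓡 2) x)} {x : M}

/-- Parallel transport for `D^L` with respect to a unit section `l` of `L`. -/
structure IsTransport (l : M → R42) (x : M) (Ψ : M → R42 →L[ℝ] R42) : Prop where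
  smooth : SmoothNear Ψ x
  map_self : Ψ x = ContinuousLinearMap.id ℝ R42
  drv_eq : ∀ᶠ y in 𝓝 x, ∀ (u : R42) (Z : TangentSpace (𝓡 2) y), drv (fun z => Ψ z u) y Z =
    form (Ψ y u) (l y) • drv l y Z - form (Ψ y u) (drv l y Z) • l y
  isometry : ∀ᶠ y in 𝓝 x, ∀ u v, form (Ψ y u) (Ψ y v) = form u v
  form_unit : ∀ᶠ y in 𝓝 x, ∀ u, form (Ψ y u) (l y) = form u (l x)

variable [IsManifold (𝓡 2) ∞ M]

/-- The unit section factors locally through one of its components. -/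
theorem IsUnitSection.exists_factor {l : M → R42} (hl : IsUnitSection f L T x l)
    (hf : IsLegendreOn univ f) (humb : IsUmbilicFreeOn univ f)
    (hT : ∀ x, T x ∈ curvatureDirections f x) :
    ∃ (A : R42 →L[ℝ] ℝ) (γ : ℝ → R42) (ε : ℝ), 0 < ε ∧
      ContDiffOn ℝ ∞ γ (Metric.ball (A (l x)) ε) ∧
      (∀ t ∈ Metric.ball (A (l x)) ε, form (γ t) (γ t) = 1) ∧
      ∀ᶠ y in 𝓝 x, l y = γ (A (l y)) := by
  obtain ⟨σ, τ, X, Y, h, hTX⟩ := exists_curvatureFrame hf humb (hT x)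
  have hX : X ∈ T x := by rw [hTX]; exact Submodule.mem_span_singleton_self _
  have hd : drv l x Y ≠ 0 := by
    intro h0
    have h1 := hl.form_drv_unit h.frame.left Y
    rw [h0, map_zero, LinearMap.zero_apply, zero_eq_neg] at h1
    exact hl.form_drv_ne_zero (hf.isContactAt (mem_univ x)) h hX h1
  obtain ⟨A, hA⟩ := SeparatingDual.exists_ne_zero (R := ℝ) hd
  set φ := extChartAt (𝓡 2) x with hφ
  set g := fun z => l (φ.symm z) with hg
  have hgs : ∀ᶠ z in 𝓝 (φ x), ContDiffAt ℝ ∞ g z := hl.smooth.contDiffAt_chart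
  have hc : ContinuousAt φ.symm (φ x) := continuousAt_extChartAt_symm x
  have hx : φ.symm (φ x) = x := extChartAt_to_inv x
  have hYd : A (fderiv ℝ g (φ x) Y) ≠ 0 := by
    have := drv_self_chart hl.smooth Y
    rw [← hφ] at this
    change A (fderiv ℝ (fun z => l (φ.symm z)) (φ x) Y) ≠ 0
    rw [← this]; exact hA
  have hYn : ∀ᶠ z in 𝓝 (φ x), A (fderiv ℝ g z Y) ≠ 0 := by
    have h1 : ContinuousAt (fderiv ℝ g) (φ x) :=
      (hgs.self_of_nhds.fderiv_right (m := 0) (by simp)).continuousAt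
    have h2 : ContinuousAt (fun z => A (fderiv ℝ g z Y)) (φ x) :=
      A.continuous.continuousAt.comp (h1.clm_apply continuousAt_const)
    exact h2.eventually_ne hYd
  -- The factoring curve takes values in the image of this neighbourhood, hence consists of unit
  -- vectors on its whole interval.
  have hN : φ.symm ⁻¹' {y | form (l y) (l y) = 1} ∈ 𝓝 (φ x) := by
    refine hc.preimage_mem_nhds ?_
    rw [hx]; exact hl.unit
  have hev : ∀ᶠ y in 𝓝 (φ.symm (φ x)), IsUnitSection f L T y l := by rw [hx]; exact hl.eventually
  -- As `dl` vanishes on `T`, its image is at most a line. `A` is nonzero on that line at `x`, and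
  -- by continuity nearby.
  have hker : ∀ᶠ z in 𝓝 (φ x), ∀ e, A (fderiv ℝ g z e) = 0 → fderiv ℝ g z e = 0 := by
    filter_upwards [hYn, hc.eventually hev, extChartAt_target_mem_nhds (I := 𝓡 2) x]
      with z hz hlz hzt e he
    have hy : φ.symm z ∈ (chartAt (EuclideanSpace ℝ (Fin 2)) x).source := by
      rw [← extChartAt_source (𝓡 2)]; exact φ.map_target hzt
    have key : ∀ e : EuclideanSpace ℝ (Fin 2),
        drv l (φ.symm z) (coordVec x e (φ.symm z)) = fderiv ℝ g z e := by
      intro e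
      rw [drv_eq_fderiv_chart hy hlz.smooth, drv_extChartAt_coordVec hy, ← hφ, φ.right_inv hzt]
    obtain ⟨σ', τ', X', Y', h', hTX'⟩ := exists_curvatureFrame hf humb (hT (φ.symm z))
    have hX' : drv l (φ.symm z) X' = 0 := hlz.drv_eq_zero.self_of_nhds X'
      (by rw [hTX']; exact Submodule.mem_span_singleton_self _)
    obtain ⟨a, b, hab⟩ := h'.spans (coordVec x e (φ.symm z))
    obtain ⟨a', b', hab'⟩ := h'.spans (coordVec x Y (φ.symm z))
    have k1 := key e
    have k2 := key Y
    rw [hab, map_add, map_smul, map_smul, hX', smul_zero, zero_add] at k1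
    rw [hab', map_add, map_smul, map_smul, hX', smul_zero, zero_add] at k2
    rw [← k2, map_smul, smul_eq_mul] at hz
    rw [← k1, map_smul, smul_eq_mul, mul_eq_zero] at he
    rw [← k1, he.resolve_right (right_ne_zero_of_mul hz), zero_smul]
  obtain ⟨γ, ε, hε, hγ, hγN, hfac⟩ := exists_factor_of_rank_one hgs hker ⟨Y, hYd⟩ hN
  have hgx : g (φ x) = l x := by simp only [hg, hx]
  rw [hgx] at hγ hγN
  refine ⟨A, γ, ε, hε, hγ, fun t ht => ?_, ?_⟩
  · obtain ⟨z, hz, hzt⟩ := hγN t ht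
    rw [← hzt]; exact hz
  · have hcφ : ContinuousAt φ x := continuousAt_extChartAt x
    filter_upwards [hcφ.eventually hfac, extChartAt_source_mem_nhds (I := 𝓡 2) x] with y h1 h2
    simp only [hg, φ.left_inv h2] at h1
    exact h1

/-- Local parallel transport for `D^L` exists. -/
theorem IsUnitSection.exists_transport {l : M → R42} (hl : IsUnitSection f L T x l)
    (hf : IsLegendreOn univ f) (humb : IsUmbilicFreeOn univ f)
    (hT : ∀ x, T x ∈ curvatureDirections f x) : ∃ Ψ, IsTransport l x Ψ := by
  obtain ⟨A, γ, ε, hε, hγ, hu, hfac⟩ := hl.exists_factor hf humb hT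
  obtain ⟨δ, hδ, hδε, Φ, hΦ0, hΦ, hΦd, hiso, hunit⟩ := exists_parallel_transport hε hγ hu
  have hv : SmoothNear (fun y => A (l y)) x := hl.smooth.clm A
  have hball : ∀ᶠ y in 𝓝 x, A (l y) ∈ Metric.ball (A (l x)) δ :=
    hv.continuousAt.eventually (Metric.ball_mem_nhds _ hδ)
  have hx := hfac.self_of_nhds
  -- The transport is that of the curve, pulled back by `A ∘ l`; its equation follows from the chain
  -- rule applied to Φ and to l = γ ∘ A ∘ l.
  refine ⟨fun y => Φ (A (l y)), ?_, hΦ0, ?_, ?_, ?_⟩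
  · refine SmoothNear.comp ?_ hv
    filter_upwards [Metric.ball_mem_nhds _ hδ] with t ht
    exact hΦ.contDiffAt (Metric.isOpen_ball.mem_nhds ht)
  · filter_upwards [hball, eventually_eventually_nhds.2 hfac, hl.smooth.eventually]
      with y h1 h2 h3 u Z
    have hvy : SmoothNear (fun y => A (l y)) y := h3.clm A
    have d1 : HasDerivAt (fun t => Φ t u)
        (wedge (γ (A (l y))) (deriv γ (A (l y))) (Φ (A (l y)) u)) (A (l y)) := by
      simpa using (hΦd _ h1).clm_apply (hasDerivAt_const _ u)
    have d2 : HasDerivAt γ (deriv γ (A (l y))) (A (l y)) :=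
      ((hγ.contDiffAt (Metric.isOpen_ball.mem_nhds (Metric.ball_subset_ball hδε h1))
        ).differentiableAt (by simp)).hasDerivAt
    have e1 := drv_comp (φ := fun t => Φ t u) (g := fun y => A (l y)) d1.differentiableAt hvy Z
    have e2 := drv_comp (φ := γ) (g := fun y => A (l y)) d2.differentiableAt hvy Z
    rw [d1.hasFDerivAt.fderiv, ContinuousLinearMap.toSpanSingleton_apply, wedge_apply] at e1
    rw [d2.hasFDerivAt.fderiv, ContinuousLinearMap.toSpanSingleton_apply] at e2
    have e3 : drv l y Z = drv (fun y => A (l y)) y Z • deriv γ (A (l y)) := by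
      rw [← e2]; exact congrArg (fun D => D Z) (drv_congr h2)
    have hy : γ (A (l y)) = l y := h2.self_of_nhds.symm
    rw [hy] at e1
    rw [e1, e3, map_smul, smul_eq_mul]
    module
  · filter_upwards [hball] with y h1 using hiso _ h1
  · filter_upwards [hball, hfac] with y h1 h2 u
    have := hunit _ h1 u
    rwa [← h2, ← hx] at this

/-- `D^L` is flat. -/
theorem IsSphereComplexAlong.isFlat (hL : IsSphereComplexAlong f T L)
    (hf : IsLegendreOn univ f) (humb : IsUmbilicFreeOn univ f)
    (hT : ∀ x, T x ∈ curvatureDirections f x) : IsFlat L := by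
  intro x
  obtain ⟨l, hl⟩ := hL.exists_unitSection x
  obtain ⟨Ψ, hΨ⟩ := hl.exists_transport hf humb hT
  obtain ⟨W, hW, hWo, hxW⟩ := eventually_nhds_iff.1
    (hΨ.smooth.eventually.and (hΨ.drv_eq.and hl.eventually))
  have hs : ∀ w : R42, ∀ y ∈ W, SmoothNear (fun z => Ψ z w) y := fun w y hy =>
    (hW y hy).1.clm (ContinuousLinearMap.apply ℝ R42 w)
  refine ⟨W, hWo, hxW, fun w => ⟨fun y => Ψ y w, by change Ψ x w = w; rw [hΨ.map_self]; rfl,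
    fun y hy => (hs w y hy).self.contMDiffWithinAt, fun y hy Z => ?_⟩⟩
  rw [(hW y hy).2.2.connD_eq (hs w y hy), (hW y hy).2.1 w Z]
  abel

end Transport

/-! ### Three-parameter families of null vectors -/

section NullFamily

theorem three_le_finrank_perp (u v w : R42) :
    3 ≤ Module.finrank ℝ (perp (Submodule.span ℝ {u, v, w})) := by
  classical
  have h : Module.finrank ℝ (Submodule.span ℝ {u, v, w}) ≤ 3 := by
    have h1 := finrank_span_finset_le_card (R := ℝ) ({u, v, w} : Finset R42)
    have h2 : ({u, v, w} : Finset R42).card ≤ 3 := Finset.card_le_three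
    simp only [Finset.coe_insert, Finset.coe_singleton] at h1
    exact h1.trans h2
  rw [finrank_perp]
  omega

theorem mem_perp_span_triple {u v w z : R42} (h : z ∈ perp (Submodule.span ℝ {u, v, w})) :
    form z u = 0 ∧ form z v = 0 ∧ form z w = 0 := by
  refine ⟨?_, ?_, ?_⟩ <;> rw [form_comm] <;> exact h _ (Submodule.subset_span (by simp))

variable {l σ d : R42}

/-- A null vector orthogonal to `l` and to neither `σ` nor `d`. -/
theorem exists_null_vector (hσ : form σ σ = 0) (hσl : form σ l = 0) (hdl : form d l = 0)
    (hdσ : form d σ ≠ 0) : ∃ n : R42, form n n = 0 ∧ form n l = 0 ∧ form n σ = form d σ ∧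
      form n d ≠ 0 := by
  set c := form d σ with hc
  have hσd : form σ d = c := form_comm _ _
  -- Subtracting this multiple of the null vector `σ` makes `d` null without changing its product
  -- with `σ`.
  set n := d - (form d d / (2 * c)) • σ with hn
  have hnn : form n n = 0 := by
    simp only [hn, map_sub, map_smul, LinearMap.sub_apply, LinearMap.smul_apply, smul_eq_mul, hσ,
      ← hc, hσd]
    field_simp; ring
  have hnl : form n l = 0 := by
    simp only [hn, map_sub, map_smul, LinearMap.sub_apply, LinearMap.smul_apply, smul_eq_mul, hσl,
      hdl]
    ring
  have hnσ : form n σ = c := by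
    simp only [hn, map_sub, map_smul, LinearMap.sub_apply, LinearMap.smul_apply, smul_eq_mul, hσ,
      ← hc]
    ring
  have hnd : form n d = form d d / 2 := by
    simp only [hn, map_sub, map_smul, LinearMap.sub_apply, LinearMap.smul_apply, smul_eq_mul, hσd]
    field_simp; ring
  by_cases hdd : form d d = 0
  -- If `d` is null, then `n = d` pairs to zero with `d`. Moving along a spacelike `u` and restoring
  -- nullity with `σ` gives the product -(u, u)/2 with `d`.
  · obtain ⟨u, hu, hu0⟩ : ∃ u ∈ perp (Submodule.span ℝ {n, σ, l}), 0 < form u u := by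
      by_contra! h
      have := finrank_le_two_of_nonpos h
      have := three_le_finrank_perp n σ l
      omega
    obtain ⟨h1, h2, h3⟩ := mem_perp_span_triple hu
    have hdn : d = n := by rw [hn, hdd, zero_div, zero_smul, sub_zero]
    have hnu : form n u = 0 := by rw [form_comm, h1]
    have hσu : form σ u = 0 := by rw [form_comm, h2]
    have hσn : form σ n = c := by rw [form_comm, hnσ]
    refine ⟨n + u - (form u u / (2 * c)) • σ, ?_, ?_, ?_, ?_⟩
    · simp only [map_sub, map_add, map_smul, LinearMap.sub_apply, LinearMap.add_apply,
        LinearMap.smul_apply, smul_eq_mul, hσ, hnn, h1, h2, hnσ, hnu, hσu, hσn]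
      field_simp; ring
    · simp only [map_sub, map_add, map_smul, LinearMap.sub_apply, LinearMap.add_apply,
        LinearMap.smul_apply, smul_eq_mul, hσl, hnl, h3]
      ring
    · simp only [map_sub, map_add, map_smul, LinearMap.sub_apply, LinearMap.add_apply,
        LinearMap.smul_apply, smul_eq_mul, hσ, hnσ, h2]
      ring
    · rw [hdn]
      simp only [map_sub, map_add, map_smul, LinearMap.sub_apply, LinearMap.add_apply,
        LinearMap.smul_apply, smul_eq_mul, hnn, h1, hσn]
      field_simp
      linarith
  · exact ⟨n, hnn, hnl, hnσ, by rw [hnd]; exact div_ne_zero hdd two_ne_zero⟩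

/-- A three-parameter family of null vectors orthogonal to `l`, with constant product with `σ`. -/
structure IsNullFamily (l σ d : R42) (w : EuclideanSpace ℝ (Fin 3) → R42) : Prop where
  smooth : ContDiff ℝ ∞ w
  null : ∀ a, form (w a) (w a) = 0
  normal : ∀ a, form (w a) l = 0
  form_eq : ∀ a, form (w a) σ = form d σ
  form_ne_zero : form (w 0) d ≠ 0
  eq_of_smul : ∀ a b (k : ℝ), w b = k • w a → a = b
  eq_zero_of_fderiv : ∀ a ξ (k : ℝ), fderiv ℝ w a ξ = k • w a → ξ = 0

/-- The usual paraboloid chart of a quadric: start at a null vector `n`, move by `ι a` orthogonally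
to `n`, `σ` and `l`, and correct by a quadratic multiple of `σ`. The product with `σ` is constant,
which excludes rescaling and makes the lines, not only the vectors, depend effectively on the
parameter. -/
theorem exists_nullFamily (hσ : form σ σ = 0) (hσl : form σ l = 0) (hdl : form d l = 0)
    (hdσ : form d σ ≠ 0) : ∃ w, IsNullFamily l σ d w := by
  obtain ⟨n, hnn, hnl, hnσ, hnd⟩ := exists_null_vector hσ hσl hdl hdσ
  obtain ⟨v, hv⟩ := exists_linearIndependent_of_le_finrank (three_le_finrank_perp n σ l)
  let ι : EuclideanSpace ℝ (Fin 3) →L[ℝ] R42 := LinearMap.toContinuousLinearMap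
    ((Submodule.subtype _).comp ((Fintype.linearCombination ℝ v).comp
      (WithLp.linearEquiv 2 ℝ (Fin 3 → ℝ)).toLinearMap))
  have hι : Function.Injective ι := Subtype.val_injective.comp
    ((linearIndependent_iff_injective_fintypeLinearCombination.1 hv).comp
      (WithLp.linearEquiv 2 ℝ (Fin 3 → ℝ)).injective)
  have hιm : ∀ a, form (ι a) n = 0 ∧ form (ι a) σ = 0 ∧ form (ι a) l = 0 := fun a =>
    mem_perp_span_triple (Subtype.property
      (Fintype.linearCombination ℝ v (WithLp.linearEquiv 2 ℝ (Fin 3 → ℝ) a)))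
  set c := form d σ with hc
  have hσn : form σ n = c := by rw [form_comm, hnσ]
  -- `ι ξ` is orthogonal to `n`, while `(σ, n) ≠ 0`. Injectivity and immersivity both reduce to
  -- this.
  have hzero : ∀ ξ (t : ℝ), ι ξ = t • σ → ξ = 0 := fun ξ t ht => by
    have h1 := (hιm ξ).1
    rw [ht, map_smul, LinearMap.smul_apply, hσn, smul_eq_mul, mul_eq_zero] at h1
    rw [h1.resolve_right hdσ, zero_smul] at ht
    exact hι (by rw [ht, map_zero])
  set q : EuclideanSpace ℝ (Fin 3) → ℝ := fun a => form (ι a) (ι a) / (2 * c) with hq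
  have sq : ContDiff ℝ ∞ q :=
    ((formL.contDiff.comp ι.contDiff).clm_apply ι.contDiff).div_const _
  have hwσ : ∀ a, form (n + ι a - q a • σ) σ = c := fun a => by
    simp only [map_sub, map_add, map_smul, LinearMap.sub_apply, LinearMap.add_apply,
      LinearMap.smul_apply, smul_eq_mul, hσ, hnσ, (hιm a).2.1]
    ring
  refine ⟨fun a => n + ι a - q a • σ, ⟨(contDiff_const.add ι.contDiff).sub (sq.smul contDiff_const),
    fun a => ?_, fun a => ?_, hwσ, ?_, fun a b k h => ?_, fun a ξ k h => ?_⟩⟩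
  · have h1 : form n (ι a) = 0 := by rw [form_comm, (hιm a).1]
    have h2 : form σ (ι a) = 0 := by rw [form_comm, (hιm a).2.1]
    simp only [map_sub, map_add, map_smul, LinearMap.sub_apply, LinearMap.add_apply,
      LinearMap.smul_apply, smul_eq_mul, hσ, hnσ, hnn, hσn, h1, h2, (hιm a).1, (hιm a).2.1, hq]
    field_simp; ring
  · simp only [map_sub, map_add, map_smul, LinearMap.sub_apply, LinearMap.add_apply,
      LinearMap.smul_apply, smul_eq_mul, hσl, hnl, (hιm a).2.2]
    ring
  · simpa [hq] using hnd
  · have h1 := hwσ b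
    change n + ι b - q b • σ = k • (n + ι a - q a • σ) at h
    rw [h, map_smul, LinearMap.smul_apply, hwσ a, smul_eq_mul] at h1
    have hk : k = 1 := mul_right_cancel₀ hdσ (by rw [h1, one_mul])
    rw [hk, one_smul] at h
    have h2 := hzero (a - b) (q a - q b) (by
      rw [map_sub, sub_smul]
      rw [← sub_eq_zero] at h ⊢
      rw [← neg_eq_zero, ← h]; abel)
    exact sub_eq_zero.1 h2
  · have hd : HasFDerivAt (fun a => n + ι a - q a • σ)
        (ι - (fderiv ℝ q a).smulRight σ) a :=
      (ι.hasFDerivAt.const_add n).sub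
        (((sq.differentiable (by simp)) a).hasFDerivAt.smul_const σ)
    rw [hd.fderiv] at h
    change ι ξ - fderiv ℝ q a ξ • σ = k • (n + ι a - q a • σ) at h
    have h1 : form (ι ξ - fderiv ℝ q a ξ • σ) σ = form (k • (n + ι a - q a • σ)) σ := by rw [h]
    rw [map_smul form k, LinearMap.smul_apply, hwσ a, map_sub, LinearMap.sub_apply, (hιm ξ).2.1, map_smul,
      LinearMap.smul_apply, hσ, smul_zero, sub_zero, smul_eq_mul, eq_comm, mul_eq_zero] at h1
    rw [h1.resolve_right hdσ, zero_smul, sub_eq_zero] at h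
    exact hzero ξ _ h

end NullFamily

/-! ### Transported null lines -/

section Family

variable {M : Type*} [TopologicalSpace M] [ChartedSpace (EuclideanSpace ℝ (Fin 2)) M]
  {f g L : M → Submodule ℝ R42} {T : ∀ x : M, Submodule ℝ (TangentSpace (𝓡 2) x)} {x y : M}
  {U : Set M}

/-- Independence at nearby points comes from the rank of the bundle, not from an openness argument.
-/
theorem IsFrameNear.eventually {σ τ : M → R42} (h : IsFrameNear f x σ τ)
    (hf : ∀ y, Module.finrank ℝ (f y) = 2) : ∀ᶠ y in 𝓝 x, IsFrameNear f y σ τ := by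
  filter_upwards [h.smooth_left.eventually, h.smooth_right.eventually,
    eventually_eventually_nhds.2 h.span_eq] with y h1 h2 h3
  exact ⟨h1, h2, h3, linearIndependent_pair_of_finrank (hf y) h3.self_of_nhds⟩

/-- Given a frame of `f` with derivatives `a`, `b` along a direction, a vector spanning the
curvature sphere belonging to that direction. -/
def curvatureVector (σ τ a b : R42) : R42 := form b b • σ - form a b • τ

/-- The curvature sphere with curvature space containing `Z`. -/
theorem IsCurvatureSphere.exists_eq_smul {c : Submodule ℝ R42} (hc : IsCurvatureSphere f y c)
    (hf : IsContactAt f y) {σ τ : M → R42} (h : IsFrameNear f y σ τ) {Z : TangentSpace (𝓡 2) y}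
    (hZ : Z ∈ curvatureSpace f y c) (hb : form (drv τ y Z) (drv τ y Z) ≠ 0) :
    ∃ v ∈ c, ∃ α : ℝ, α ≠ 0 ∧
      v = α • curvatureVector (σ y) (τ y) (drv σ y Z) (drv τ y Z) := by
  have hne : c ≠ ⊥ := by
    rintro rfl
    have := hc.rank_one
    rw [finrank_bot] at this
    exact zero_ne_one this
  obtain ⟨v, hv, hv0⟩ := Submodule.exists_mem_ne_zero_of_ne_bot hne
  have hvf := hc.le hv
  rw [h.span_eq.self_of_nhds] at hvf
  obtain ⟨α, β, rfl⟩ := Submodule.mem_span_pair.1 hvf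
  have hs := (h.left.const_smul α).add (h.right.const_smul β)
  have h1 : drv (fun z => α • σ z + β • τ z) y Z ∈ f y := hZ _ hs hv
  rw [drv_add (h.left.const_smul α).smoothNear (h.right.const_smul β).smoothNear,
    drv_const_smul α h.smooth_left, drv_const_smul β h.smooth_right] at h1
  have h2 := hf.contact _ h.right Z _ h1
  rw [map_add, map_smul, map_smul, LinearMap.add_apply, LinearMap.smul_apply, LinearMap.smul_apply,
    smul_eq_mul, smul_eq_mul] at h2
  -- For a generator `α σ + β τ` of `c`, pairing its derivative, which lies in `f`, with `d_Z τ ∈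
  -- f^⊥` determines the ratio of the coefficients.
  have hβ : β = -(α * form (drv σ y Z) (drv τ y Z)) / form (drv τ y Z) (drv τ y Z) := by
    rw [eq_div_iff hb]; linarith
  refine ⟨_, Submodule.smul_mem _ (form (drv τ y Z) (drv τ y Z)) hv, α, ?_, ?_⟩
  · rintro rfl
    rw [zero_mul, neg_zero, zero_div] at hβ
    rw [hβ, zero_smul, zero_smul, add_zero] at hv0
    exact hv0 rfl
  · rw [curvatureVector, smul_add, smul_sub, smul_smul, smul_smul, smul_smul, smul_smul, hβ,
      mul_div_cancel₀ _ hb]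
    module

theorem IsFrameNear.curvatureVector_mem {σ τ : M → R42} (h : IsFrameNear f y σ τ) (a b : R42) :
    curvatureVector (σ y) (τ y) a b ∈ f y :=
  sub_mem (Submodule.smul_mem _ _ h.left.mem_self) (Submodule.smul_mem _ _ h.right.mem_self)

/-- Parallel transport for `D^L` on an open set. -/
structure IsTransportOn (f L : M → Submodule ℝ R42)
    (T : ∀ x : M, Submodule ℝ (TangentSpace (𝓡 2) x)) (l : M → R42) (x : M)
    (Ψ : M → R42 →L[ℝ] R42) (U : Set M) : Prop where
  isOpen : IsOpen U
  unit : ∀ y ∈ U, IsUnitSection f L T y l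
  smooth : ∀ y ∈ U, SmoothNear Ψ y
  drv_eq : ∀ y ∈ U, ∀ (u : R42) (Z : TangentSpace (𝓡 2) y), drv (fun z => Ψ z u) y Z =
    form (Ψ y u) (l y) • drv l y Z - form (Ψ y u) (drv l y Z) • l y
  isometry : ∀ y ∈ U, ∀ u v, form (Ψ y u) (Ψ y v) = form u v
  form_unit : ∀ y ∈ U, ∀ u, form (Ψ y u) (l y) = form u (l x)

namespace IsTransportOn

variable {l : M → R42} {Ψ : M → R42 →L[ℝ] R42}

theorem injective (h : IsTransportOn f L T l x Ψ U) (hy : y ∈ U) : Function.Injective (Ψ y) := by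
  intro u v huv
  rw [← sub_eq_zero]
  refine form_nondegenerate.1 _ fun z => ?_
  rw [← h.isometry y hy, map_sub, huv, sub_self, map_zero, LinearMap.zero_apply]

theorem smooth_apply (h : IsTransportOn f L T l x Ψ U) (hy : y ∈ U) (u : R42) :
    SmoothNear (fun z => Ψ z u) y :=
  (h.smooth y hy).clm (ContinuousLinearMap.apply ℝ R42 u)

/-- Transport preserves the form and products with `l`, so being null and orthogonal to `l` need
only be imposed on the initial vector. -/
theorem isParallelNullLineOn (h : IsTransportOn f L T l x Ψ U) {u : R42} (h0 : u ≠ 0)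
    (hu : form u u = 0) (hul : form u (l x) = 0) :
    IsParallelNullLineOn U L (fun y => Submodule.span ℝ {Ψ y u}) := by
  have hne : ∀ y ∈ U, Ψ y u ≠ 0 := fun y hy hz =>
    h0 (h.injective hy (by rw [hz, map_zero]))
  refine ⟨isSubbundleOn_one_of_section fun y hy => ⟨_, h.smooth_apply hy u, ?_⟩, fun y hy => ?_,
    fun y hy ρ hρ Z => ?_, fun y hy => ?_⟩
  · filter_upwards [h.isOpen.mem_nhds hy] with z hz using ⟨hz, rfl, hne z hz⟩
  · rw [IsNull, Submodule.span_singleton_le_iff_mem, mem_perp_span_singleton, h.isometry y hy, hu]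
  · have hl := h.unit y hy
    obtain ⟨a, ha, he⟩ := exists_coeff_of_line (h.smooth_apply hy u) (hne y hy)
      (Filter.Eventually.of_forall fun _ => rfl) hρ
    have hwl : form (Ψ y u) (l y) = 0 := by rw [h.form_unit y hy, hul]
    refine Submodule.mem_span_singleton.2 ⟨drv a y Z, ?_⟩
    rw [hl.connD_eq hρ.smoothNear, drv_congr he, drv_smul ha (h.smooth_apply hy u),
      h.drv_eq y hy, he.self_of_nhds, hwl, map_smul, LinearMap.smul_apply, LinearMap.smul_apply,
      hwl, smul_eq_mul]
    module
  · rw [(h.unit y hy).span_eq.self_of_nhds, Submodule.span_singleton_le_iff_mem,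
      mem_perp_span_singleton, form_comm, h.form_unit y hy, hul]

/-- A parallel section varies in directions where it is not orthogonal to `dl`. -/
theorem drv_notMem (h : IsTransportOn f L T l x Ψ U) (hy : y ∈ U) {u : R42}
    (hul : form u (l x) = 0) {V : TangentSpace (𝓡 2) y} (hV : form (Ψ y u) (drv l y V) ≠ 0) :
    drv (fun z => Ψ z u) y V ∉ Submodule.span ℝ {Ψ y u} := by
  have hwl : form (Ψ y u) (l y) = 0 := by rw [h.form_unit y hy, hul]
  rw [h.drv_eq y hy, hwl, zero_smul, zero_sub]
  intro hm
  obtain ⟨k, hk⟩ := Submodule.mem_span_singleton.1 hm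
  have h1 : form (k • Ψ y u) (l y) = form (-(form (Ψ y u) (drv l y V) • l y)) (l y) := by rw [hk]
  rw [map_smul, map_neg, map_smul, LinearMap.smul_apply, LinearMap.neg_apply, LinearMap.smul_apply,
    hwl, (h.unit y hy).unit.self_of_nhds, smul_zero, smul_eq_mul, mul_one] at h1
  exact hV (neg_eq_zero.1 h1.symm)

theorem isThreeParameterFamilyOn (h : IsTransportOn f L T l x Ψ U) {σ d : R42}
    {w : EuclideanSpace ℝ (Fin 3) → R42} (hw : IsNullFamily (l x) σ d w)
    (hdσ : form d σ ≠ 0) (Ω : Set (EuclideanSpace ℝ (Fin 3))) :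
    IsThreeParameterFamilyOn Ω U (fun a y => Ψ y (w a)) := by
  refine ⟨?_, fun a _ y hy hz => ?_, fun a _ y hy ξ hξ => ?_⟩
  · have h1 : ContMDiffOn (𝓡 2) 𝓘(ℝ, R42 →L[ℝ] R42) ∞ Ψ U := fun y hy =>
      (h.smooth y hy).self.contMDiffWithinAt
    have h2 := h1.comp (contMDiffOn_snd (I := 𝓘(ℝ, EuclideanSpace ℝ (Fin 3)))
      (s := Ω ×ˢ U)) (fun q hq => hq.2)
    have h3 := hw.smooth.contMDiff.comp_contMDiffOn (contMDiffOn_fst (J := 𝓡 2)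
      (I := 𝓘(ℝ, EuclideanSpace ℝ (Fin 3))) (s := Ω ×ˢ U))
    exact h2.clm_apply h3
  · have h1 : w a = 0 := h.injective hy (by rw [map_zero]; exact hz)
    have h2 := hw.form_eq a
    rw [h1, map_zero, LinearMap.zero_apply] at h2
    exact hdσ h2.symm
  · obtain ⟨k, hk⟩ := Submodule.mem_span_singleton.1 hξ
    have hd : HasFDerivAt (fun b => Ψ y (w b)) ((Ψ y).comp (fderiv ℝ w a)) a :=
      (Ψ y).hasFDerivAt.comp a ((hw.smooth.differentiable (by simp)) a).hasFDerivAt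
    rw [hd.fderiv, ← map_smul] at hk
    exact hw.eq_zero_of_fderiv a ξ k (h.injective hy hk).symm

end IsTransportOn

theorem IsTransport.exists_isTransportOn {l : M → R42} {Ψ : M → R42 →L[ℝ] R42}
    (h : IsTransport l x Ψ) (hl : IsUnitSection f L T x l) {S : Set M} (hS : S ∈ 𝓝 x) :
    ∃ U ⊆ S, x ∈ U ∧ IsTransportOn f L T l x Ψ U := by
  obtain ⟨U, hU, hUo, hx⟩ := eventually_nhds_iff.1 ((hl.eventually.and h.smooth.eventually).and
    ((h.drv_eq.and h.isometry).and (h.form_unit.and hS)))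
  exact ⟨U, fun y hy => (hU y hy).2.2.2, hx, hUo, fun y hy => (hU y hy).1.1,
    fun y hy => (hU y hy).1.2, fun y hy => (hU y hy).2.1.1, fun y hy => (hU y hy).2.1.2,
    fun y hy => (hU y hy).2.2.1⟩

theorem IsSectionNear.congr {σ : M → R42} (h : IsSectionNear f x σ)
    (e : ∀ᶠ y in 𝓝 x, f y = g y) : IsSectionNear g x σ :=
  ⟨h.smooth, by filter_upwards [h.mem, e] with y h1 h2; rwa [← h2]⟩

/-- Curvature spaces depend only on the germ of the bundle, so transforms that agree merely on an
open set can be compared there. -/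
theorem curvatureSpace_congr (e : ∀ᶠ y in 𝓝 x, f y = g y) (s : Submodule ℝ R42) :
    curvatureSpace f x s = curvatureSpace g x s := by
  have key : ∀ {f g : M → Submodule ℝ R42}, (∀ᶠ y in 𝓝 x, f y = g y) →
      curvatureSpace f x s ≤ curvatureSpace g x s := fun {f g} e X hX σ hσ hs => by
    rw [← e.self_of_nhds]
    exact hX σ (hσ.congr (e.mono fun _ h => h.symm)) hs
  exact le_antisymm (key e) (key (e.mono fun _ h => h.symm))

theorem IsCurvatureSphere.congr {s : Submodule ℝ R42} (h : IsCurvatureSphere f x s)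
    (e : ∀ᶠ y in 𝓝 x, f y = g y) : IsCurvatureSphere g x s :=
  ⟨h.rank_one, by rw [← e.self_of_nhds]; exact h.le, by
    rw [← curvatureSpace_congr e]; exact h.space_ne_bot⟩

/-- The null line is determined by the transform near `x`. -/
theorem IsTransformData.eq_of_transform_eq {s s' : M → Submodule ℝ R42} {l w σ τ l' w' σ' τ' : M → R42}
    {X Y X' Y' : TangentSpace (𝓡 2) x} (h : IsTransformData f L s T x l w σ τ X Y)
    (h' : IsTransformData f L s' T x l' w' σ' τ' X' Y')
    (hX : Submodule.span ℝ {X} = Submodule.span ℝ {X'})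
    (e : ∀ᶠ y in 𝓝 x, transform f s y = transform f s' y) : s x = s' x := by
  obtain ⟨m, hm⟩ := h.transform_curvatureFrame
  obtain ⟨m', hm'⟩ := h'.transform_curvatureFrame
  rw [h.span_eq.self_of_nhds.1, h'.span_eq.self_of_nhds.1]
  refine hm'.eq_left_of_curvatureSpace h'.transform_isContactAt
    ((hm.isCurvatureSphere_left h.transform_isContactAt).congr e) ?_
  rw [← curvatureSpace_congr e, hm.curvatureSpace_left h.transform_isContactAt, hX]

variable [IsManifold (𝓡 2) ∞ M]

/-- A derivative of a smooth map at `x` extends continuously to nearby derivatives. -/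
theorem SmoothNear.exists_continuousAt_drv {F : Type*} [NormedAddCommGroup F] [NormedSpace ℝ F]
    {g : M → F} (hg : SmoothNear g x) (Y : TangentSpace (𝓡 2) x) :
    ∃ D : M → F, ContinuousAt D x ∧ D x = drv g x Y ∧ ∀ᶠ y in 𝓝 x, ∃ V, drv g y V = D y := by
  set φ := extChartAt (𝓡 2) x with hφ
  set G := fun z => g (φ.symm z) with hG
  have hc : ContinuousAt (fderiv ℝ G) (φ x) :=
    (hg.contDiffAt_chart.self_of_nhds.fderiv_right (m := 0) (by simp)).continuousAt
  have hc' : ContinuousAt (fun y => fderiv ℝ G (φ y)) x :=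
    ContinuousAt.comp (f := φ) hc (continuousAt_extChartAt x)
  refine ⟨fun y => fderiv ℝ G (φ y) Y, hc'.clm_apply continuousAt_const,
    (drv_self_chart hg Y).symm, ?_⟩
  filter_upwards [hg.eventually, (chartAt (EuclideanSpace ℝ (Fin 2)) x).open_source.mem_nhds
    (mem_chart_source _ x)] with y h1 h2
  have key : ∀ e : EuclideanSpace ℝ (Fin 2),
      drv g y (coordVec x e y) = fderiv ℝ G (φ y) e := fun e => by
    rw [drv_eq_fderiv_chart h2 h1, drv_extChartAt_coordVec h2]
  exact ⟨_, key Y⟩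

end Family

/-! ### Local families in general position -/

section Existence

variable {M : Type*} [TopologicalSpace M] [ChartedSpace (EuclideanSpace ℝ (Fin 2)) M]
  [IsManifold (𝓡 2) ∞ M] {f L : M → Submodule ℝ R42}
  {T : ∀ x : M, Submodule ℝ (TangentSpace (𝓡 2) x)}

/-- Near every point there is a family of parallel null lines in general position. -/
theorem exists_transport_family (hf : IsLegendreOn univ f) (humb : IsUmbilicFreeOn univ f)
    (hT : ∀ x, T x ∈ curvatureDirections f x) (hTd : IsLineDistribution T)
    (hL : IsSphereComplexAlong f T L) (x : M) :
    ∃ (l : M → R42) (Ψ : M → R42 →L[ℝ] R42) (σ d : R42) (w : EuclideanSpace ℝ (Fin 3) → R42)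
      (U : Set M) (Ω : Set (EuclideanSpace ℝ (Fin 3))),
      Ψ x = ContinuousLinearMap.id ℝ R42 ∧ form d σ ≠ 0 ∧ IsNullFamily (l x) σ d w ∧ x ∈ U ∧
      IsTransportOn f L T l x Ψ U ∧ IsOpen Ω ∧ Ω.Nonempty ∧ ∀ a ∈ Ω, ∀ y ∈ U,
        Submodule.span ℝ {Ψ y (w a)} ⊓ f y = ⊥ ∧
        (∀ c, IsCurvatureSphere f y c → curvatureSpace f y c = T y →
          ¬ c ≤ perp (Submodule.span ℝ {Ψ y (w a)})) ∧
        ∃ V : TangentSpace (𝓡 2) y,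
          drv (fun z => Ψ z (w a)) y V ∉ Submodule.span ℝ {Ψ y (w a)} := by
  obtain ⟨l, hl⟩ := hL.exists_unitSection x
  obtain ⟨Ψ, hΨ⟩ := hl.exists_transport hf humb hT
  obtain ⟨σ, τ, X, Y, h, hTX⟩ := exists_curvatureFrame hf humb (hT x)
  obtain ⟨W, hW, hxW, Z, hZ, hTZ⟩ := hTd x
  have hfx := hf.isContactAt (mem_univ x)
  have hX : X ∈ T x := by rw [hTX]; exact Submodule.mem_span_singleton_self _
  have hdσ : form (drv l x Y) (σ x) ≠ 0 := by
    rw [hl.form_drv_unit h.frame.left]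
    exact neg_ne_zero.2 (hl.form_drv_ne_zero hfx h hX)
  have hdl : form (drv l x Y) (l x) = 0 := by
    have := form_drv_add_eq_zero hl.smooth hl.smooth hl.unit Y
    rw [form_comm (l x)] at this
    linarith
  have hσl : form (σ x) (l x) = 0 := hl.normal.self_of_nhds _ h.frame.left.mem_self
  obtain ⟨w, hw⟩ := exists_nullFamily (hfx.null h.frame.left.mem_self _ h.frame.left.mem_self)
    hσl hdl hdσ
  obtain ⟨D, hDc, hDx, hD⟩ := hl.smooth.exists_continuousAt_drv Y
  -- the curvature sphere congruence near `x`
  have hac := h.frame.smooth_left.continuousAt_drv hW hxW hZ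
  have hbc := h.frame.smooth_right.continuousAt_drv hW hxW hZ
  -- At `x` the cross term vanishes, so the curvature vector is a nonzero multiple of `σ`, whose
  -- product with `w 0` is nonzero.
  have hbb : form (drv τ x (Z x)) (drv τ x (Z x)) ≠ 0 ∧
      form (drv σ x (Z x)) (drv τ x (Z x)) = 0 := by
    have hZx : Z x ∈ Submodule.span ℝ {X} := by
      rw [← hTX, (hTZ x hxW).2]; exact Submodule.mem_span_singleton_self _
    obtain ⟨k, hk⟩ := Submodule.mem_span_singleton.1 hZx
    have hk0 : k ≠ 0 := by
      rintro rfl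
      exact (hTZ x hxW).1 (by rw [← hk, zero_smul])
    rw [← hk, map_smul, map_smul]
    constructor
    · rw [map_smul, LinearMap.smul_apply]
      exact smul_ne_zero hk0 (smul_ne_zero hk0 (h.swap.form_pos hfx).ne')
    · rw [map_smul, map_smul, map_smul, LinearMap.smul_apply,
        hfx.contact _ h.frame.right X _ h.drv_left, smul_zero, smul_zero]
  have hform : ∀ {P : Type _} [TopologicalSpace P] {u v : P → R42} {p : P}, ContinuousAt u p →
      ContinuousAt v p → ContinuousAt (fun q => form (u q) (v q)) p := fun hu hv =>
    (formL.continuous.continuousAt.comp hu).clm_apply hv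
  have hcv : ContinuousAt
      (fun y => curvatureVector (σ y) (τ y) (drv σ y (Z y)) (drv τ y (Z y))) x :=
    ((hform hbc hbc).smul h.frame.smooth_left.continuousAt).sub
      ((hform hac hbc).smul h.frame.smooth_right.continuousAt)
  have hwc : ContinuousAt (fun q : EuclideanSpace ℝ (Fin 3) × M => Ψ q.2 (w q.1)) (0, x) :=
    (ContinuousAt.comp (f := Prod.snd) (x := ((0 : EuclideanSpace ℝ (Fin 3)), x))
      hΨ.smooth.continuousAt continuousAt_snd).clm_apply
      (hw.smooth.continuous.continuousAt.comp continuousAt_fst)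
  have hΨx : Ψ x (w 0) = w 0 := by rw [hΨ.map_self]; rfl
  -- Nonorthogonality to the curvature vector, near `(0, x)`, yields both general position and
  -- trivial intersection with the null space `f`. The second condition `e2`, a nonzero product with
  -- a derivative of `l`, prevents stationarity.
  have e1 := (hform hwc (ContinuousAt.comp (f := Prod.snd)
    (x := ((0 : EuclideanSpace ℝ (Fin 3)), x)) hcv continuousAt_snd)).eventually_ne (y := 0) (by
      simp only [Function.comp_apply, curvatureVector, hbb.2, zero_smul, sub_zero, map_smul,
        smul_eq_mul, hΨx, hw.form_eq]
      exact mul_ne_zero hbb.1 hdσ)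
  have e2 := (hform hwc (ContinuousAt.comp (f := Prod.snd)
    (x := ((0 : EuclideanSpace ℝ (Fin 3)), x)) hDc continuousAt_snd)).eventually_ne (y := 0) (by
      simp only [Function.comp_apply, hΨx, hDx]
      exact hw.form_ne_zero)
  obtain ⟨Ω, S, hΩ, h0, hS, hxS, hΩS⟩ := mem_nhds_prod_iff'.1 (e1.and e2)
  have e3 : S ∩ W ∩ {y | IsFrameNear f y σ τ ∧ form (drv τ y (Z y)) (drv τ y (Z y)) ≠ 0 ∧
      ∃ V, drv l y V = D y} ∈ 𝓝 x := by
    filter_upwards [hS.mem_nhds hxS, hW.mem_nhds hxW,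
      h.frame.eventually fun y => hf.subbundle.1 y (mem_univ y),
      (hform hbc hbc).eventually_ne hbb.1, hD] with y h1 h2 h3 h4 h5
    exact ⟨⟨h1, h2⟩, h3, h4, h5⟩
  obtain ⟨U, hUS, hxU, hU⟩ := hΨ.exists_isTransportOn hl e3
  refine ⟨l, Ψ, σ x, drv l x Y, w, U, Ω, hΨ.map_self, hdσ, hw, hxU, hU, hΩ, ⟨0, h0⟩,
    fun a ha y hy => ?_⟩
  obtain ⟨⟨hyS, hyW⟩, hF, hb, V, hV⟩ := hUS hy
  obtain ⟨h1, h2⟩ := hΩS (mk_mem_prod ha hyS)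
  have hfy := hf.isContactAt (mem_univ y)
  simp only [Function.comp_apply] at h1 h2
  refine ⟨?_, fun c hc hcT hle => ?_, V, hU.drv_notMem hy (hw.normal a) (by rw [hV]; exact h2)⟩
  · rw [eq_bot_iff]
    rintro v ⟨hv, hvf⟩
    obtain ⟨k, rfl⟩ := Submodule.mem_span_singleton.1 hv
    have h3 := hfy.null (hF.curvatureVector_mem (drv σ y (Z y)) (drv τ y (Z y))) _ hvf
    rw [map_smul, LinearMap.smul_apply, smul_eq_mul, mul_eq_zero] at h3
    rw [h3.resolve_right h1, zero_smul]
    exact zero_mem _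
  · have hZy : Z y ∈ curvatureSpace f y c := by
      rw [hcT, (hTZ y hyW).2]; exact Submodule.mem_span_singleton_self _
    obtain ⟨v, hv, α, hα, he⟩ := hc.exists_eq_smul hfy hF hZy hb
    have h3 := mem_perp_span_singleton.1 (hle hv)
    rw [he, map_smul, smul_eq_mul] at h3
    exact (mul_ne_zero hα h1) h3

end Existence

end LieSphere

end

/-! ### Assembly of the theorem -/

theorem mainTheorem6 {M : Type*} [TopologicalSpace M]
    [ChartedSpace (EuclideanSpace ℝ (Fin 2)) M] [IsManifold (𝓡 2) ∞ M]
    (f : M → Submodule ℝ LieSphere.R42)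
    (hf : LieSphere.IsLegendreOn univ f)
    (humb : LieSphere.IsUmbilicFreeOn univ f)
    (hreg : LieSphere.IsRegular f)
    (T : ∀ x : M, Submodule ℝ (TangentSpace (𝓡 2) x))
    (hT : LieSphere.HasSphericalCurvatureLines f T) :
    ∃ L : M → Submodule ℝ LieSphere.R42,
      LieSphere.IsSphereComplexAlong f T L ∧
      (∀ L', LieSphere.IsSphereComplexAlong f T L' → L' = L) ∧
      LieSphere.IsFlat L ∧
      -- near every point there is a three-parameter family of such transforms
      (∀ x₀ : M, ∃ (U : Set M) (Ω : Set (EuclideanSpace ℝ (Fin 3)))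
          (w : EuclideanSpace ℝ (Fin 3) → M → LieSphere.R42),
        IsOpen U ∧ x₀ ∈ U ∧ IsOpen Ω ∧ Ω.Nonempty ∧
        LieSphere.IsThreeParameterFamilyOn Ω U w ∧
        (∀ a ∈ Ω,
          LieSphere.IsParallelNullLineOn U L (fun x => Submodule.span ℝ {w a x}) ∧
          (∀ x ∈ U, Submodule.span ℝ {w a x} ⊓ f x = ⊥) ∧
          LieSphere.IsChannelSurfaceOn U
            (LieSphere.transform f (fun x => Submodule.span ℝ {w a x})) ∧
          LieSphere.IsRibaucourPairOn U f
            (LieSphere.transform f (fun x => Submodule.span ℝ {w a x}))) ∧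
        ∀ a ∈ Ω, ∀ b ∈ Ω, a ≠ b → ∃ x ∈ U,
          LieSphere.transform f (fun y => Submodule.span ℝ {w a y}) x ≠
          LieSphere.transform f (fun y => Submodule.span ℝ {w b y}) x) ∧
      -- every parallel null line in general position gives such a transform
      ∀ (U : Set M) (s : M → Submodule ℝ LieSphere.R42), IsOpen U →
        LieSphere.IsParallelNullLineOn U L s →
        (∀ x ∈ U, ∀ c, LieSphere.IsCurvatureSphere f x c →
          LieSphere.curvatureSpace f x c = T x → ¬ c ≤ LieSphere.perp (s x)) →
        (∀ x ∈ U, ∃ (σ : M → LieSphere.R42) (X : TangentSpace (𝓡 2) x),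
          LieSphere.IsSectionNear s x σ ∧ LieSphere.dAt σ x X ∉ s x) →
        LieSphere.IsChannelSurfaceOn U (LieSphere.transform f s) ∧
        LieSphere.IsRibaucourPairOn U f (LieSphere.transform f s) := by
  obtain ⟨L, hL⟩ := hT.exists_sphereComplex hf humb hreg
  refine ⟨L, hL, fun L' h => hL.unique hf humb hreg hT.curvature h, hL.isFlat hf humb hT.curvature,
    fun x => ?_, fun U s hU hs hgen hst =>
      LieSphere.transform_isChannel_isRibaucour hf humb hT.curvature hL hU hs hgen hst⟩
  obtain ⟨l, Ψ, σ, d, w, U, Ω, hΨx, hdσ, hw, hxU, hΨ, hΩ, hΩn, hgen⟩ :=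
    LieSphere.exists_transport_family hf humb hT.curvature hT.distribution hL x
  have hfam := hΨ.isThreeParameterFamilyOn hw hdσ Ω
  have hpar : ∀ a, LieSphere.IsParallelNullLineOn U L
      (fun y => Submodule.span ℝ {Ψ y (w a)}) := fun a => by
    refine hΨ.isParallelNullLineOn (fun h0 => hdσ ?_) (hw.null a) (hw.normal a)
    rw [← hw.form_eq a, h0, map_zero, LinearMap.zero_apply]
  have hst : ∀ a ∈ Ω, ∀ y ∈ U, ∃ (ρ : M → LieSphere.R42) (V : TangentSpace (𝓡 2) y),
      LieSphere.IsSectionNear (fun z => Submodule.span ℝ {Ψ z (w a)}) y ρ ∧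
        LieSphere.dAt ρ y V ∉ Submodule.span ℝ {Ψ y (w a)} := fun a ha y hy => by
    obtain ⟨V, hV⟩ := (hgen a ha y hy).2.2
    exact ⟨_, V, ⟨hΨ.smooth_apply hy (w a),
      Filter.Eventually.of_forall fun z => Submodule.mem_span_singleton_self _⟩, hV⟩
  refine ⟨U, Ω, fun a y => Ψ y (w a), hΨ.isOpen, hxU, hΩ, hΩn, hfam, fun a ha =>
    ⟨hpar a, fun y hy => (hgen a ha y hy).1,
      LieSphere.transform_isChannel_isRibaucour hf humb hT.curvature hL hΨ.isOpen (hpar a)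
        (fun y hy => (hgen a ha y hy).2.1) (hst a ha)⟩, fun a ha b hb hab => ?_⟩
  by_contra! he
  have hdata := fun a (ha : a ∈ Ω) => LieSphere.exists_transformData hf humb hT.curvature hL
    hΨ.isOpen (hpar a) hxU (hgen a ha x hxU).2.1 (hst a ha x hxU)
  obtain ⟨_, _, _, _, X, _, h, hX⟩ := hdata a ha
  obtain ⟨_, _, _, _, X', _, h', hX'⟩ := hdata b hb
  -- Equal transforms have the same curvature sphere for `T`. At `x` the transport is the identity,
  -- so `w a` and `w b` span the same line.
  have hs := h.eq_of_transform_eq h' (hX.symm.trans hX')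
    (Filter.eventually_of_mem (hΨ.isOpen.mem_nhds hxU) he)
  have hm : w b ∈ Submodule.span ℝ {w a} := by
    simp only [hΨx, ContinuousLinearMap.id_apply] at hs
    rw [hs]
    exact Submodule.mem_span_singleton_self _
  obtain ⟨k, hk⟩ := Submodule.mem_span_singleton.1 hm
  exact hab (hw.eq_of_smul a b k hk.symm)
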